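/- Let $1\le K<M$, $N\ge 1$, $0<d\le\lambda/2$, and for $\theta\in[-\pi/2,\pi/2]$ put $\omega(\theta)=2\pi(d/\lambda)\sin\theta$ and $a(\theta)=[1,e^{-j\omega},\dots,e^{-j(M-1)\omega}]^T\in\mathbb C^M$, $a^{(1)}(\theta)=-[0,e^{-j\omega},2e^{-j2\omega},\dots,(M-1)e^{-j(M-1)\omega}]^T$ with $\omega=\omega(\theta)$. Let $\theta_1\le\dots\le\theta_K$ be DOAs in $[-\pi/2,\pi/2]$ whose steering vectors $a_k=a(\theta_k)$ are pairwise distinct, let $a_k^{(1)}=a^{(1)}(\theta_k)$, $\omega_k=\omega(\theta_k)$, $A=[a_1,\dots,a_K]$, and $P_A=A(A^HA)^{-1}A^H$. Let $S\in\mathbb C^{K\times K}$ be Hermitian positive definite, $\sigma>0$, $R=ASA^H+\sigma^2I_M$. Let $\mu_1\le\dots\le\mu_K$ be the $K$ largest eigenvalues of $R$ with orthonormal eigenvectors $e_1,\dots,e_K$, and let $P=\sum_k e_ke_k^H$, $P^\perp=I-P$, $V^\dagger=\sum_k(\mu_k-\sigma^2)^{-1}e_ke_k^H$ (the pseudo-inverse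 of $V=R-\sigma^2I=ASA^H$). For a Hermitian matrix $\hat R=R+\Delta R$ let $\hat\theta_1\le\dots\le\hat\theta_K$ be DOA estimates given by root-MUSIC: with $\hat G\hat G^H$ the projection onto the orthogonal complement of eigenvectors for the $K$ largest eigenvalues of $\hat R$, one selects the $K$ distinct roots of $a^T(z^{-1})\hat G\hat G^Ha(z)=0$, $a(z)=[1,z^{-1},\dots,z^{-(M-1)}]^T$, inside (or on) the unit circle that are closest to it, and $\hat\theta_k$ are the inverse sines of their angles times $\lambda/(2\pi d)$. Let $\hat\omega_k=\omega(\hat\theta_k)$, $\Delta\omega_k=\hat\omega_k-\omega_k$, let $\hat P_A$ be $P_A$ formed with $\hat\theta_k$ in place of $\theta_k$, $T=\hat P_A\hat R(I-\hat P_A)$ and, for $\gamma\in\mathbb R$, $\hat R^{(2)}=\hat R-\gamma(T+T^H)$. The subspace leakage of a Hermitian matrix is $\frac1K\sum_k\|P^\perp\hat e_k\|_2^2$, where $\hat e_1,\dots,\hat e_K$ are orthonormal eigenvectors for its $K$ largest eigenvalues. Write $dP=\sum_k\frac{\partial P_A}{\partial\omega_k}\Delta\omega_k$, $\rho_1=\frac1K\mathrm{Tr}\{V^\dagger\Delta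 R\,P^\perp\Delta R\,V^\dagger\}$, and $$F_\gamma=(1-\gamma)^2\rho_1+\frac{2(\gamma-\gamma^2)}{K}\mathrm{Re}\,\mathrm{Tr}\{V^\dagger\Delta R\,P^\perp dP\}+\frac{\gamma^2}{K}\mathrm{Tr}\{dP\,P^\perp dP\}.$$ (i) $P_A$, as a function of $(\omega_1,\dots,\omega_K)$, equals $P+dP+O(\|\Delta\omega\|^2)$ near the true values. (ii) Let $\rho_2=\frac1K\mathrm{Tr}\{V^\dagger\Delta R^{(2)}P^\perp\Delta R^{(2)}V^\dagger\}$ with $\Delta R^{(2)}=\Delta R-\gamma(T_1+T_1^H)$, where $T_1=-PR\,dP+P\,\Delta R\,P^\perp+dP\,R\,P^\perp$ is the first-order part of $T$. Then, for all Hermitian $\Delta R$, all real $\Delta\omega_k$ and all real $\gamma$, $\rho_2=F_\gamma$. (iii) Suppose $|\theta_k|<\pi/2$ for all $k$. For each fixed $\gamma$, as the Hermitian matrix $\Delta R\to0$: root-MUSIC estimates exist for all sufficiently small $\Delta R$, and for any choice of them $$\Delta\omega_k=\frac{a_k^{(1)H}P^\perp\Delta R\,V^\dagger a_k-a_k^HV^\dagger\Delta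 R\,P^\perp a_k^{(1)}}{2j\,a_k^{(1)H}P^\perp a_k^{(1)}}+O(\|\Delta R\|^2),$$ the subspace leakage of $\hat R$ is $\rho_1+O(\|\Delta R\|^3)$, and the subspace leakage of $\hat R^{(2)}$ is $F_\gamma+O(\|\Delta R\|^3)$. (iv) Let $x(t)=As(t)+n(t)$, $t=1,\dots,N$, where the $s(t)$ are square-integrable random vectors with $E\{s(t)s^H(t)\}=S$, the noise vectors $n(t)$ are independent, distributed as $\mathcal N_C(0,\sigma^2I_M)$ (circularly symmetric), and jointly independent of $(s(1),\dots,s(N))$. Let $\hat R=\frac1N\sum_tx(t)x^H(t)$, $\Delta R=\hat R-R$, and form $\rho_1$ as above and $\rho_2$ as in (ii), with $\Delta\omega_k$ equal to the fraction displayed in (iii). Then $\rho_1$ and $\rho_2$ are integrable, $E\{\rho_1\}=\frac{\sigma^2(M-K)}{NK}\sum_{k}\frac{\mu_k}{(\mu_k-\sigma^2)^2}$, and for every fixed real $\gamma$ $$\begin{aligned}E\{\rho_2\}={}&(1-\gamma)^2E\{\rho_1\}+\frac{2(\gamma-\gamma^2)\sigma^2}{NK}\mathrm{Re}\Big\{\sum_{k=1}^K\frac{a_k^{(1)H}P^\perp\frac{\partial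 A}{\partial\omega_k}(A^HA)^{-1}A^HV^\dagger RV^\dagger a_k}{2j\,(a_k^{(1)H}P^\perp a_k^{(1)})}\Big\}\\&+\frac{\gamma^2\sigma^2}{2NK}\sum_{k=1}^K\sum_{i=1}^K\frac{\mathrm{Tr}\{(\frac{\partial A}{\partial\omega_k})^HP^\perp\frac{\partial A}{\partial\omega_i}(A^HA)^{-1}\}}{(a_k^{(1)H}P^\perp a_k^{(1)})(a_i^{(1)H}P^\perp a_i^{(1)})}\mathrm{Re}\{a_i^HV^\dagger RV^\dagger a_k\,a_k^{(1)H}P^\perp a_i^{(1)}\}.\end{aligned}$$ At $\gamma=0$ this is $E\{\rho_1\}$, and at $\gamma=1$ the first two terms vanish, leaving the last term. -/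

import Mathlib

open Matrix MeasureTheory ProbabilityTheory Filter Topology
open scoped ComplexOrder

noncomputable section

/-- The electrical angle `ω = 2π (d/λ) sin θ` of a wave impinging from direction `θ`. -/
def electricalAngle (d lam θ : ℝ) : ℝ := 2 * Real.pi * (d / lam) * Real.sin θ

/-- The steering vector `[1, e^{-jω}, …, e^{-j(M-1)ω}]ᵀ` of the uniform linear array. -/
def steering (M : ℕ) (ω : ℝ) : Fin M → ℂ :=
  fun m => Complex.exp (-(Complex.I * (m : ℕ) * ω))

/-- The vector `a⁽¹⁾ = -[0, e^{-jω}, 2 e^{-j2ω}, …, (M-1) e^{-j(M-1)ω}]ᵀ`. -/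
def steeringOne (M : ℕ) (ω : ℝ) : Fin M → ℂ :=
  fun m => -((m : ℕ) * Complex.exp (-(Complex.I * (m : ℕ) * ω)))

/-- The Vandermonde matrix `A` whose columns are the steering vectors. -/
def arrayMatrix (M : ℕ) {K : ℕ} (ω : Fin K → ℝ) : Matrix (Fin M) (Fin K) ℂ :=
  Matrix.of fun m k => steering M (ω k) m

/-- The projection matrix `P_A = A (Aᴴ A)⁻¹ Aᴴ`, as a function of the electrical angles. -/
def projA (M : ℕ) {K : ℕ} (ω : Fin K → ℝ) : Matrix (Fin M) (Fin M) ℂ :=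
  arrayMatrix M ω * ((arrayMatrix M ω)ᴴ * arrayMatrix M ω)⁻¹ * (arrayMatrix M ω)ᴴ

/-- The partial derivative `∂A/∂ω_k`. -/
def partialA (M : ℕ) {K : ℕ} (ω : Fin K → ℝ) (k : Fin K) : Matrix (Fin M) (Fin K) ℂ :=
  Matrix.of fun i j => deriv (fun u : ℝ => arrayMatrix M (Function.update ω k u) i j) (ω k)

/-- The partial derivative `∂P_A/∂ω_k`. -/
def partialProjA (M : ℕ) {K : ℕ} (ω : Fin K → ℝ) (k : Fin K) : Matrix (Fin M) (Fin M) ℂ :=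
  Matrix.of fun i j => deriv (fun u : ℝ => projA M (Function.update ω k u) i j) (ω k)

/-- The first order Taylor term `dP = ∑ₖ (∂P_A/∂ω_k) Δω_k` of `P_A` around `ω`. The increments are
complex numbers only for notational convenience. -/
def dProj (M : ℕ) {K : ℕ} (ω : Fin K → ℝ) (Δω : Fin K → ℂ) : Matrix (Fin M) (Fin M) ℂ :=
  ∑ k, Δω k • partialProjA M ω k

/-- The data covariance matrix `R = A S Aᴴ + σ² I`. -/
def dataCov (M : ℕ) {K : ℕ} (ω : Fin K → ℝ) (S : Matrix (Fin K) (Fin K) ℂ) (σ : ℝ) :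
    Matrix (Fin M) (Fin M) ℂ :=
  arrayMatrix M ω * S * (arrayMatrix M ω)ᴴ + ((σ ^ 2 : ℝ) : ℂ) • (1 : Matrix (Fin M) (Fin M) ℂ)

/-- `e` is a system of signal eigenvectors of the Hermitian matrix `R`: orthonormal eigenvectors
for its `K` largest eigenvalues `μ`, the latter listed in nondecreasing order. -/
structure IsSignalEigensystem {M K : ℕ} (R : Matrix (Fin M) (Fin M) ℂ)
    (μ : Fin K → ℝ) (e : Fin K → Fin M → ℂ) : Prop where
  orthonormal : ∀ i j, star (e i) ⬝ᵥ e j = if i = j then 1 else 0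
  eigen : ∀ k, R *ᵥ e k = (μ k : ℂ) • e k
  mono : Monotone μ
  largest : ∀ (v : Fin M → ℂ) (ν : ℝ), v ≠ 0 → (∀ k, star (e k) ⬝ᵥ v = 0) →
    R *ᵥ v = (ν : ℂ) • v → ∀ k, ν ≤ μ k

/-- The signal projection matrix `∑ₖ eₖ eₖᴴ`. -/
def signalProj {M K : ℕ} (e : Fin K → Fin M → ℂ) : Matrix (Fin M) (Fin M) ℂ :=
  ∑ k, vecMulVec (e k) (star (e k))

/-- The noise projection matrix, the complement of the signal projection matrix. -/
def noiseProj {M K : ℕ} (e : Fin K → Fin M → ℂ) : Matrix (Fin M) (Fin M) ℂ :=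
  1 - signalProj e

/-- The pseudo-inverse `V† = ∑ₖ (μₖ - σ²)⁻¹ eₖ eₖᴴ` of `V = R - σ² I = A S Aᴴ`. -/
def pinvV {M K : ℕ} (σ : ℝ) (μ : Fin K → ℝ) (e : Fin K → Fin M → ℂ) :
    Matrix (Fin M) (Fin M) ℂ :=
  ∑ k, ((1 / (μ k - σ ^ 2) : ℝ) : ℂ) • vecMulVec (e k) (star (e k))

/-- The subspace leakage `(1/K) ∑ₖ ‖P⊥ êₖ‖₂²` of estimated signal eigenvectors `ê` into the true
noise subspace with projection matrix `Pperp`. -/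
def subspaceLeakage {M K : ℕ} (Pperp : Matrix (Fin M) (Fin M) ℂ) (ehat : Fin K → Fin M → ℂ) : ℝ :=
  1 / (K : ℝ) * ∑ k, ∑ m, ‖(Pperp *ᵥ ehat k) m‖ ^ 2

/-- The vector `a(z) = [1, z⁻¹, …, z^{-(M-1)}]ᵀ`. -/
def steeringZ (M : ℕ) (z : ℂ) : Fin M → ℂ := fun m => z⁻¹ ^ (m : ℕ)

/-- The roots `z` of the root-MUSIC equation `aᵀ(z⁻¹) Ĝ Ĝᴴ a(z) = 0` that are inside the unit
circle; `Q` is `Ĝ Ĝᴴ`. Roots come in pairs `z`, `1 / conj z`; a pair that meets on the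
circle (a double root there) contributes its common value, hence `≤`. -/
def musicRoots {M : ℕ} (Q : Matrix (Fin M) (Fin M) ℂ) : Set ℂ :=
  {z | z ≠ 0 ∧ ‖z‖ ≤ 1 ∧ steeringZ M z⁻¹ ⬝ᵥ (Q *ᵥ steeringZ M z) = 0}

/-- `θhat` are DOA estimates that the root-MUSIC method yields for the covariance estimate `Rhat`:
`K` distinct roots inside the unit circle that are closest to it are selected, and the DOAs
are the inverse sines in `[-π/2, π/2]` of their angles times `λ / (2πd)`, in nondecreasing order. -/
def IsRootMusicEstimate {M K : ℕ} (d lam : ℝ) (Rhat : Matrix (Fin M) (Fin M) ℂ)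
    (θhat : Fin K → ℝ) : Prop :=
  ∃ (μ : Fin K → ℝ) (e : Fin K → Fin M → ℂ) (z : Fin K → ℂ),
    IsSignalEigensystem Rhat μ e ∧
    Function.Injective z ∧
    (∀ k, z k ∈ musicRoots (noiseProj e)) ∧
    (∀ w ∈ musicRoots (noiseProj e), w ∉ Set.range z → ∀ k, 1 - ‖z k‖ ≤ 1 - ‖w‖) ∧
    (∀ k, θhat k ∈ Set.Icc (-(Real.pi / 2)) (Real.pi / 2) ∧
      Real.sin (θhat k) = Complex.arg (z k) * (lam / (2 * Real.pi * d))) ∧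
    Monotone θhat

/-- The estimate `T = P̂_A R̂ P̂_A⊥` of the signal-noise correlation term. -/
def crossTerm {M : ℕ} (Rhat PA : Matrix (Fin M) (Fin M) ℂ) : Matrix (Fin M) (Fin M) ℂ :=
  PA * Rhat * (1 - PA)

/-- The modified covariance matrix `R̂⁽²⁾ = R̂ - γ (T + Tᴴ)` of the second step. -/
def modifiedCov {M : ℕ} (γ : ℝ) (Rhat PA : Matrix (Fin M) (Fin M) ℂ) :
    Matrix (Fin M) (Fin M) ℂ :=
  Rhat - (γ : ℂ) • (crossTerm Rhat PA + (crossTerm Rhat PA)ᴴ)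

/-- The first order part
`(a_k⁽¹⁾ᴴ P⊥ ΔR V† a_k - a_kᴴ V† ΔR P⊥ a_k⁽¹⁾) / (2j a_k⁽¹⁾ᴴ P⊥ a_k⁽¹⁾)`
of the root-MUSIC error `Δω_k`. -/
def freqError (M : ℕ) {K : ℕ} (ω : Fin K → ℝ) (Pperp Vd ΔR : Matrix (Fin M) (Fin M) ℂ)
    (k : Fin K) : ℂ :=
  (star (steeringOne M (ω k)) ⬝ᵥ ((Pperp * ΔR * Vd) *ᵥ steering M (ω k))
      - star (steering M (ω k)) ⬝ᵥ ((Vd * ΔR * Pperp) *ᵥ steeringOne M (ω k)))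
    / (2 * Complex.I * (star (steeringOne M (ω k)) ⬝ᵥ (Pperp *ᵥ steeringOne M (ω k))))

/-- The first step leakage `ρ₁ = (1/K) Tr{V† ΔR P⊥ ΔR V†}` (leading order). -/
def rho1 (K : ℕ) {M : ℕ} (Pperp Vd ΔR : Matrix (Fin M) (Fin M) ℂ) : ℂ :=
  1 / (K : ℂ) * (Vd * ΔR * Pperp * ΔR * Vd).trace

/-- The part `-P R dP + P ΔR P⊥ + dP R P⊥` of `T` that is of first order in `ΔR` and `dP`. -/
def crossTermFirstOrder {M : ℕ} (R Pperp ΔR dP : Matrix (Fin M) (Fin M) ℂ) :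
    Matrix (Fin M) (Fin M) ℂ :=
  -((1 - Pperp) * R * dP) + (1 - Pperp) * ΔR * Pperp + dP * R * Pperp

/-- The second step leakage `ρ₂ = (1/K) Tr{V† ΔR⁽²⁾ P⊥ ΔR⁽²⁾ V†}` (leading order), where
`ΔR⁽²⁾ = ΔR - γ (T + Tᴴ)` and `T` is replaced by its first order part. -/
def rho2 (K : ℕ) {M : ℕ} (γ : ℝ) (R Pperp Vd ΔR dP : Matrix (Fin M) (Fin M) ℂ) : ℂ :=
  rho1 K Pperp Vd (ΔR - (γ : ℂ) • (crossTermFirstOrder R Pperp ΔR dP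
    + (crossTermFirstOrder R Pperp ΔR dP)ᴴ))

/-- The expression
`(1-2γ+γ²) ρ₁ + (2(γ-γ²)/K) Re Tr{V† ΔR P⊥ dP} + (γ²/K) Tr{dP P⊥ dP}`. -/
def rho2Formula (K : ℕ) {M : ℕ} (γ : ℝ) (Pperp Vd ΔR dP : Matrix (Fin M) (Fin M) ℂ) : ℂ :=
  (1 - 2 * γ + γ ^ 2) * rho1 K Pperp Vd ΔR
    + 2 * (γ - γ ^ 2) / K * (((Vd * ΔR * Pperp * dP).trace.re : ℝ) : ℂ)
    + γ ^ 2 / K * (dP * Pperp * dP).trace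

/-- The law on `ℂ` of a circularly symmetric complex Gaussian variable with variance `v`:
independent centred real and imaginary parts of variance `v / 2`. -/
def complexGaussian (v : ℝ) : Measure ℂ :=
  ((gaussianReal 0 (v / 2).toNNReal).prod (gaussianReal 0 (v / 2).toNNReal)).map
    (fun p : ℝ × ℝ => (p.1 : ℂ) + (p.2 : ℂ) * Complex.I)

/-- The sample covariance matrix `(1/N) ∑ₜ x(t) x(t)ᴴ`. -/
def sampleCov {M N : ℕ} (x : Fin N → Fin M → ℂ) : Matrix (Fin M) (Fin M) ℂ :=
  (1 / (N : ℂ)) • ∑ t, vecMulVec (x t) (star (x t))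

/-- The sum over `k` of
`a_k⁽¹⁾ᴴ P⊥ (∂A/∂ω_k) (AᴴA)⁻¹ Aᴴ V† R V† a_k / (2j a_k⁽¹⁾ᴴ P⊥ a_k⁽¹⁾)`. -/
def crossSum (M : ℕ) {K : ℕ} (ω : Fin K → ℝ) (R Pperp Vd : Matrix (Fin M) (Fin M) ℂ) : ℂ :=
  ∑ k, (star (steeringOne M (ω k)) ⬝ᵥ
      ((Pperp * partialA M ω k * ((arrayMatrix M ω)ᴴ * arrayMatrix M ω)⁻¹ * (arrayMatrix M ω)ᴴ
        * Vd * R * Vd) *ᵥ steering M (ω k)))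
    / (2 * Complex.I * (star (steeringOne M (ω k)) ⬝ᵥ (Pperp *ᵥ steeringOne M (ω k))))

/-- The double sum over `k` and `i` of
`Tr{(∂A/∂ω_k)ᴴ P⊥ (∂A/∂ω_i) (AᴴA)⁻¹} Re{a_iᴴ V† R V† a_k a_k⁽¹⁾ᴴ P⊥ a_i⁽¹⁾}
  / ((a_k⁽¹⁾ᴴ P⊥ a_k⁽¹⁾) (a_i⁽¹⁾ᴴ P⊥ a_i⁽¹⁾))`. -/
def quadSum (M : ℕ) {K : ℕ} (ω : Fin K → ℝ) (R Pperp Vd : Matrix (Fin M) (Fin M) ℂ) : ℂ :=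
  ∑ k, ∑ i,
    ((partialA M ω k)ᴴ * Pperp * partialA M ω i
        * ((arrayMatrix M ω)ᴴ * arrayMatrix M ω)⁻¹).trace
      / ((star (steeringOne M (ω k)) ⬝ᵥ (Pperp *ᵥ steeringOne M (ω k)))
        * (star (steeringOne M (ω i)) ⬝ᵥ (Pperp *ᵥ steeringOne M (ω i))))
      * ((((star (steering M (ω i)) ⬝ᵥ ((Vd * R * Vd) *ᵥ steering M (ω k)))
          * (star (steeringOne M (ω k)) ⬝ᵥ (Pperp *ᵥ steeringOne M (ω i)))).re : ℝ) : ℂ)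

end

/-! Write Q = P⊥, W = V† and V = A S Aᴴ.

The signal space is the range of A. The signal eigenvalues of R exceed σ², so the signal projection
P equals V W. Hence P_A P = P, and P_A − P is a Hermitian idempotent of trace K − K = 0
(`projA_eq_signalProj`). The linear independence of steering vectors, and the fact that no a_k⁽¹⁾
lies in the range of A, come from pairing with polynomials of degree below M.

Leakage is second order. The variational characterization of the top K eigenvectors bounds D = P̂ −
P by a multiple of ‖ΔR‖ (`norm_signalProj_sub_le`). Idempotency of P̂ makes P D P and Q D Q
quadratic, and commutation of P̂ with R + ΔR gives Q D P = Q ΔR W up to second order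
(`proj_sub_expansion`). The leakage is Tr{(Q D)(D Q)}/K, so replacing each factor by its first-order
part costs only third order (`isBigO_subspaceLeakage`).

For root-MUSIC, the substitution z = e^{jτ} turns the root equation into the vanishing of an entire
function f_Q(τ). It is conjugation symmetric and equals ‖Q a‖² on the real axis, and the true angles
are nondegenerate double zeros. Compactness and a quantitative open mapping theorem show that the K
roots closest to the circle are exactly those near the true angles (`eventually_closestRoots`). A
Taylor expansion along the real direction then shows that the angle error is the Newton step −f′/f″
up to second order (`isBigO_root_sub`), which is the displayed fraction (`freqError_eq`).

For the second step, differentiating P_A² = P_A gives Q dP Q = 0. With W R = P + σ² W this collapses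
W ΔR⁽²⁾ Q to (1 − γ) W ΔR Q + γ P dP Q, whose squared norm is K F_γ (`rho2_eq_rho2Formula`).

For the expectations, Q ΔR W = (1/N) ∑ₜ (Q n(t))(W x(t))ᴴ. Since Q W = 0, the Gaussian vectors Q n
and W n are uncorrelated, hence independent, and the sources are independent of both. So the second
moments of the entries factor (`hasCrossMoments_sampleCov`), and every expectation needed is a
quadratic functional of this one matrix (`integral_rho1`, `integral_rho2`). -/

/-! ### Signal eigenvectors: matrix form, variational property and existence. -/

section SignalEigensystem

variable {M K : ℕ}

/-- The matrix whose columns are the vectors `e k`. -/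
def eigMat (e : Fin K → Fin M → ℂ) : Matrix (Fin M) (Fin K) ℂ := Matrix.of fun m k => e k m

/-- With the eigenvectors gathered as the columns of one matrix E, orthonormality reads Eᴴ E = 1 and
the eigenvalue equations read R E = E diag(μ). Facts about projections then become short matrix
identities. -/
lemma signalProj_eq (e : Fin K → Fin M → ℂ) : signalProj e = eigMat e * (eigMat e)ᴴ := by
  ext i j
  simp [signalProj, eigMat, Matrix.sum_apply, vecMulVec_apply, Matrix.mul_apply]

lemma pinvV_eq (σ : ℝ) (μ : Fin K → ℝ) (e : Fin K → Fin M → ℂ) :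
    pinvV σ μ e = eigMat e * diagonal (fun k => ((1 / (μ k - σ ^ 2) : ℝ) : ℂ)) * (eigMat e)ᴴ := by
  ext i j
  rw [Matrix.mul_apply]
  simp only [pinvV, Matrix.sum_apply, Matrix.smul_apply, vecMulVec_apply,
    mul_diagonal, conjTranspose_apply, eigMat, of_apply, Pi.star_apply, smul_eq_mul]
  exact Finset.sum_congr rfl fun k _ => by ring

variable {R : Matrix (Fin M) (Fin M) ℂ} {μ : Fin K → ℝ} {e : Fin K → Fin M → ℂ}

namespace IsSignalEigensystem

lemma eigMat_orth (h : IsSignalEigensystem R μ e) : (eigMat e)ᴴ * eigMat e = 1 := by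
  ext i j
  simpa [Matrix.mul_apply, eigMat, dotProduct, Matrix.one_apply] using h.orthonormal i j

lemma mul_eigMat (h : IsSignalEigensystem R μ e) :
    R * eigMat e = eigMat e * diagonal (fun k => (μ k : ℂ)) := by
  ext i k
  have := congrFun (h.eigen k) i
  simp only [mulVec, dotProduct, Pi.smul_apply, smul_eq_mul] at this
  rw [mul_diagonal, Matrix.mul_apply]
  simp only [eigMat, of_apply]
  rw [this, mul_comm]

lemma eigMat_mul (h : IsSignalEigensystem R μ e) (hR : R.IsHermitian) :
    (eigMat e)ᴴ * R = diagonal (fun k => (μ k : ℂ)) * (eigMat e)ᴴ := by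
  have := congrArg conjTranspose h.mul_eigMat
  rw [conjTranspose_mul, conjTranspose_mul, hR.eq, diagonal_conjTranspose] at this
  rw [this]
  congr 2
  ext k
  simp

end IsSignalEigensystem

lemma signalProj_isHermitian (e : Fin K → Fin M → ℂ) : (signalProj e).IsHermitian := by
  rw [signalProj_eq]; exact isHermitian_mul_conjTranspose_self _

lemma noiseProj_isHermitian (e : Fin K → Fin M → ℂ) : (noiseProj e).IsHermitian :=
  isHermitian_one.sub (signalProj_isHermitian e)

lemma pinvV_isHermitian (σ : ℝ) (μ : Fin K → ℝ) (e : Fin K → Fin M → ℂ) :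
    (pinvV σ μ e).IsHermitian := by
  rw [pinvV_eq]
  refine isHermitian_mul_mul_conjTranspose _ ?_
  rw [isHermitian_diagonal_iff]
  intro k
  rw [isSelfAdjoint_iff, Complex.star_def, Complex.conj_ofReal]

namespace IsSignalEigensystem

lemma signalProj_mul_self (h : IsSignalEigensystem R μ e) :
    signalProj e * signalProj e = signalProj e := by
  rw [signalProj_eq]
  calc eigMat e * (eigMat e)ᴴ * (eigMat e * (eigMat e)ᴴ)
      = eigMat e * ((eigMat e)ᴴ * eigMat e) * (eigMat e)ᴴ := by simp only [Matrix.mul_assoc]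
    _ = _ := by rw [h.eigMat_orth, Matrix.mul_one]

lemma noiseProj_mul_self (h : IsSignalEigensystem R μ e) :
    noiseProj e * noiseProj e = noiseProj e := by
  have := h.signalProj_mul_self
  simp only [noiseProj]
  noncomm_ring [this]

lemma trace_signalProj (h : IsSignalEigensystem R μ e) : (signalProj e).trace = K := by
  rw [signalProj_eq, trace_mul_comm, h.eigMat_orth]
  simp

lemma commute (h : IsSignalEigensystem R μ e) (hR : R.IsHermitian) :
    R * signalProj e = signalProj e * R := by
  rw [signalProj_eq, ← Matrix.mul_assoc, h.mul_eigMat, Matrix.mul_assoc, Matrix.mul_assoc,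
    h.eigMat_mul hR]

lemma noise_commute (h : IsSignalEigensystem R μ e) (hR : R.IsHermitian) :
    R * noiseProj e = noiseProj e * R := by
  have := h.commute hR
  simp only [noiseProj]
  rw [Matrix.mul_sub, Matrix.sub_mul, this, Matrix.mul_one, Matrix.one_mul]

lemma star_dotProduct_noiseProj (h : IsSignalEigensystem R μ e) (v : Fin M → ℂ) (k : Fin K) :
    star (e k) ⬝ᵥ (noiseProj e *ᵥ v) = 0 := by
  have h1 : (eigMat e)ᴴ * noiseProj e = 0 := by
    rw [noiseProj, signalProj_eq, Matrix.mul_sub, ← Matrix.mul_assoc, h.eigMat_orth]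
    simp
  have h2 : (eigMat e)ᴴ *ᵥ (noiseProj e *ᵥ v) = 0 := by
    rw [mulVec_mulVec, h1, zero_mulVec]
  exact congrFun h2 k

/-- On the complement of the signal eigenvectors `R` is bounded by each signal eigenvalue. -/
lemma posSemidef_noise (h : IsSignalEigensystem R μ e) (hR : R.IsHermitian) (k : Fin K) :
    ((μ k : ℂ) • noiseProj e - R * noiseProj e).PosSemidef := by
  have hQ := h.noiseProj_mul_self
  have hc := h.noise_commute hR
  have hH : ((μ k : ℂ) • noiseProj e - R * noiseProj e).IsHermitian := by
    refine IsHermitian.sub ?_ ?_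
    · rw [IsHermitian, conjTranspose_smul, (noiseProj_isHermitian e).eq]
      simp
    · rw [IsHermitian, conjTranspose_mul, hR.eq, (noiseProj_isHermitian e).eq, hc]
  rw [hH.posSemidef_iff_eigenvalues_nonneg]
  -- An eigenvector v for a negative eigenvalue ν of (μ_k − R) Q would lie in the range of Q,
  -- because ν ≠ 0, and would be an eigenvector of R for μ_k − ν > μ_k. This contradicts maximality.
  intro i
  by_contra! hneg
  simp only [Pi.zero_apply] at hneg
  have hv := hH.mulVec_eigenvectorBasis i
  set v : Fin M → ℂ := (hH.eigenvectorBasis i).ofLp with hvdef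
  set ν := hH.eigenvalues i with hν
  have hv0 : v ≠ 0 := by
    intro h0
    have h1 := hH.eigenvectorBasis.orthonormal.1 i
    have h2 : hH.eigenvectorBasis i = 0 := by ext j; exact congrFun h0 j
    rw [h2] at h1
    simp at h1
  have hvν : ((μ k : ℂ) • noiseProj e - R * noiseProj e) *ᵥ v = (ν : ℂ) • v := by
    rw [hv]; ext j; simp
  have hfac : (μ k : ℂ) • noiseProj e - R * noiseProj e
      = noiseProj e * ((μ k : ℂ) • 1 - R) := by
    rw [Matrix.mul_sub, hc]; simp
  have hν0 : (ν : ℂ) ≠ 0 := by exact_mod_cast hneg.ne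
  have hvQ : v = noiseProj e *ᵥ ((ν : ℂ)⁻¹ • (((μ k : ℂ) • 1 - R) *ᵥ v)) := by
    rw [mulVec_smul, mulVec_mulVec, ← hfac, hvν, smul_smul, inv_mul_cancel₀ hν0, one_smul]
  have hQv : noiseProj e *ᵥ v = v := by
    conv_lhs => rw [hvQ]
    rw [mulVec_mulVec, hQ, ← hvQ]
  have horth : ∀ k, star (e k) ⬝ᵥ v = 0 := fun k => by
    rw [hvQ]; exact h.star_dotProduct_noiseProj _ k
  have heig : R *ᵥ v = ((μ k - ν : ℝ) : ℂ) • v := by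
    have : (μ k : ℂ) • v - R *ᵥ v = (ν : ℂ) • v := by
      rw [← hvν, sub_mulVec, smul_mulVec, ← mulVec_mulVec, hQv]
    rw [Complex.ofReal_sub, sub_smul, ← this]
    simp
  have := h.largest v _ hv0 horth heig k
  linarith

/-- The signal projection maximizes `Re Tr(R P)` among projections of rank `K`. -/
lemma re_trace_le (h : IsSignalEigensystem R μ e) (hR : R.IsHermitian)
    {P : Matrix (Fin M) (Fin M) ℂ} (hP : P.IsHermitian) (hPP : P * P = P) (htr : P.trace = K) :
    (R * P).trace.re ≤ (R * signalProj e).trace.re := by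
  -- The argument needs a smallest signal eigenvalue as threshold, so the empty case is split off.
  rcases Nat.eq_zero_or_pos K with rfl | hK
  · have h0 : P = 0 := by
      rw [← trace_conjTranspose_mul_self_eq_zero_iff, hP.eq, hPP, htr]; simp
    have h1 : signalProj e = 0 := by
      simp [signalProj]
    rw [h0, h1]
  set k₀ : Fin K := ⟨0, hK⟩
  have key : ∀ X : Matrix (Fin M) (Fin M) ℂ, X.PosSemidef → ∀ Y : Matrix (Fin M) (Fin M) ℂ,
      Y.IsHermitian → Y * Y = Y → 0 ≤ (X * Y).trace.re := by
    intro X hX Y hY hYY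
    have h1 := (hX.conjTranspose_mul_mul_same Y).trace_nonneg
    rw [hY.eq, trace_mul_comm, ← Matrix.mul_assoc, hYY, trace_mul_comm] at h1
    exact (Complex.le_def.1 h1).1
  have hlow : (R * signalProj e - (μ k₀ : ℂ) • signalProj e).PosSemidef := by
    have : R * signalProj e - (μ k₀ : ℂ) • signalProj e
        = eigMat e * diagonal (fun k => ((μ k - μ k₀ : ℝ) : ℂ)) * (eigMat e)ᴴ := by
      have hd : diagonal (fun k => ((μ k - μ k₀ : ℝ) : ℂ))
          = diagonal (fun k => (μ k : ℂ)) - (μ k₀ : ℂ) • (1 : Matrix (Fin K) (Fin K) ℂ) := by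
        rw [smul_one_eq_diagonal, diagonal_sub]; congr 1; ext k; simp
      rw [signalProj_eq, ← Matrix.mul_assoc, h.mul_eigMat, hd, Matrix.mul_sub, Matrix.sub_mul]
      simp
    rw [this]
    refine PosSemidef.mul_mul_conjTranspose_same ?_ _
    refine PosSemidef.diagonal fun k => ?_
    have : μ k₀ ≤ μ k := h.mono (Fin.mk_le_of_le_val (Nat.zero_le _))
    simpa using this
  -- The smallest signal eigenvalue μ₀ separates the spectrum: R ≥ μ₀ on the signal space and R ≤ μ₀
  -- on its complement. Testing the first bound on 1 − P and the second on P and adding, μ₀ cancels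
  -- because both projections have trace K.
  have h1 := key _ hlow (1 - P) (isHermitian_one.sub hP) (by noncomm_ring [hPP])
  have h2 := key _ (h.posSemidef_noise hR k₀) P hP hPP
  have h3 : ((R * signalProj e - (μ k₀ : ℂ) • signalProj e) * (1 - P)).trace
      + (((μ k₀ : ℂ) • noiseProj e - R * noiseProj e) * P).trace
      = (R * signalProj e).trace - (R * P).trace
        + (μ k₀ : ℂ) * (P.trace - (signalProj e).trace) := by
    simp only [noiseProj, Matrix.mul_sub, Matrix.sub_mul, trace_sub, smul_mul, trace_smul,
      Matrix.mul_one, Matrix.one_mul, smul_eq_mul, smul_sub]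
    ring
  rw [htr, h.trace_signalProj, sub_self, mul_zero, add_zero] at h3
  have := congrArg Complex.re h3
  simp only [Complex.add_re, Complex.sub_re] at this
  linarith

end IsSignalEigensystem

/-- A Hermitian matrix has a system of signal eigenvectors. -/
lemma exists_isSignalEigensystem (hKM : K ≤ M) (hR : R.IsHermitian) :
    ∃ (μ : Fin K → ℝ) (e : Fin K → Fin M → ℂ), IsSignalEigensystem R μ e := by
  set s := Tuple.sort hR.eigenvalues with hs
  have hmono : Monotone (hR.eigenvalues ∘ s) := Tuple.monotone_sort _
  -- The sort is increasing, so the last K positions carry the K largest eigenvalues.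
  let f : Fin K → Fin M := fun k => ⟨M - K + k, by omega⟩
  have hf : Function.Injective f := fun a b hab => by
    simp only [f, Fin.mk.injEq] at hab; ext; omega
  have hon := hR.eigenvectorBasis.orthonormal
  have hinner : ∀ x y : EuclideanSpace ℂ (Fin M), star x.ofLp ⬝ᵥ y.ofLp = inner ℂ x y := by
    intro x y
    rw [EuclideanSpace.inner_eq_star_dotProduct, dotProduct_comm]
  refine ⟨fun k => hR.eigenvalues (s (f k)), fun k => (hR.eigenvectorBasis (s (f k))).ofLp,
    ⟨fun i j => ?_, fun k => ?_, fun a b hab => ?_, ?_⟩⟩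
  · rw [hinner, orthonormal_iff_ite.1 hon]
    simp [s.injective.eq_iff, hf.eq_iff]
  · rw [hR.mulVec_eigenvectorBasis]; ext; simp
  · refine hmono ?_
    simp only [f, Fin.mk_le_mk]
    have : (a : ℕ) ≤ b := hab
    omega
  · intro v ν hv horth hRv k
    -- A nonzero v overlaps some basis eigenvector. Its eigenvalue must then be ν, and the overlap
    -- forces that vector to be one of the unselected ones.
    obtain ⟨i, hi⟩ : ∃ i, inner ℂ (hR.eigenvectorBasis i) (WithLp.toLp 2 v) ≠ (0 : ℂ) := by
      by_contra! hall
      apply hv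
      have : WithLp.toLp 2 v = 0 := by
        apply hR.eigenvectorBasis.repr.injective
        ext i
        rw [OrthonormalBasis.repr_apply_apply, hall i]
        simp
      simpa using congrArg WithLp.ofLp this
    have hνi : hR.eigenvalues i = ν := by
      have h1 : star (hR.eigenvectorBasis i).ofLp ⬝ᵥ (R *ᵥ v)
          = (hR.eigenvalues i : ℂ) * (star (hR.eigenvectorBasis i).ofLp ⬝ᵥ v) := by
        have hs := star_mulVec R (hR.eigenvectorBasis i).ofLp
        rw [hR.eq] at hs
        rw [dotProduct_mulVec, ← hs, hR.mulVec_eigenvectorBasis]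
        have : star (hR.eigenvalues i • (hR.eigenvectorBasis i).ofLp)
            = (hR.eigenvalues i : ℂ) • star (hR.eigenvectorBasis i).ofLp := by
          ext; simp
        rw [this, smul_dotProduct, smul_eq_mul]
      rw [hRv, dotProduct_smul, smul_eq_mul] at h1
      have h2 := hinner (hR.eigenvectorBasis i) (WithLp.toLp 2 v)
      simp only at h2
      rw [h2] at h1
      exact_mod_cast (mul_right_cancel₀ hi h1).symm
    obtain ⟨j, rfl⟩ := s.surjective i
    have hj : (j : ℕ) < M - K := by
      by_contra! hj
      apply hi
      have : f ⟨j - (M - K), by omega⟩ = j := by ext; simp only [f]; omega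
      have h2 := horth ⟨j - (M - K), by omega⟩
      rw [this] at h2
      rw [← hinner]; exact h2
    rw [← hνi]
    refine hmono ?_
    rw [Fin.le_def]
    simp only [f]
    omega

end SignalEigensystem

/-! ### Steering vectors, polynomial evaluation and the projection onto the range of A. -/

section Array

variable {M K : ℕ}

lemma steering_eq_pow (M : ℕ) (ω : ℝ) (m : Fin M) :
    steering M ω m = Complex.exp (-(Complex.I * ω)) ^ (m : ℕ) := by
  rw [steering, ← Complex.exp_nat_mul]
  congr 1; ring

/-- The entries of a steering vector are the powers of w = e^{-jω}, so a vector of polynomial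
coefficients acts on it as evaluation at w. This replaces Vandermonde determinants in what follows.
-/
lemma sum_coeff_mul_steering {p : Polynomial ℂ} (hp : p.natDegree < M) (ω : ℝ) :
    ∑ m : Fin M, p.coeff m * steering M ω m = p.eval (Complex.exp (-(Complex.I * ω))) := by
  rw [Polynomial.eval_eq_sum_range' hp, Finset.sum_range]
  exact Finset.sum_congr rfl fun m _ => by rw [steering_eq_pow]

/-- The weights m in a⁽¹⁾ turn p into X p′, whose degree is still below M. -/
lemma sum_coeff_mul_steeringOne {p : Polynomial ℂ} (hp : p.natDegree < M) (ω : ℝ) :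
    ∑ m : Fin M, p.coeff m * steeringOne M ω m
      = -(Complex.exp (-(Complex.I * ω))
          * p.derivative.eval (Complex.exp (-(Complex.I * ω)))) := by
  have hdeg : (Polynomial.X * p.derivative).natDegree < M := by
    rcases Nat.eq_zero_or_pos p.natDegree with h0 | h0
    · rw [Polynomial.derivative_of_natDegree_zero h0, mul_zero, Polynomial.natDegree_zero]; omega
    · have h1 := Polynomial.natDegree_mul_le (p := Polynomial.X) (q := p.derivative)
      have h2 := Polynomial.natDegree_derivative_le p
      rw [Polynomial.natDegree_X] at h1
      omega
  have hcoeff : ∀ m : ℕ, (Polynomial.X * p.derivative).coeff m = p.coeff m * m := by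
    rintro (_ | m)
    · simp
    · rw [Polynomial.coeff_X_mul, Polynomial.coeff_derivative]; push_cast; ring
  have := sum_coeff_mul_steering hdeg ω
  rw [Polynomial.eval_mul, Polynomial.eval_X] at this
  rw [← this, ← Finset.sum_neg_distrib]
  refine Finset.sum_congr rfl fun m _ => ?_
  rw [hcoeff, steeringOne, steering]; ring

lemma steering_congr {ω ω' : ℝ}
    (h : Complex.exp (-(Complex.I * ω)) = Complex.exp (-(Complex.I * ω'))) :
    steering M ω = steering M ω' := by
  ext m; rw [steering_eq_pow, steering_eq_pow, h]

variable {ω : Fin K → ℝ}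

lemma exp_injective_of_steering (hω : Function.Injective fun k => steering M (ω k)) :
    Function.Injective fun k => Complex.exp (-(Complex.I * ω k)) :=
  fun _ _ h => hω (steering_congr h)

lemma sum_coeff_mul_arrayMatrix {p : Polynomial ℂ} (hp : p.natDegree < M) (c : Fin K → ℂ) :
    ∑ m : Fin M, p.coeff m * (arrayMatrix M ω *ᵥ c) m
      = ∑ k, p.eval (Complex.exp (-(Complex.I * ω k))) * c k := by
  simp_rw [mulVec, dotProduct, Finset.mul_sum]
  rw [Finset.sum_comm]
  refine Finset.sum_congr rfl fun k _ => ?_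
  rw [← sum_coeff_mul_steering hp, Finset.sum_mul]
  exact Finset.sum_congr rfl fun m _ => by rw [arrayMatrix, of_apply]; ring

lemma natDegree_prod_X_sub_C_lt (s : Finset (Fin K)) (hs : s.card < M) (w : Fin K → ℂ) :
    (∏ k ∈ s, (Polynomial.X - Polynomial.C (w k))).natDegree < M := by
  rw [Polynomial.natDegree_prod_of_monic _ _ fun k _ => Polynomial.monic_X_sub_C _]
  simpa using hs

/-- Lagrange interpolation: the polynomial vanishing at every node but the k-th has degree K − 1 <
M, and pairing it with A c isolates c_k. -/
lemma arrayMatrix_mulVec_injective (hω : Function.Injective fun k => steering M (ω k))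
    (hKM : K ≤ M) : Function.Injective (arrayMatrix M ω).mulVec := by
  have hw := exp_injective_of_steering hω
  suffices ∀ c, arrayMatrix M ω *ᵥ c = 0 → c = 0 by
    intro c c' h
    refine sub_eq_zero.1 (this _ ?_)
    rw [mulVec_sub, sub_eq_zero]; exact h
  intro c hc
  ext k
  have hdeg := natDegree_prod_X_sub_C_lt (M := M) (Finset.univ.erase k)
    (by rw [Finset.card_erase_of_mem (Finset.mem_univ k), Finset.card_fin]
        have := k.pos; omega) (fun k => Complex.exp (-(Complex.I * ω k)))
  have h1 := sum_coeff_mul_arrayMatrix (ω := ω) hdeg c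
  rw [hc, Finset.sum_eq_single k] at h1
  · simp only [Pi.zero_apply, mul_zero, Finset.sum_const_zero, Polynomial.eval_prod,
      Polynomial.eval_sub, Polynomial.eval_X, Polynomial.eval_C] at h1
    rcases mul_eq_zero.1 h1.symm with h2 | h2
    · obtain ⟨i, hi, hi2⟩ := Finset.prod_eq_zero_iff.1 h2
      exact absurd (hw (sub_eq_zero.1 hi2)).symm (Finset.ne_of_mem_erase hi)
    · exact h2
  · intro i _ hik
    rw [Polynomial.eval_prod, Finset.prod_eq_zero (i := i) (by simp [hik]) (by simp), zero_mul]
  · simp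

lemma eval_prod_eq_zero (w : Fin K → ℂ) (k : Fin K) :
    (∏ k, (Polynomial.X - Polynomial.C (w k))).eval (w k) = 0 := by
  rw [Polynomial.eval_prod, Finset.prod_eq_zero (Finset.mem_univ k) (by simp)]

/-- A steering vector in the range of the array matrix belongs to one of the array angles. -/
lemma exists_exp_eq_of_mulVec_eq_steering (hKM : K < M) {c : Fin K → ℂ} {x : ℝ}
    (h : arrayMatrix M ω *ᵥ c = steering M x) :
    ∃ k, Complex.exp (-(Complex.I * x)) = Complex.exp (-(Complex.I * ω k)) := by
  -- The nodal polynomial has degree K < M and annihilates the range of A, so any steering vector in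
  -- that range has its node among the roots.
  have hdeg := natDegree_prod_X_sub_C_lt (M := M) Finset.univ (by simpa using hKM)
    (fun k => Complex.exp (-(Complex.I * ω k)))
  have h1 := sum_coeff_mul_arrayMatrix (ω := ω) hdeg c
  rw [h, sum_coeff_mul_steering hdeg, Finset.sum_eq_zero fun k _ => by
    rw [eval_prod_eq_zero (fun k => Complex.exp (-(Complex.I * ω k))), zero_mul],
    Polynomial.eval_prod, Finset.prod_eq_zero_iff] at h1
  obtain ⟨k, -, hk⟩ := h1
  exact ⟨k, by simpa [sub_eq_zero] using hk⟩

/-- The derivative of a steering vector does not lie in the range of the array matrix. -/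
lemma mulVec_ne_steeringOne (hω : Function.Injective fun k => steering M (ω k)) (hKM : K < M)
    (k : Fin K) (c : Fin K → ℂ) : arrayMatrix M ω *ᵥ c ≠ steeringOne M (ω k) := by
  intro h
  have hw := exp_injective_of_steering hω
  -- The nodal polynomial kills the range of A, but paired with a_k⁽¹⁾ it gives its derivative at
  -- the simple root w_k, up to a nonzero factor.
  have hdeg := natDegree_prod_X_sub_C_lt (M := M) Finset.univ (by simpa using hKM)
    (fun k => Complex.exp (-(Complex.I * ω k)))
  have h1 := sum_coeff_mul_arrayMatrix (ω := ω) hdeg c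
  rw [h, sum_coeff_mul_steeringOne hdeg, Finset.sum_eq_zero fun k _ => by
    rw [eval_prod_eq_zero (fun k => Complex.exp (-(Complex.I * ω k))), zero_mul],
    neg_eq_zero, mul_eq_zero, or_iff_right (Complex.exp_ne_zero _),
    Polynomial.derivative_prod_finset, Polynomial.eval_finsetSum,
    Finset.sum_eq_single k, Polynomial.eval_mul, Polynomial.eval_prod] at h1
  · simp only [Polynomial.eval_sub, Polynomial.eval_X, Polynomial.eval_C,
      Polynomial.derivative_sub, Polynomial.derivative_X, Polynomial.derivative_C, sub_zero,
      Polynomial.eval_one, mul_one] at h1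
    obtain ⟨i, hi, hi2⟩ := Finset.prod_eq_zero_iff.1 h1
    exact absurd (hw (sub_eq_zero.1 hi2)).symm (Finset.ne_of_mem_erase hi)
  · intro i _ hik
    rw [Polynomial.eval_mul, Polynomial.eval_prod,
      Finset.prod_eq_zero (i := k) (by simp [hik.symm]) (by simp), zero_mul]
  · simp

lemma posDef_gram (hω : Function.Injective fun k => steering M (ω k)) (hKM : K ≤ M) :
    ((arrayMatrix M ω)ᴴ * arrayMatrix M ω).PosDef :=
  PosDef.conjTranspose_mul_self _ (arrayMatrix_mulVec_injective hω hKM)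

lemma isUnit_det_gram (hω : Function.Injective fun k => steering M (ω k)) (hKM : K ≤ M) :
    IsUnit ((arrayMatrix M ω)ᴴ * arrayMatrix M ω).det :=
  (Matrix.isUnit_iff_isUnit_det _).1 (posDef_gram hω hKM).isUnit

lemma projA_isHermitian (ω : Fin K → ℝ) : (projA M ω).IsHermitian :=
  isHermitian_mul_mul_conjTranspose _ (isHermitian_conjTranspose_mul_self _).inv

lemma projA_mul_arrayMatrix (h : IsUnit ((arrayMatrix M ω)ᴴ * arrayMatrix M ω).det) :
    projA M ω * arrayMatrix M ω = arrayMatrix M ω := by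
  rw [projA, Matrix.mul_assoc, Matrix.mul_assoc, nonsing_inv_mul _ h, Matrix.mul_one]

lemma projA_mul_self (h : IsUnit ((arrayMatrix M ω)ᴴ * arrayMatrix M ω).det) :
    projA M ω * projA M ω = projA M ω := by
  nth_rewrite 2 [projA]
  rw [← Matrix.mul_assoc, ← Matrix.mul_assoc, projA_mul_arrayMatrix h]
  rfl

lemma trace_projA (h : IsUnit ((arrayMatrix M ω)ᴴ * arrayMatrix M ω).det) :
    (projA M ω).trace = K := by
  rw [projA, trace_mul_comm, ← Matrix.mul_assoc, mul_nonsing_inv _ h]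
  simp

/-- A Hermitian idempotent matrix of trace zero vanishes. -/
lemma eq_zero_of_trace_eq_zero {n : Type*} [Fintype n] {X : Matrix n n ℂ} (h : X.IsHermitian)
    (hX : X * X = X) (ht : X.trace = 0) : X = 0 := by
  rw [← trace_conjTranspose_mul_self_eq_zero_iff, h.eq, hX, ht]

end Array

/-! ### Signal eigenvalues lie strictly above the noise level. -/

section Model

variable {M K : ℕ}

/-- `W` is the pseudo-inverse of the positive semidefinite matrix `V` with range projection `P`. -/
structure IsPinvSystem (V P W : Matrix (Fin M) (Fin M) ℂ) : Prop where
  herm_V : V.IsHermitian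
  herm_P : P.IsHermitian
  herm_W : W.IsHermitian
  PP : P * P = P
  VW : V * W = P
  WV : W * V = P
  PW : P * W = W
  WP : W * P = W
  PV : P * V = V
  VP : V * P = V
  coercive : ∃ c : ℝ, 0 < c ∧ (V - (c : ℂ) • P).PosSemidef

lemma dataCov_isHermitian {S : Matrix (Fin K) (Fin K) ℂ} (hS : S.PosDef) (ω : Fin K → ℝ) (σ : ℝ) :
    (dataCov M ω S σ).IsHermitian := by
  refine (isHermitian_mul_mul_conjTranspose _ hS.isHermitian).add ?_
  rw [IsHermitian, conjTranspose_smul]; simp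

variable {ω : Fin K → ℝ} {S : Matrix (Fin K) (Fin K) ℂ} {σ : ℝ} {μ : Fin K → ℝ}
  {e : Fin K → Fin M → ℂ}

/-- The signal eigenvalues exceed the noise variance. -/
lemma sq_lt_signal_eigenvalue (hω : Function.Injective fun k => steering M (ω k)) (hKM : K ≤ M)
    (hS : S.PosDef) (he : IsSignalEigensystem (dataCov M ω S σ) μ e) (k : Fin K) :
    σ ^ 2 < μ k := by
  by_contra! hk
  have hR := dataCov_isHermitian (M := M) hS ω σ
  set A := arrayMatrix M ω with hA
  have hinj := arrayMatrix_mulVec_injective hω hKM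
  -- Dimension count: dropping the k-th of K linear conditions leaves a nonzero c for which x = A c
  -- is orthogonal to every e_j with j ≠ k. If μ_k ≤ σ², the form of V is nonpositive at x, whereas
  -- S > 0 makes it positive unless Aᴴ x = 0, that is, x = 0.
  set B : Matrix (Fin K) (Fin K) ℂ := ((eigMat e)ᴴ * A).updateRow k 0 with hB
  have hdet : B.det = 0 := det_eq_zero_of_row_eq_zero k fun j => by simp [hB]
  obtain ⟨c, hc0, hc⟩ := exists_mulVec_eq_zero_iff.2 hdet
  set x := A *ᵥ c with hx
  have horth : ∀ j, j ≠ k → star (e j) ⬝ᵥ x = 0 := by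
    intro j hj
    have h1 := congrFun hc j
    rw [hB, mulVec, updateRow_ne hj] at h1
    have h2 : ((eigMat e)ᴴ * A) *ᵥ c = (eigMat e)ᴴ *ᵥ x := by rw [hx, mulVec_mulVec]
    exact (congrFun h2 j).symm.trans h1
  set a := star (e k) ⬝ᵥ x with ha
  set y := noiseProj e *ᵥ x with hy
  have hxdec : x = a • e k + y := by
    have h1 : signalProj e *ᵥ x = a • e k := by
      rw [signalProj_eq, ← mulVec_mulVec]
      ext m
      simp only [mulVec, dotProduct, eigMat, of_apply, conjTranspose_apply, Pi.smul_apply,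
        smul_eq_mul]
      rw [Finset.sum_eq_single k]
      · rw [ha, mul_comm]; rfl
      · intro j _ hj
        have := horth j hj
        simp only [dotProduct, Pi.star_apply] at this
        rw [this, mul_zero]
      · simp
    rw [hy, ← h1, noiseProj, sub_mulVec, one_mulVec]; abel
  have hQQ := he.noiseProj_mul_self
  have heQ : star (e k) ⬝ᵥ y = 0 := he.star_dotProduct_noiseProj x k
  have hQe : star y ⬝ᵥ e k = 0 := by
    rw [star_dotProduct, heQ, star_zero]
  set V := dataCov M ω S σ - ((σ ^ 2 : ℝ) : ℂ) • (1 : Matrix (Fin M) (Fin M) ℂ) with hV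
  have hVA : V = A * S * Aᴴ := by rw [hV, dataCov]; simp [hA]
  have hVe : V *ᵥ e k = ((μ k - σ ^ 2 : ℝ) : ℂ) • e k := by
    rw [hV, sub_mulVec, he.eigen, smul_mulVec, one_mulVec, ← sub_smul]; simp
  have hyV : star (e k) ⬝ᵥ (V *ᵥ y) = 0 := by
    have : V *ᵥ y = noiseProj e *ᵥ (V *ᵥ x) := by
      have hc : V * noiseProj e = noiseProj e * V := by
        rw [hV, Matrix.sub_mul, Matrix.mul_sub, he.noise_commute hR]; simp
      rw [hy, mulVec_mulVec, hc, ← mulVec_mulVec]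
    rw [this, he.star_dotProduct_noiseProj]
  -- On the noise component R is at most μ_k, which the negated claim puts at or below σ².
  have hq1 : star y ⬝ᵥ (V *ᵥ y) ≤ 0 := by
    have h1 := (he.posSemidef_noise hR k).dotProduct_mulVec_nonneg y
    have hQy : noiseProj e *ᵥ y = y := by rw [hy, mulVec_mulVec, hQQ]
    rw [sub_mulVec, smul_mulVec, ← mulVec_mulVec, hQy] at h1
    have h2 : dataCov M ω S σ *ᵥ y = V *ᵥ y + ((σ ^ 2 : ℝ) : ℂ) • y := by
      rw [hV, sub_mulVec, smul_mulVec, one_mulVec]; abel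
    rw [h2, dotProduct_sub, dotProduct_add, dotProduct_smul, dotProduct_smul, smul_eq_mul,
      smul_eq_mul] at h1
    have h3 : 0 ≤ ((σ ^ 2 - μ k : ℝ) : ℂ) * (star y ⬝ᵥ y) :=
      mul_nonneg (by exact_mod_cast sub_nonneg.2 hk) (dotProduct_star_self_nonneg y)
    have h4 := add_nonneg h1 h3
    rw [← neg_nonneg]
    convert h4 using 1
    push_cast; ring
  have hq : star x ⬝ᵥ (V *ᵥ x) ≤ 0 := by
    have h1 : star x ⬝ᵥ (V *ᵥ x) = ((μ k - σ ^ 2 : ℝ) : ℂ) * (star (a • e k) ⬝ᵥ (a • e k))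
        + star y ⬝ᵥ (V *ᵥ y) := by
      conv_lhs => rw [hxdec]
      rw [mulVec_add, mulVec_smul, hVe, star_add, star_smul, add_dotProduct, dotProduct_add,
        dotProduct_add]
      simp only [smul_dotProduct, dotProduct_smul, hyV, hQe, smul_eq_mul]
      ring
    have h3 : 0 ≤ ((σ ^ 2 - μ k : ℝ) : ℂ) * (star (a • e k) ⬝ᵥ (a • e k)) :=
      mul_nonneg (by exact_mod_cast sub_nonneg.2 hk) (dotProduct_star_self_nonneg _)
    rw [h1, ← neg_nonneg]
    have h4 := add_nonneg h3 (neg_nonneg.2 hq1)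
    convert h4 using 1
    push_cast; ring
  have hAx : Aᴴ *ᵥ x = 0 := by
    by_contra hne
    have h1 := hS.dotProduct_mulVec_pos hne
    have h2 : star (Aᴴ *ᵥ x) ⬝ᵥ (S *ᵥ (Aᴴ *ᵥ x)) = star x ⬝ᵥ (V *ᵥ x) := by
      rw [hVA, star_mulVec, conjTranspose_conjTranspose, ← dotProduct_mulVec, mulVec_mulVec,
        mulVec_mulVec, Matrix.mul_assoc]
    rw [h2] at h1
    exact absurd (lt_of_lt_of_le h1 hq) (lt_irrefl _)
  have hx0 : x = 0 := by
    have h1 : star (A *ᵥ c) ⬝ᵥ x = 0 := by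
      rw [star_mulVec, ← dotProduct_mulVec, hAx, dotProduct_zero]
    rwa [← hx, dotProduct_star_self_eq_zero] at h1
  exact hc0 (hinj (by rw [← hx, hx0]; simp))

end Model
-- The pseudo-inverse of V, the identity P_A = P, and nondegeneracy of a⁽¹⁾.
section Model

variable {M K : ℕ} {ω : Fin K → ℝ} {S : Matrix (Fin K) (Fin K) ℂ} {σ : ℝ} {μ : Fin K → ℝ}
  {e : Fin K → Fin M → ℂ}

lemma signal_mul_eigMat (he : IsSignalEigensystem (dataCov M ω S σ) μ e) :
    arrayMatrix M ω * S * (arrayMatrix M ω)ᴴ * eigMat e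
      = eigMat e * diagonal (fun k => ((μ k - σ ^ 2 : ℝ) : ℂ)) := by
  have h1 := he.mul_eigMat
  have hd : diagonal (fun k => ((μ k - σ ^ 2 : ℝ) : ℂ))
      = diagonal (fun k => (μ k : ℂ)) - ((σ ^ 2 : ℝ) : ℂ) • (1 : Matrix (Fin K) (Fin K) ℂ) := by
    rw [smul_one_eq_diagonal, diagonal_sub]; congr 1; ext k; simp
  rw [hd, Matrix.mul_sub, ← h1, dataCov, Matrix.add_mul]
  simp

lemma signal_mul_pinvV (hμ : ∀ k, σ ^ 2 < μ k)
    (he : IsSignalEigensystem (dataCov M ω S σ) μ e) :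
    arrayMatrix M ω * S * (arrayMatrix M ω)ᴴ * pinvV σ μ e = signalProj e := by
  rw [pinvV_eq, ← Matrix.mul_assoc, ← Matrix.mul_assoc, signal_mul_eigMat he,
    Matrix.mul_assoc (eigMat e), diagonal_mul_diagonal, signalProj_eq]
  have : (fun i => ((μ i - σ ^ 2 : ℝ) : ℂ) * ((1 / (μ i - σ ^ 2) : ℝ) : ℂ)) = fun _ => 1 := by
    ext k
    rw [← Complex.ofReal_mul, mul_one_div_cancel (sub_pos.2 (hμ k)).ne', Complex.ofReal_one]
  rw [this, diagonal_one, Matrix.mul_one]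

/-- P = V V† begins with a factor A, which P_A fixes; hence P_A P = P = P P_A. So P_A − P is a
Hermitian idempotent, and it has trace K − K = 0. -/
lemma projA_eq_signalProj (hω : Function.Injective fun k => steering M (ω k)) (hKM : K ≤ M)
    (hS : S.PosDef) (he : IsSignalEigensystem (dataCov M ω S σ) μ e) :
    projA M ω = signalProj e := by
  have hμ := sq_lt_signal_eigenvalue hω hKM hS he
  have hu := isUnit_det_gram hω hKM
  have h1 : projA M ω * signalProj e = signalProj e := by
    rw [← signal_mul_pinvV hμ he, ← Matrix.mul_assoc, ← Matrix.mul_assoc, ← Matrix.mul_assoc,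
      projA_mul_arrayMatrix hu]
  have h2 : signalProj e * projA M ω = signalProj e := by
    have := congrArg conjTranspose h1
    rwa [conjTranspose_mul, (signalProj_isHermitian e).eq, (projA_isHermitian ω).eq] at this
  have h3 := he.signalProj_mul_self
  have h4 := projA_mul_self hu
  refine sub_eq_zero.1 (eq_zero_of_trace_eq_zero ((projA_isHermitian ω).sub
    (signalProj_isHermitian e)) ?_ ?_)
  · rw [Matrix.mul_sub, Matrix.sub_mul, Matrix.sub_mul, h1, h2, h3, h4]; abel
  · rw [trace_sub, trace_projA hu, he.trace_signalProj, sub_self]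

lemma isPinvSystem (hK : 0 < K) (hω : Function.Injective fun k => steering M (ω k)) (hKM : K ≤ M)
    (hS : S.PosDef) (he : IsSignalEigensystem (dataCov M ω S σ) μ e) :
    IsPinvSystem (arrayMatrix M ω * S * (arrayMatrix M ω)ᴴ) (signalProj e) (pinvV σ μ e) := by
  have hμ := sq_lt_signal_eigenvalue hω hKM hS he
  have hV : (arrayMatrix M ω * S * (arrayMatrix M ω)ᴴ).IsHermitian :=
    isHermitian_mul_mul_conjTranspose _ hS.isHermitian
  have hP := signalProj_isHermitian e
  have hW := pinvV_isHermitian σ μ e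
  have hVW := signal_mul_pinvV hμ he
  have hPW : signalProj e * pinvV σ μ e = pinvV σ μ e := by
    rw [pinvV_eq, signalProj_eq, Matrix.mul_assoc (eigMat e), ← Matrix.mul_assoc _ _ (eigMat e)ᴴ,
      ← Matrix.mul_assoc _ (eigMat e), he.eigMat_orth, Matrix.one_mul, ← Matrix.mul_assoc]
  have hPV : signalProj e * (arrayMatrix M ω * S * (arrayMatrix M ω)ᴴ)
      = arrayMatrix M ω * S * (arrayMatrix M ω)ᴴ := by
    rw [← projA_eq_signalProj hω hKM hS he, ← Matrix.mul_assoc, ← Matrix.mul_assoc,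
      projA_mul_arrayMatrix (isUnit_det_gram hω hKM)]
  have hVP : arrayMatrix M ω * S * (arrayMatrix M ω)ᴴ * signalProj e
      = arrayMatrix M ω * S * (arrayMatrix M ω)ᴴ := by
    have := congrArg conjTranspose hPV
    rwa [conjTranspose_mul, hP.eq, hV.eq] at this
  refine ⟨hV, hP, hW, he.signalProj_mul_self, hVW, ?_, hPW, ?_, hPV, hVP, ?_⟩
  · have := congrArg conjTranspose hVW
    rwa [conjTranspose_mul, hP.eq, hV.eq, hW.eq] at this
  · have := congrArg conjTranspose hPW
    rwa [conjTranspose_mul, hP.eq, hW.eq] at this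
  -- The eigenvalues are nondecreasing, so index 0 gives the smallest nonzero eigenvalue of V. It is
  -- the spectral gap.
  · refine ⟨μ ⟨0, hK⟩ - σ ^ 2, sub_pos.2 (hμ _), ?_⟩
    have hd : arrayMatrix M ω * S * (arrayMatrix M ω)ᴴ
        - ((μ ⟨0, hK⟩ - σ ^ 2 : ℝ) : ℂ) • signalProj e
        = eigMat e * diagonal (fun k => ((μ k - μ ⟨0, hK⟩ : ℝ) : ℂ)) * (eigMat e)ᴴ := by
      have hd : diagonal (fun k => ((μ k - μ ⟨0, hK⟩ : ℝ) : ℂ))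
          = diagonal (fun k => ((μ k - σ ^ 2 : ℝ) : ℂ))
            - ((μ ⟨0, hK⟩ - σ ^ 2 : ℝ) : ℂ) • (1 : Matrix (Fin K) (Fin K) ℂ) := by
        rw [smul_one_eq_diagonal, diagonal_sub]; congr 1; ext k; push_cast; ring
      rw [hd, Matrix.mul_sub, ← signal_mul_eigMat he, Matrix.sub_mul, Matrix.mul_assoc _ (eigMat e),
        ← signalProj_eq, hVP, Matrix.mul_smul, Matrix.mul_one, Matrix.smul_mul, ← signalProj_eq]
    rw [hd]
    refine PosSemidef.mul_mul_conjTranspose_same (PosSemidef.diagonal fun k => ?_) _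
    have : μ ⟨0, hK⟩ ≤ μ k := he.mono (Fin.mk_le_of_le_val (Nat.zero_le _))
    simpa using this

lemma noiseProj_mul_arrayMatrix (hω : Function.Injective fun k => steering M (ω k)) (hKM : K ≤ M)
    (hS : S.PosDef) (he : IsSignalEigensystem (dataCov M ω S σ) μ e) :
    noiseProj e * arrayMatrix M ω = 0 := by
  rw [noiseProj, ← projA_eq_signalProj hω hKM hS he, Matrix.sub_mul,
    projA_mul_arrayMatrix (isUnit_det_gram hω hKM), Matrix.one_mul, sub_self]

lemma noiseProj_mulVec_steering (hω : Function.Injective fun k => steering M (ω k)) (hKM : K ≤ M)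
    (hS : S.PosDef) (he : IsSignalEigensystem (dataCov M ω S σ) μ e) (k : Fin K) :
    noiseProj e *ᵥ steering M (ω k) = 0 := by
  have h := noiseProj_mul_arrayMatrix hω hKM hS he
  ext m
  exact congrFun (congrFun h m) k

/-- A vector annihilated by the noise projection lies in the range of the array matrix. -/
lemma exists_mulVec_eq_of_noiseProj_mulVec (hω : Function.Injective fun k => steering M (ω k))
    (hKM : K ≤ M) (hS : S.PosDef) (he : IsSignalEigensystem (dataCov M ω S σ) μ e)
    {v : Fin M → ℂ} (hv : noiseProj e *ᵥ v = 0) : ∃ c, arrayMatrix M ω *ᵥ c = v := by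
  rw [noiseProj, ← projA_eq_signalProj hω hKM hS he, sub_mulVec, one_mulVec, sub_eq_zero, projA,
    Matrix.mul_assoc, ← mulVec_mulVec] at hv
  exact ⟨_, hv.symm⟩

lemma star_dotProduct_noiseProj_mulVec {R : Matrix (Fin M) (Fin M) ℂ}
    (he : IsSignalEigensystem R μ e) (v : Fin M → ℂ) :
    star v ⬝ᵥ (noiseProj e *ᵥ v) = star (noiseProj e *ᵥ v) ⬝ᵥ (noiseProj e *ᵥ v) := by
  rw [star_mulVec, (noiseProj_isHermitian e).eq, ← dotProduct_mulVec, mulVec_mulVec,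
    he.noiseProj_mul_self]

/-- The quantity is ‖P⊥ a_k⁽¹⁾‖², and it vanishes only if a_k⁽¹⁾ lies in the range of A. It is the
denominator of the angle error and half the second derivative of the null spectrum. -/
lemma noise_quadratic_pos (hω : Function.Injective fun k => steering M (ω k))
    (hKM : K < M) (hS : S.PosDef) (he : IsSignalEigensystem (dataCov M ω S σ) μ e) (k : Fin K) :
    0 < star (steeringOne M (ω k)) ⬝ᵥ (noiseProj e *ᵥ steeringOne M (ω k)) := by
  rw [star_dotProduct_noiseProj_mulVec he, dotProduct_star_self_pos_iff]
  intro h0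
  obtain ⟨c, hc⟩ := exists_mulVec_eq_of_noiseProj_mulVec hω hKM.le hS he h0
  exact mulVec_ne_steeringOne hω hKM k c hc

end Model

/-! ### Perturbation of spectral projections and leading-order leakage. -/

section Perturbation

open Asymptotics
open scoped Matrix.Norms.Frobenius

variable {M K : ℕ}

lemma norm_sq_eq_re_trace (X : Matrix (Fin M) (Fin M) ℂ) : ‖X‖ ^ 2 = (Xᴴ * X).trace.re := by
  rw [frobenius_norm_def, ← Real.sqrt_eq_rpow, Real.sq_sqrt (by positivity), trace]
  simp only [diag_apply, Matrix.mul_apply, conjTranspose_apply, Complex.re_sum]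
  rw [Finset.sum_comm]
  refine Finset.sum_congr rfl fun i _ => Finset.sum_congr rfl fun j _ => ?_
  rw [Complex.star_def, ← Complex.normSq_eq_conj_mul_self, Complex.ofReal_re,
    Complex.normSq_eq_norm_sq]
  simp

lemma norm_entry_le_norm (X : Matrix (Fin M) (Fin M) ℂ) (i j : Fin M) : ‖X i j‖ ≤ ‖X‖ := by
  have h : ‖X i j‖ ^ 2 ≤ ‖X‖ ^ 2 := by
    rw [frobenius_norm_def, ← Real.sqrt_eq_rpow, Real.sq_sqrt (by positivity)]
    simp only [Real.rpow_two]
    exact (Finset.single_le_sum (f := fun j => ‖X i j‖ ^ 2) (fun _ _ => by positivity)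
      (Finset.mem_univ j)).trans (Finset.single_le_sum (f := fun i => ∑ j, ‖X i j‖ ^ 2)
        (fun _ _ => by positivity) (Finset.mem_univ i))
  exact le_of_sq_le_sq h (norm_nonneg _)

lemma norm_le_sum_norm_entry (X : Matrix (Fin M) (Fin M) ℂ) : ‖X‖ ≤ ∑ i, ∑ j, ‖X i j‖ := by
  rw [frobenius_norm_def, ← Real.sqrt_eq_rpow]
  refine Real.sqrt_le_iff.2 ⟨by positivity, ?_⟩
  simp only [Real.rpow_two]
  calc ∑ i, ∑ j, ‖X i j‖ ^ 2 ≤ ∑ i, (∑ j, ‖X i j‖) ^ 2 :=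
        Finset.sum_le_sum fun i _ => Finset.sum_sq_le_sq_sum_of_nonneg fun j _ => norm_nonneg _
    _ ≤ _ := Finset.sum_sq_le_sq_sum_of_nonneg fun i _ => by positivity

lemma norm_trace_le (X : Matrix (Fin M) (Fin M) ℂ) : ‖X.trace‖ ≤ M * ‖X‖ := by
  calc ‖X.trace‖ ≤ ∑ i, ‖X i i‖ := norm_sum_le _ _
    _ ≤ ∑ _i : Fin M, ‖X‖ := Finset.sum_le_sum fun i _ => norm_entry_le_norm X i i
    _ = M * ‖X‖ := by simp

/-- Perturbation estimates are made in the submultiplicative Frobenius norm, while derivatives and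
null spectra are handled entrywise. This passes between the two. -/
lemma isBigO_matrix_iff {ι : Type*} {l : Filter ι} {X : ι → Matrix (Fin M) (Fin M) ℂ}
    {g : ι → ℝ} : X =O[l] g ↔ ∀ i j, (fun t => X t i j) =O[l] g := by
  refine ⟨fun h i j => (IsBigO.of_bound 1 (Eventually.of_forall fun t => ?_)).trans h, fun h => ?_⟩
  · rw [one_mul]; exact norm_entry_le_norm _ _ _
  · have h1 : (fun t => ∑ i, ∑ j, ‖X t i j‖) =O[l] g :=
      IsBigO.fun_sum fun i _ => IsBigO.fun_sum fun j _ => (h i j).norm_left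
    refine (IsBigO.of_bound 1 (Eventually.of_forall fun t => ?_)).trans h1
    rw [one_mul]
    exact (norm_le_sum_norm_entry _).trans (le_abs_self _)

lemma isBigO_trace {ι : Type*} {l : Filter ι} {X : ι → Matrix (Fin M) (Fin M) ℂ}
    {g : ι → ℝ} (h : X =O[l] g) : (fun t => (X t).trace) =O[l] g :=
  (IsBigO.of_bound M (Eventually.of_forall fun _ => norm_trace_le _)).trans h

lemma isBigO_const_mul_matrix {ι : Type*} {l : Filter ι} {X : ι → Matrix (Fin M) (Fin M) ℂ}
    {g : ι → ℝ} (A : Matrix (Fin M) (Fin M) ℂ) (h : X =O[l] g) : (fun t => A * X t) =O[l] g :=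
  (IsBigO.of_bound ‖A‖ (Eventually.of_forall fun _ => norm_mul_le _ _)).trans h

lemma isBigO_mul_const_matrix {ι : Type*} {l : Filter ι} {X : ι → Matrix (Fin M) (Fin M) ℂ}
    {g : ι → ℝ} (h : X =O[l] g) (A : Matrix (Fin M) (Fin M) ℂ) : (fun t => X t * A) =O[l] g :=
  (IsBigO.of_bound ‖A‖ (Eventually.of_forall fun _ => by
    rw [mul_comm]; exact norm_mul_le _ _)).trans h

lemma re_trace_mul_nonneg {X Y : Matrix (Fin M) (Fin M) ℂ} (hX : X.PosSemidef)
    (hY : Y.IsHermitian) (hYY : Y * Y = Y) : 0 ≤ (X * Y).trace.re := by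
  have h1 := (hX.conjTranspose_mul_mul_same Y).trace_nonneg
  rw [hY.eq, trace_mul_comm, ← Matrix.mul_assoc, hYY, trace_mul_comm] at h1
  exact (Complex.le_def.1 h1).1

variable {V P W : Matrix (Fin M) (Fin M) ℂ}

/-- The signal projection of a perturbed matrix is Lipschitz close to the unperturbed one. -/
lemma norm_signalProj_sub_le (h : IsPinvSystem V P W) (hP : P.trace = K) {c : ℝ} (hc0 : 0 < c)
    (hc : (V - (c : ℂ) • P).PosSemidef) {s : ℂ} {R Δ : Matrix (Fin M) (Fin M) ℂ}
    (hRV : R = V + s • 1) (hR : (R + Δ).IsHermitian) {μ : Fin K → ℝ} {e : Fin K → Fin M → ℂ}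
    (he : IsSignalEigensystem (R + Δ) μ e) :
    ‖signalProj e - P‖ ≤ 2 * M / c * ‖Δ‖ := by
  set D := signalProj e - P with hD
  have hPe := signalProj_isHermitian e
  have hPP := he.signalProj_mul_self
  -- The perturbed projection beats P for R + Δ, while the gap makes it lose at least c‖D‖²/2 for V.
  -- The gain can only come from Δ, so c‖D‖² is at most a multiple of ‖Δ‖‖D‖, and one factor ‖D‖
  -- cancels.
  have h1 := he.re_trace_le hR h.herm_P h.PP hP
  have h2 := re_trace_mul_nonneg hc (isHermitian_one.sub hPe)
    (by rw [Matrix.mul_sub, Matrix.sub_mul, Matrix.sub_mul, hPP]; simp)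
  have h3 : ‖D‖ ^ 2 = 2 * (K - (P * signalProj e).trace.re) := by
    rw [norm_sq_eq_re_trace, hD, conjTranspose_sub, hPe.eq, h.herm_P.eq, Matrix.mul_sub,
      Matrix.sub_mul, Matrix.sub_mul, hPP, h.PP, trace_sub, trace_sub, trace_sub,
      trace_mul_comm (signalProj e) P, he.trace_signalProj, hP]
    simp only [Complex.sub_re, Complex.natCast_re]
    ring
  have h4 : (Δ * D).trace.re ≤ M * (‖Δ‖ * ‖D‖) :=
    (Complex.re_le_norm _).trans ((norm_trace_le _).trans
      (mul_le_mul_of_nonneg_left (norm_mul_le _ _) (Nat.cast_nonneg _)))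
  have h5 : ((R + Δ) * signalProj e).trace.re - ((R + Δ) * P).trace.re
      = (Δ * D).trace.re - (V * (1 - signalProj e)).trace.re := by
    rw [← Complex.sub_re, ← Complex.sub_re, hD, hRV]
    congr 1
    simp only [Matrix.add_mul, Matrix.mul_sub, trace_add, trace_sub, smul_mul, Matrix.one_mul,
      trace_smul, Matrix.mul_one, h.VP, he.trace_signalProj, hP]
    ring
  have h6 : ((V - (c : ℂ) • P) * (1 - signalProj e)).trace.re
      = (V * (1 - signalProj e)).trace.re - c * (K - (P * signalProj e).trace.re) := by
    rw [Matrix.sub_mul, trace_sub, smul_mul, trace_smul, Matrix.mul_sub P, trace_sub,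
      Matrix.mul_one, hP, smul_eq_mul]
    simp
  have h7 : c * ‖D‖ ^ 2 ≤ 2 * M * ‖Δ‖ * ‖D‖ := by
    rw [h3]; nlinarith
  rcases (norm_nonneg D).eq_or_lt with h0 | h0
  · rw [← h0]; positivity
  · have h8 : c * ‖D‖ ≤ 2 * M * ‖Δ‖ := by
      by_contra! hlt
      nlinarith [mul_lt_mul_of_pos_right hlt h0]
    rw [div_mul_eq_mul_div, le_div_iff₀ hc0]
    linarith

/-- The second order expansion of a spectral projection, with an explicit remainder. -/
lemma proj_sub_expansion (h : IsPinvSystem V P W) {s : ℂ} {R Δ P' : Matrix (Fin M) (Fin M) ℂ}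
    (hRV : R = V + s • 1) (hΔ : Δ.IsHermitian) (hP' : P'.IsHermitian) (hPP' : P' * P' = P')
    (hcomm : (R + Δ) * P' = P' * (R + Δ)) :
    (P' - P) - (W * Δ * (1 - P) + (1 - P) * Δ * W)
      = -(P * (P' - P) * (P' - P) * P) + (1 - P) * (P' - P) * (P' - P) * (1 - P)
        + (1 - P) * Δ * (P' - P) * W - (1 - P) * (P' - P) * Δ * W
        + (W * (P' - P) * Δ * (1 - P) - W * Δ * (P' - P) * (1 - P)) := by
  set D := P' - P with hD
  set Q := 1 - P with hQ
  have hQP : Q * P = 0 := by rw [hQ, Matrix.sub_mul, h.PP, Matrix.one_mul, sub_self]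
  have hPQ : P * Q = 0 := by rw [hQ, Matrix.mul_sub, h.PP, Matrix.mul_one, sub_self]
  have hQV : Q * V = 0 := by rw [hQ, Matrix.sub_mul, h.PV, Matrix.one_mul, sub_self]
  have hQH : Qᴴ = Q := by rw [hQ, conjTranspose_sub, h.herm_P.eq, conjTranspose_one]
  have hDH : Dᴴ = D := by rw [hD, conjTranspose_sub, h.herm_P.eq, hP'.eq]
  -- Idempotency of P + D. Its diagonal blocks show that P D P and Q D Q are quadratic in D.
  have hD2 : P * D + D * P + D * D = D := by
    have : (P + D) * (P + D) = P + D := by rw [hD]; simpa using hPP'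
    rw [Matrix.add_mul, Matrix.mul_add, Matrix.mul_add, h.PP] at this
    calc P * D + D * P + D * D = (P + P * D + (D * P + D * D)) - P := by abel
      _ = D := by rw [this]; abel
  -- Commutation of P + D with V + Δ; the scalar part of R drops out. Multiplying by Q on the left
  -- and W on the right solves for the off-diagonal block Q D P, because Q V = 0 and V W = P.
  have hcV : V * D + Δ * (P + D) = D * V + (P + D) * Δ := by
    have h1 : (V + Δ) * (P + D) = (P + D) * (V + Δ) := by
      have hPD : P + D = P' := by rw [hD]; abel
      rw [hPD]
      rw [hRV] at hcomm
      have h2 : ∀ X : Matrix (Fin M) (Fin M) ℂ, (V + s • 1 + Δ) * X = (V + Δ) * X + s • X :=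
        fun X => by simp only [Matrix.add_mul, smul_mul, Matrix.one_mul]; abel
      have h3 : ∀ X : Matrix (Fin M) (Fin M) ℂ, X * (V + s • 1 + Δ) = X * (V + Δ) + s • X :=
        fun X => by simp only [Matrix.mul_add, Matrix.mul_smul, Matrix.mul_one]; abel
      rw [h2, h3] at hcomm
      exact add_right_cancel hcomm
    have ha : (V + Δ) * (P + D) = V + (V * D + Δ * (P + D)) := by
      rw [Matrix.add_mul, Matrix.mul_add V, h.VP]; abel
    have hb : (P + D) * (V + Δ) = V + (D * V + (P + D) * Δ) := by
      rw [Matrix.mul_add, Matrix.add_mul _ _ V, h.PV]; abel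
    rw [ha, hb] at h1
    exact add_left_cancel h1
  have hPDP : P * D * P = -(P * D * D * P) := by
    have h1 := congrArg (fun X => P * X * P) hD2
    simp only [Matrix.mul_add, Matrix.add_mul, ← Matrix.mul_assoc, h.PP] at h1
    rw [Matrix.mul_assoc (P * D) P P, h.PP] at h1
    rw [eq_neg_iff_add_eq_zero]
    calc P * D * P + P * D * D * P = (P * D * P + P * D * P + P * D * D * P) - P * D * P := by abel
      _ = 0 := by rw [h1, sub_self]
  have hQDQ : Q * D * Q = Q * D * D * Q := by
    have h1 := congrArg (fun X => Q * X * Q) hD2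
    simp only [Matrix.mul_add, Matrix.add_mul, ← Matrix.mul_assoc, hQP] at h1
    rw [Matrix.mul_assoc (Q * D) P Q, hPQ] at h1
    rw [← h1]; simp
  have hQDP : Q * D * P = Q * Δ * W + Q * Δ * D * W - Q * D * Δ * W := by
    have h1 := congrArg (fun X => Q * X * W) hcV
    simp only [Matrix.mul_add, Matrix.add_mul, ← Matrix.mul_assoc, hQP, hQV] at h1
    rw [Matrix.mul_assoc (Q * Δ) P W, h.PW, Matrix.mul_assoc (Q * D) V W, h.VW] at h1
    simp only [Matrix.zero_mul, zero_add] at h1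
    rw [h1]; abel
  have hPDQ : P * D * Q = W * Δ * Q + W * D * Δ * Q - W * Δ * D * Q := by
    have h1 := congrArg conjTranspose hQDP
    simp only [conjTranspose_add, conjTranspose_sub, conjTranspose_mul, hQH, hDH, h.herm_P.eq,
      h.herm_W.eq, hΔ.eq, ← Matrix.mul_assoc] at h1
    exact h1
  have hdec : D = P * D * P + P * D * Q + Q * D * P + Q * D * Q := by
    rw [hQ]; noncomm_ring
  conv_lhs => rw [hdec, hPDP, hQDQ, hQDP, hPDQ]
  abel

lemma subspaceLeakage_eq {Q : Matrix (Fin M) (Fin M) ℂ} (hQ : Q.IsHermitian)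
    (e : Fin K → Fin M → ℂ) :
    (subspaceLeakage Q e : ℂ) = 1 / (K : ℂ) * (Q * signalProj e * Q).trace := by
  have h1 : (Q * signalProj e * Q).trace = ((Q * eigMat e) * (Q * eigMat e)ᴴ).trace := by
    rw [signalProj_eq, conjTranspose_mul, hQ.eq]; simp only [Matrix.mul_assoc]
  rw [h1, trace, subspaceLeakage]
  push_cast
  congr 1
  rw [Finset.sum_comm]
  refine Finset.sum_congr rfl fun m _ => ?_
  rw [diag_apply, Matrix.mul_apply]
  refine Finset.sum_congr rfl fun k _ => ?_
  rw [conjTranspose_apply, Complex.star_def, Complex.mul_conj, Complex.normSq_eq_norm_sq]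
  push_cast
  rfl

variable {ι : Type*} {l : Filter ι} {ε : ι → ℝ}

/-- First order perturbation of the signal projection, with the error terms. -/
lemma isBigO_signalProj (h : IsPinvSystem V P W) (hP : P.trace = K) {s : ℂ}
    {R : Matrix (Fin M) (Fin M) ℂ} (hRV : R = V + s • 1) (hR : R.IsHermitian)
    {Δ : ι → Matrix (Fin M) (Fin M) ℂ} {μ : ι → Fin K → ℝ} {e : ι → Fin K → Fin M → ℂ}
    (hΔ : ∀ᶠ i in l, (Δ i).IsHermitian) (hΔε : Δ =O[l] ε)
    (he : ∀ᶠ i in l, IsSignalEigensystem (R + Δ i) (μ i) (e i)) :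
    (fun i => signalProj (e i) - P) =O[l] ε ∧
    (fun i => signalProj (e i) - P - (W * Δ i * (1 - P) + (1 - P) * Δ i * W))
      =O[l] fun i => ε i ^ 2 := by
  obtain ⟨c, hc0, hc⟩ := h.coercive
  have hD : (fun i => signalProj (e i) - P) =O[l] ε := by
    refine IsBigO.trans (IsBigO.of_bound (2 * M / c) ?_) hΔε
    filter_upwards [hΔ, he] with i hΔi hei
    exact norm_signalProj_sub_le h hP hc0 hc hRV (hR.add hΔi) hei
  refine ⟨hD, ?_⟩
  have hDD : (fun i => (signalProj (e i) - P) * (signalProj (e i) - P)) =O[l] fun i => ε i ^ 2 := by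
    simpa only [sq] using hD.mul hD
  have hDΔ : (fun i => (signalProj (e i) - P) * Δ i) =O[l] fun i => ε i ^ 2 := by
    simpa only [sq] using hD.mul hΔε
  have hΔD : (fun i => Δ i * (signalProj (e i) - P)) =O[l] fun i => ε i ^ 2 := by
    simpa only [sq] using hΔε.mul hD
  have key : ∀ {X : ι → Matrix (Fin M) (Fin M) ℂ} (A B : Matrix (Fin M) (Fin M) ℂ),
      (X =O[l] fun i => ε i ^ 2) → (fun i => A * X i * B) =O[l] fun i => ε i ^ 2 :=
    fun A B hX => isBigO_mul_const_matrix (isBigO_const_mul_matrix A hX) B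
  have hall := ((((key P P hDD).neg_left.add (key (1 - P) (1 - P) hDD)).add
    (key (1 - P) W hΔD)).sub (key (1 - P) W hDΔ)).add
    ((key W (1 - P) hDΔ).sub (key W (1 - P) hΔD))
  refine IsBigO.congr' hall ?_ EventuallyEq.rfl
  filter_upwards [hΔ, he] with i hΔi hei
  rw [proj_sub_expansion h hRV hΔi (signalProj_isHermitian _) hei.signalProj_mul_self
    (hei.commute (hR.add hΔi))]
  simp only [Matrix.mul_assoc]

/-- The leading order of the subspace leakage. -/
lemma isBigO_subspaceLeakage (h : IsPinvSystem V P W) (hP : P.trace = K) {s : ℂ}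
    {R : Matrix (Fin M) (Fin M) ℂ} (hRV : R = V + s • 1) (hR : R.IsHermitian)
    {Δ : ι → Matrix (Fin M) (Fin M) ℂ} {μ : ι → Fin K → ℝ} {e : ι → Fin K → Fin M → ℂ}
    (hΔ : ∀ᶠ i in l, (Δ i).IsHermitian) (hΔε : Δ =O[l] ε)
    (he : ∀ᶠ i in l, IsSignalEigensystem (R + Δ i) (μ i) (e i)) :
    (fun i => (subspaceLeakage (1 - P) (e i) : ℂ) - rho1 K (1 - P) W (Δ i))
      =O[l] fun i => ε i ^ 3 := by
  obtain ⟨hD, hE⟩ := isBigO_signalProj h hP hRV hR hΔ hΔε he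
  have hQP : (1 - P) * P = 0 := by rw [Matrix.sub_mul, h.PP, Matrix.one_mul, sub_self]
  have hPQ : P * (1 - P) = 0 := by rw [Matrix.mul_sub, h.PP, Matrix.mul_one, sub_self]
  have hQQ : (1 - P) * (1 - P) = 1 - P := by
    rw [Matrix.mul_sub, hQP, Matrix.mul_one, sub_zero]
  have hWQ : W * (1 - P) = 0 := by rw [Matrix.mul_sub, h.WP, Matrix.mul_one, sub_self]
  have hQW : (1 - P) * W = 0 := by rw [Matrix.sub_mul, h.PW, Matrix.one_mul, sub_self]
  set Q := 1 - P with hQ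
  have hQH : Q.IsHermitian := isHermitian_one.sub h.herm_P
  set D : ι → Matrix (Fin M) (Fin M) ℂ := fun i => signalProj (e i) - P with hDdef
  set E : ι → Matrix (Fin M) (Fin M) ℂ := fun i => D i - (W * Δ i * Q + Q * Δ i * W) with hEdef
  -- The leakage is the trace of (Q D)(D Q). Replacing each factor in turn by its linear part leaves
  -- one first-order factor times one second-order remainder.
  have h1 : (fun i => Q * E i * (D i * Q)) =O[l] fun i => ε i ^ 3 := by
    have := (isBigO_const_mul_matrix Q hE).mul (isBigO_mul_const_matrix hD Q)
    simpa only [← pow_succ] using this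
  have h2 : (fun i => (Q * Δ i * W) * (E i * Q)) =O[l] fun i => ε i ^ 3 := by
    have := (isBigO_mul_const_matrix (isBigO_const_mul_matrix Q hΔε) W).mul
      (isBigO_mul_const_matrix hE Q)
    simpa only [← pow_succ'] using this
  have h3 := (isBigO_trace (h1.add h2)).const_mul_left (1 / (K : ℂ))
  refine IsBigO.congr' h3 ?_ EventuallyEq.rfl
  filter_upwards [hΔ, he] with i hΔi hei
  rw [subspaceLeakage_eq hQH, rho1, ← mul_sub]
  congr 1
  have h4 : (W * Δ i * Q * Δ i * W).trace = ((Q * Δ i * W) * (W * Δ i * Q)).trace := by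
    rw [show W * Δ i * Q * Δ i * W = (W * Δ i * Q) * (Q * Δ i * W) by
      calc W * Δ i * Q * Δ i * W = W * Δ i * (Q * Q) * Δ i * W := by rw [hQQ]
        _ = _ := by simp only [Matrix.mul_assoc], trace_mul_comm]
  rw [h4, ← trace_sub]
  congr 1
  have hDD : Q * signalProj (e i) * Q = Q * D i * (D i * Q) := by
    have hs : signalProj (e i) * signalProj (e i) = signalProj (e i) := hei.signalProj_mul_self
    have ha : Q * D i = Q * signalProj (e i) := by
      simp only [hDdef]; rw [Matrix.mul_sub, hQP, sub_zero]
    have hb : D i * Q = signalProj (e i) * Q := by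
      simp only [hDdef]; rw [Matrix.sub_mul, hPQ, sub_zero]
    rw [ha, hb, ← Matrix.mul_assoc, Matrix.mul_assoc Q (signalProj (e i)) (signalProj (e i)), hs]
  have hQD : Q * D i = Q * Δ i * W + Q * E i := by
    change _ = _ + Q * (D i - _)
    rw [Matrix.mul_sub Q (D i), Matrix.mul_add, ← Matrix.mul_assoc, ← Matrix.mul_assoc,
      ← Matrix.mul_assoc, ← Matrix.mul_assoc, hQW, hQQ]
    simp
  have hDQ : D i * Q = W * Δ i * Q + E i * Q := by
    change _ = _ + (D i - _) * Q
    rw [Matrix.sub_mul (D i), Matrix.add_mul, Matrix.mul_assoc _ Q Q, hQQ,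
      Matrix.mul_assoc _ W Q, hWQ]
    simp
  rw [hDD]
  conv_rhs => rw [hQD]
  rw [Matrix.add_mul]
  nth_rewrite 2 [hDQ]
  rw [Matrix.mul_add]
  abel

/-- ρ₁ is quadratic in the perturbation, so a second-order change of a first-order argument alters
it only at third order. This lets T be replaced by its linear part. -/
lemma isBigO_rho1_sub {Q W : Matrix (Fin M) (Fin M) ℂ} {Δ₁ Δ₂ : ι → Matrix (Fin M) (Fin M) ℂ}
    (h₁ : Δ₁ =O[l] ε) (h₂ : Δ₂ =O[l] ε) (h : (fun i => Δ₁ i - Δ₂ i) =O[l] fun i => ε i ^ 2) :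
    (fun i => rho1 K Q W (Δ₁ i) - rho1 K Q W (Δ₂ i)) =O[l] fun i => ε i ^ 3 := by
  have ha : (fun i => W * (Δ₁ i - Δ₂ i) * Q * (Δ₁ i * W)) =O[l] fun i => ε i ^ 3 := by
    have := (isBigO_mul_const_matrix (isBigO_const_mul_matrix W h) Q).mul
      (isBigO_mul_const_matrix h₁ W)
    simpa only [← pow_succ] using this
  have hb : (fun i => W * Δ₂ i * Q * ((Δ₁ i - Δ₂ i) * W)) =O[l] fun i => ε i ^ 3 := by
    have := (isBigO_mul_const_matrix (isBigO_const_mul_matrix W h₂) Q).mul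
      (isBigO_mul_const_matrix h W)
    simpa only [← pow_succ'] using this
  refine IsBigO.congr_left ((isBigO_trace (ha.add hb)).const_mul_left (1 / (K : ℂ))) fun i => ?_
  rw [rho1, rho1, ← mul_sub, ← trace_sub]
  congr 2
  simp only [Matrix.mul_sub, Matrix.sub_mul, Matrix.mul_assoc]
  abel

end Perturbation

/-! ### Analyticity of P_A in the angles and identities for its derivatives. -/

section Derivatives

open Asymptotics

variable {M K : ℕ}

lemma hasDerivAt_mul_entry {l m n : Type*} [Fintype m] {A : ℝ → Matrix l m ℂ}
    {B : ℝ → Matrix m n ℂ} {A' : Matrix l m ℂ} {B' : Matrix m n ℂ} {u : ℝ}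
    (hA : ∀ i j, HasDerivAt (fun u => A u i j) (A' i j) u)
    (hB : ∀ i j, HasDerivAt (fun u => B u i j) (B' i j) u) (i : l) (j : n) :
    HasDerivAt (fun u => (A u * B u) i j) ((A' * B u + A u * B') i j) u := by
  simp only [Matrix.mul_apply, Matrix.add_apply, ← Finset.sum_add_distrib]
  exact HasDerivAt.fun_sum fun k _ => (hA i k).fun_mul (hB k j)

lemma analyticAt_arrayMatrix (ω : Fin K → ℝ) (i : Fin M) (j : Fin K) :
    AnalyticAt ℝ (fun w : Fin K → ℝ => arrayMatrix M w i j) ω := by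
  have h1 : AnalyticAt ℝ (fun w : Fin K → ℝ => (w j : ℂ)) ω :=
    (Complex.ofRealCLM.comp
      (ContinuousLinearMap.proj (R := ℝ) (φ := fun _ : Fin K => ℝ) j)).analyticAt ω
  have h2 : AnalyticAt ℝ (fun w : Fin K → ℝ => -(Complex.I * (i : ℕ) * w j)) ω :=
    (analyticAt_const.mul h1).neg
  exact AnalyticAt.fun_comp (AnalyticAt.restrictScalars (𝕜 := ℝ) analyticAt_cexp) h2

lemma analyticAt_star {E : Type*} [NormedAddCommGroup E] [NormedSpace ℝ E] {f : E → ℂ} {x : E}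
    (h : AnalyticAt ℝ f x) : AnalyticAt ℝ (fun y => star (f y)) x :=
  (Complex.conjCLE.toContinuousLinearMap.analyticAt (f x)).fun_comp h

lemma analyticAt_mul_entry {E : Type*} [NormedAddCommGroup E] [NormedSpace ℝ E]
    {l m n : Type*} [Fintype m] {A : E → Matrix l m ℂ} {B : E → Matrix m n ℂ} {x : E}
    (hA : ∀ i j, AnalyticAt ℝ (fun y => A y i j) x)
    (hB : ∀ i j, AnalyticAt ℝ (fun y => B y i j) x) (i : l) (j : n) :
    AnalyticAt ℝ (fun y => (A y * B y) i j) x := by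
  simp only [Matrix.mul_apply]
  exact Finset.analyticAt_fun_sum _ fun k _ => (hA i k).fun_mul (hB k j)

lemma analyticAt_det {E : Type*} [NormedAddCommGroup E] [NormedSpace ℝ E]
    {n : Type*} [Fintype n] [DecidableEq n] {A : E → Matrix n n ℂ} {x : E}
    (hA : ∀ i j, AnalyticAt ℝ (fun y => A y i j) x) :
    AnalyticAt ℝ (fun y => (A y).det) x := by
  simp only [Matrix.det_apply']
  exact Finset.analyticAt_fun_sum _ fun σ _ =>
    analyticAt_const.fun_mul (Finset.analyticAt_fun_prod _ fun i _ => hA _ _)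

lemma analyticAt_inv_entry {E : Type*} [NormedAddCommGroup E] [NormedSpace ℝ E]
    {n : Type*} [Fintype n] [DecidableEq n] {A : E → Matrix n n ℂ} {x : E}
    (hA : ∀ i j, AnalyticAt ℝ (fun y => A y i j) x) (hx : IsUnit (A x).det) (i j : n) :
    AnalyticAt ℝ (fun y => (A y)⁻¹ i j) x := by
  simp only [Matrix.inv_def, Matrix.smul_apply, smul_eq_mul, Ring.inverse_eq_inv',
    adjugate_apply]
  refine ((analyticAt_det hA).fun_inv hx.ne_zero).fun_mul (analyticAt_det fun a b => ?_)
  by_cases h : a = j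
  · subst h
    simp only [updateRow_self]
    exact analyticAt_const
  · simp only [updateRow_ne h]
    exact hA a b

lemma analyticAt_conjTranspose_entry {E : Type*} [NormedAddCommGroup E] [NormedSpace ℝ E]
    {m n : Type*} {A : E → Matrix m n ℂ} {x : E}
    (hA : ∀ i j, AnalyticAt ℝ (fun y => A y i j) x) (i : n) (j : m) :
    AnalyticAt ℝ (fun y => (A y)ᴴ i j) x := by
  simp only [conjTranspose_apply]
  exact analyticAt_star (hA j i)

lemma analyticAt_gram (ω : Fin K → ℝ) (i j : Fin K) :
    AnalyticAt ℝ (fun w => ((arrayMatrix M w)ᴴ * arrayMatrix M w) i j) ω :=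
  analyticAt_mul_entry (analyticAt_conjTranspose_entry (analyticAt_arrayMatrix ω))
    (analyticAt_arrayMatrix ω) i j

variable {ω : Fin K → ℝ}

/-- Real analyticity supplies both the partial derivatives and a quadratic Taylor remainder. The
inverse Gram matrix is analytic through the adjugate formula. -/
lemma analyticAt_projA (h : IsUnit ((arrayMatrix M ω)ᴴ * arrayMatrix M ω).det) (i j : Fin M) :
    AnalyticAt ℝ (fun w => projA M w i j) ω :=
  analyticAt_mul_entry (analyticAt_mul_entry (analyticAt_arrayMatrix ω)
    (analyticAt_inv_entry (analyticAt_gram ω) h))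
    (analyticAt_conjTranspose_entry (analyticAt_arrayMatrix ω)) i j

lemma hasDerivAt_comp_update {f : (Fin K → ℝ) → ℂ} (hf : DifferentiableAt ℝ f ω) (k : Fin K) :
    HasDerivAt (fun u => f (Function.update ω k u)) (fderiv ℝ f ω (Pi.single k 1)) (ω k) := by
  have h1 : HasFDerivAt f (fderiv ℝ f ω) (Function.update ω k (ω k)) := by
    rw [Function.update_eq_self]; exact hf.hasFDerivAt
  exact h1.comp_hasDerivAt _ (hasDerivAt_update ω k (ω k))

lemma hasDerivAt_arrayMatrix (k : Fin K) (i : Fin M) (j : Fin K) :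
    HasDerivAt (fun u => arrayMatrix M (Function.update ω k u) i j) (partialA M ω k i j) (ω k) :=
  (hasDerivAt_comp_update (analyticAt_arrayMatrix ω i j).differentiableAt
    k).differentiableAt.hasDerivAt

lemma hasDerivAt_projA (h : IsUnit ((arrayMatrix M ω)ᴴ * arrayMatrix M ω).det) (k : Fin K)
    (i j : Fin M) :
    HasDerivAt (fun u => projA M (Function.update ω k u) i j) (partialProjA M ω k i j) (ω k) :=
  (hasDerivAt_comp_update (analyticAt_projA h i j).differentiableAt k).differentiableAt.hasDerivAt

lemma partialProjA_apply (h : IsUnit ((arrayMatrix M ω)ᴴ * arrayMatrix M ω).det) (k : Fin K)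
    (i j : Fin M) :
    partialProjA M ω k i j = fderiv ℝ (fun w => projA M w i j) ω (Pi.single k 1) :=
  (hasDerivAt_comp_update (analyticAt_projA h i j).differentiableAt k).deriv

/-- The identities P_A² = P_A and P_A A = A are available where the Gram matrix is invertible. To be
differentiated they must hold on a neighbourhood. -/
lemma eventually_isUnit_det_gram (h : IsUnit ((arrayMatrix M ω)ᴴ * arrayMatrix M ω).det)
    (k : Fin K) : ∀ᶠ u in 𝓝 (ω k), IsUnit ((arrayMatrix M (Function.update ω k u))ᴴ
      * arrayMatrix M (Function.update ω k u)).det := by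
  have hc : ContinuousAt (fun u => ((arrayMatrix M (Function.update ω k u))ᴴ
      * arrayMatrix M (Function.update ω k u)).det) (ω k) := by
    have h1 : ContinuousAt (fun w => ((arrayMatrix M w)ᴴ * arrayMatrix M w).det)
        (Function.update ω k (ω k)) := by
      rw [Function.update_eq_self]
      exact (analyticAt_det (analyticAt_gram ω)).continuousAt
    exact h1.comp (hasDerivAt_update ω k (ω k)).continuousAt
  have h2 := hc.eventually_ne (y := 0) (by rw [Function.update_eq_self]; exact h.ne_zero)
  filter_upwards [h2] with u hu using isUnit_iff_ne_zero.2 hu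

lemma partialProjA_isHermitian (h : IsUnit ((arrayMatrix M ω)ᴴ * arrayMatrix M ω).det)
    (k : Fin K) : (partialProjA M ω k).IsHermitian := by
  ext i j
  rw [conjTranspose_apply]
  refine HasDerivAt.unique (hasDerivAt_projA h k j i).star ?_
  have h1 := hasDerivAt_projA h k i j
  have h2 : (fun u => projA M (Function.update ω k u) i j)
      = fun u => star (projA M (Function.update ω k u) j i) := by
    ext u; exact ((projA_isHermitian (Function.update ω k u)).apply i j).symm
  rwa [h2] at h1

/-- The product rule applied to P_A² = P_A. -/
lemma partialProjA_mul_add (h : IsUnit ((arrayMatrix M ω)ᴴ * arrayMatrix M ω).det)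
    (k : Fin K) :
    partialProjA M ω k * projA M ω + projA M ω * partialProjA M ω k = partialProjA M ω k := by
  ext i j
  have h1 := hasDerivAt_mul_entry (hasDerivAt_projA h k) (hasDerivAt_projA h k) i j
  rw [Function.update_eq_self] at h1
  refine h1.unique ((hasDerivAt_projA h k i j).congr_of_eventuallyEq ?_)
  filter_upwards [eventually_isUnit_det_gram h k] with u hu
  rw [projA_mul_self hu]

/-- The product rule applied to P_A A = A. -/
lemma partialProjA_mul_arrayMatrix (h : IsUnit ((arrayMatrix M ω)ᴴ * arrayMatrix M ω).det)
    (k : Fin K) :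
    partialProjA M ω k * arrayMatrix M ω = (1 - projA M ω) * partialA M ω k := by
  have : partialProjA M ω k * arrayMatrix M ω + projA M ω * partialA M ω k
      = partialA M ω k := by
    ext i j
    have h1 := hasDerivAt_mul_entry (hasDerivAt_projA h k) (hasDerivAt_arrayMatrix k) i j
    rw [Function.update_eq_self] at h1
    refine h1.unique ((hasDerivAt_arrayMatrix k i j).congr_of_eventuallyEq ?_)
    filter_upwards [eventually_isUnit_det_gram h k] with u hu
    rw [projA_mul_arrayMatrix hu]
  rw [Matrix.sub_mul, Matrix.one_mul, eq_sub_iff_add_eq, this]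

/-- The tangent to the manifold of projections is off-diagonal: sandwiching the differentiated
idempotency kills the diagonal blocks. -/
lemma compl_mul_partialProjA_mul_compl (h : IsUnit ((arrayMatrix M ω)ᴴ * arrayMatrix M ω).det)
    (k : Fin K) : (1 - projA M ω) * partialProjA M ω k * (1 - projA M ω) = 0 := by
  have h1 := partialProjA_mul_add h k
  have h2 := projA_mul_self h
  have h3 := congrArg (fun X => X * projA M ω) h1
  simp only [Matrix.add_mul] at h3
  rw [Matrix.mul_assoc _ (projA M ω) (projA M ω), h2] at h3
  have h4 : projA M ω * partialProjA M ω k * projA M ω = 0 := by simpa using h3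
  rw [Matrix.mul_sub, Matrix.mul_one, Matrix.sub_mul, Matrix.one_mul, Matrix.sub_mul, h4, sub_zero]
  nth_rewrite 1 [← h1]
  abel

/-- Since the noise-noise block vanishes, a factor P_A = A (AᴴA)⁻¹ Aᴴ can be inserted on the right.
Then (∂P_A) A is known, and the expression from the statement of the theorem appears. -/
lemma compl_mul_partialProjA (h : IsUnit ((arrayMatrix M ω)ᴴ * arrayMatrix M ω).det)
    (k : Fin K) : (1 - projA M ω) * partialProjA M ω k
      = (1 - projA M ω) * (partialA M ω k
        * (((arrayMatrix M ω)ᴴ * arrayMatrix M ω)⁻¹ * (arrayMatrix M ω)ᴴ)) := by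
  have h1 : (1 - projA M ω) * partialProjA M ω k
      = (1 - projA M ω) * partialProjA M ω k * projA M ω := by
    have := compl_mul_partialProjA_mul_compl h k
    rwa [Matrix.mul_sub, Matrix.mul_one, sub_eq_zero] at this
  have h2 : partialProjA M ω k * projA M ω = (1 - projA M ω) * (partialA M ω k
        * (((arrayMatrix M ω)ᴴ * arrayMatrix M ω)⁻¹ * (arrayMatrix M ω)ᴴ)) := by
    rw [projA, Matrix.mul_assoc (arrayMatrix M ω), ← Matrix.mul_assoc (partialProjA M ω k),
      partialProjA_mul_arrayMatrix h, Matrix.mul_assoc, projA, Matrix.mul_assoc (arrayMatrix M ω)]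
  have h3 : (1 - projA M ω) * (1 - projA M ω) = 1 - projA M ω := by
    rw [Matrix.mul_sub, Matrix.sub_mul, Matrix.sub_mul, projA_mul_self h]; simp
  rw [h1, Matrix.mul_assoc, h2, ← Matrix.mul_assoc, h3]

lemma dProj_apply (h : IsUnit ((arrayMatrix M ω)ᴴ * arrayMatrix M ω).det) (Δω : Fin K → ℝ)
    (i j : Fin M) : dProj M ω (fun k => (Δω k : ℂ)) i j
      = fderiv ℝ (fun w => projA M w i j) ω Δω := by
  conv_rhs => rw [← Finset.univ_sum_single Δω, map_sum]
  rw [dProj, Matrix.sum_apply]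
  refine Finset.sum_congr rfl fun k _ => ?_
  rw [Matrix.smul_apply, partialProjA_apply h, smul_eq_mul, ← Complex.real_smul,
    ← map_smul, ← Pi.single_smul, smul_eq_mul, mul_one]

lemma isBigO_projA_sub (h : IsUnit ((arrayMatrix M ω)ᴴ * arrayMatrix M ω).det) (i j : Fin M) :
    (fun Δω : Fin K → ℝ => projA M (ω + Δω) i j - projA M ω i j
      - dProj M ω (fun k => (Δω k : ℂ)) i j) =O[𝓝 0] fun Δω => ‖Δω‖ ^ 2 := by
  obtain ⟨p, hp⟩ := analyticAt_projA h i j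
  refine (hp.isBigO_sub_partialSum_pow 2).congr_left fun Δω => ?_
  rw [dProj_apply h, hp.fderiv_eq, FormalMultilinearSeries.partialSum, Finset.sum_range_succ,
    Finset.sum_range_one, hp.coeff_zero, sub_sub]
  congr 2

lemma dProj_isHermitian (h : IsUnit ((arrayMatrix M ω)ᴴ * arrayMatrix M ω).det) {Δω : Fin K → ℂ}
    (hΔω : ∀ k, star (Δω k) = Δω k) : (dProj M ω Δω).IsHermitian := by
  rw [IsHermitian, dProj, conjTranspose_sum]
  refine Finset.sum_congr rfl fun k _ => ?_
  rw [conjTranspose_smul, (partialProjA_isHermitian h k).eq, hΔω]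

lemma compl_mul_dProj_mul_compl (h : IsUnit ((arrayMatrix M ω)ᴴ * arrayMatrix M ω).det)
    (Δω : Fin K → ℂ) : (1 - projA M ω) * dProj M ω Δω * (1 - projA M ω) = 0 := by
  rw [dProj, Finset.mul_sum, Finset.sum_mul]
  refine Finset.sum_eq_zero fun k _ => ?_
  rw [Matrix.mul_smul, Matrix.smul_mul, compl_mul_partialProjA_mul_compl h, smul_zero]

end Derivatives

/-! ### The algebraic formula for the second-step leakage. -/

section SecondStep

variable {M K : ℕ} {V P W : Matrix (Fin M) (Fin M) ℂ}

/-- The leading order leakage of the second step. -/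
lemma rho2_eq_rho2Formula (h : IsPinvSystem V P W) {s : ℝ} {R Δ D Q : Matrix (Fin M) (Fin M) ℂ}
    (hRV : R = V + (s : ℂ) • 1) (hΔ : Δ.IsHermitian) (hD : D.IsHermitian) (hQ : Q = 1 - P)
    (hQDQ : Q * D * Q = 0) (γ : ℝ) : rho2 K γ R Q W Δ D = rho2Formula K γ Q W Δ D := by
  have hQP : Q * P = 0 := by rw [hQ, Matrix.sub_mul, h.PP, Matrix.one_mul, sub_self]
  have hPQ : P * Q = 0 := by rw [hQ, Matrix.mul_sub, h.PP, Matrix.mul_one, sub_self]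
  have hQQ : Q * Q = Q := by
    nth_rewrite 2 [hQ]; rw [Matrix.mul_sub, hQP, Matrix.mul_one, sub_zero]
  have hWQ : W * Q = 0 := by rw [hQ, Matrix.mul_sub, h.WP, Matrix.mul_one, sub_self]
  have hQW : Q * W = 0 := by rw [hQ, Matrix.sub_mul, h.PW, Matrix.one_mul, sub_self]
  have hVQ : V * Q = 0 := by rw [hQ, Matrix.mul_sub, h.VP, Matrix.mul_one, sub_self]
  have hQH : Qᴴ = Q := by rw [hQ, conjTranspose_sub, h.herm_P.eq, conjTranspose_one]
  have hRH : R.IsHermitian := by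
    rw [hRV]; refine h.herm_V.add ?_
    rw [IsHermitian, conjTranspose_smul]; simp
  have hP1 : 1 - Q = P := by rw [hQ]; abel
  set T := crossTermFirstOrder R Q Δ D with hT
  have hT' : T = -(P * R * D) + P * Δ * Q + D * R * Q := by rw [hT, crossTermFirstOrder, hP1]
  -- The noise-level terms cancel: W R = P + s W contributes −s W D Q, while R Q = s Q contributes +
  -- s W D Q.
  have hWTQ : W * T * Q = W * Δ * Q - P * D * Q := by
    rw [hT']
    simp only [Matrix.mul_add, Matrix.add_mul, Matrix.mul_neg, Matrix.neg_mul, ← Matrix.mul_assoc,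
      h.WP]
    rw [Matrix.mul_assoc _ Q Q, hQQ, Matrix.mul_assoc _ Q Q, hQQ]
    have h1 : W * R = P + (s : ℂ) • W := by rw [hRV, Matrix.mul_add, h.WV]; simp
    have h2 : W * D * R * Q = (s : ℂ) • (W * D * Q) := by
      rw [Matrix.mul_assoc (W * D), hRV, Matrix.add_mul, hVQ]; simp
    rw [h1, h2, Matrix.add_mul, Matrix.add_mul, Matrix.smul_mul, Matrix.smul_mul]
    abel
  -- Each term of Tᴴ either starts with Q, killed by W on the left, or ends with P, killed by Q on
  -- the right.
  have hWTHQ : W * Tᴴ * Q = 0 := by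
    rw [hT']
    simp only [conjTranspose_add, conjTranspose_neg, conjTranspose_mul, hQH, hRH.eq, hΔ.eq, hD.eq,
      h.herm_P.eq, Matrix.mul_add, Matrix.mul_neg, Matrix.neg_mul,
      ← Matrix.mul_assoc, hWQ, Matrix.zero_mul, add_zero]
    rw [Matrix.mul_assoc _ P Q, hPQ, Matrix.mul_zero, neg_zero]
  set Z := Δ - (γ : ℂ) • (T + Tᴴ) with hZ
  have hZH : Zᴴ = Z := by
    rw [hZ, conjTranspose_sub, conjTranspose_smul, conjTranspose_add, conjTranspose_conjTranspose,
      hΔ.eq, add_comm Tᴴ]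
    simp
  have hWZQ : W * Z * Q = (1 - γ : ℂ) • (W * Δ * Q) + (γ : ℂ) • (P * D * Q) := by
    rw [hZ, Matrix.mul_sub, Matrix.sub_mul, Matrix.mul_smul, Matrix.smul_mul, Matrix.mul_add,
      Matrix.add_mul, hWTQ, hWTHQ, add_zero, smul_sub, sub_smul, one_smul]
    abel
  have hQZW : Q * Z * W = (1 - γ : ℂ) • (Q * Δ * W) + (γ : ℂ) • (Q * D * P) := by
    have := congrArg conjTranspose hWZQ
    simp only [conjTranspose_add, conjTranspose_smul, conjTranspose_mul, hQH, hZH, hΔ.eq, hD.eq,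
      h.herm_P.eq, h.herm_W.eq, ← Matrix.mul_assoc] at this
    rw [this]
    simp
  have htr : (W * Z * Q * Z * W).trace = ((W * Z * Q) * (Q * Z * W)).trace := by
    congr 1
    calc W * Z * Q * Z * W = W * Z * (Q * Q) * Z * W := by rw [hQQ]
      _ = _ := by simp only [Matrix.mul_assoc]
  have h1 : ((W * Δ * Q) * (Q * Δ * W)).trace = (W * Δ * Q * Δ * W).trace := by
    congr 1
    calc _ = W * Δ * (Q * Q) * Δ * W := by simp only [Matrix.mul_assoc]
      _ = _ := by rw [hQQ]
  have h2 : ((W * Δ * Q) * (Q * D * P)).trace = (W * Δ * Q * D).trace := by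
    calc _ = ((W * Δ * (Q * Q) * D) * P).trace := by simp only [Matrix.mul_assoc]
      _ = ((P * W) * Δ * Q * D).trace := by
        rw [hQQ, trace_mul_comm]; simp only [Matrix.mul_assoc]
      _ = _ := by rw [h.PW]
  have h3 : ((P * D * Q) * (Q * Δ * W)).trace = star (W * Δ * Q * D).trace := by
    rw [← h2, ← trace_conjTranspose]
    simp only [conjTranspose_mul, hQH, hΔ.eq, hD.eq, h.herm_P.eq, h.herm_W.eq, Matrix.mul_assoc]
  -- The outer P may be dropped because Q D Q = 0, so D Q D has no noise-noise block.
  have h4 : ((P * D * Q) * (Q * D * P)).trace = (D * Q * D).trace := by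
    calc _ = (P * (D * (Q * Q) * D * P)).trace := by simp only [Matrix.mul_assoc]
      _ = (D * Q * D * (P * P)).trace := by
        rw [hQQ, trace_mul_comm]; simp only [Matrix.mul_assoc]
      _ = (D * Q * D * P).trace := by rw [h.PP]
      _ = (D * Q * D * P).trace + (D * (Q * D * Q)).trace := by rw [hQDQ]; simp
      _ = (D * Q * D * (P + Q)).trace := by
        rw [Matrix.mul_add, trace_add]; simp only [Matrix.mul_assoc]
      _ = _ := by rw [hQ]; simp
  rw [rho2, rho2Formula, rho1, rho1, ← hT, ← hZ, htr, hWZQ, hQZW]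
  simp only [Matrix.add_mul, Matrix.mul_add, Matrix.smul_mul, Matrix.mul_smul, trace_add,
    trace_smul, smul_eq_mul, h1, h2, h3, h4]
  have h5 := Complex.add_conj (W * Δ * Q * D).trace
  rw [Complex.star_def]
  have h6 : (starRingEnd ℂ) (W * Δ * Q * D).trace
      = (((2 * (W * Δ * Q * D).trace.re : ℝ)) : ℂ) - (W * Δ * Q * D).trace := by
    rw [← h5]; ring
  rw [h6]
  push_cast
  ring

end SecondStep

/-! ### The null spectrum as an entire function of the electrical angle. -/

section NullSpectrum

open Asymptotics

variable {M : ℕ}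

/-- The `r`-th derivative of the null spectrum `aᴴ Q a` at the complex electrical angle `τ`. -/
noncomputable def nullSpectrum (r : ℕ) (Q : Matrix (Fin M) (Fin M) ℂ) (τ : ℂ) : ℂ :=
  ∑ m, ∑ l, Q m l * (Complex.I * ((m : ℕ) - (l : ℕ))) ^ r
    * Complex.exp (Complex.I * ((m : ℕ) - (l : ℕ)) * τ)

lemma hasDerivAt_nullSpectrum (r : ℕ) (Q : Matrix (Fin M) (Fin M) ℂ) (τ : ℂ) :
    HasDerivAt (nullSpectrum r Q) (nullSpectrum (r + 1) Q τ) τ := by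
  unfold nullSpectrum
  refine HasDerivAt.fun_sum fun m _ => HasDerivAt.fun_sum fun l _ => ?_
  have h1 : HasDerivAt (fun τ : ℂ => Complex.I * ((m : ℕ) - (l : ℕ)) * τ)
      (Complex.I * ((m : ℕ) - (l : ℕ))) τ := by
    simpa using (hasDerivAt_id τ).const_mul (Complex.I * ((m : ℕ) - (l : ℕ) : ℂ))
  refine (h1.cexp.const_mul (Q m l * (Complex.I * ((m : ℕ) - (l : ℕ))) ^ r)).congr_deriv ?_
  rw [pow_succ]; ring

lemma differentiable_nullSpectrum (r : ℕ) (Q : Matrix (Fin M) (Fin M) ℂ) :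
    Differentiable ℂ (nullSpectrum r Q) :=
  fun τ => (hasDerivAt_nullSpectrum r Q τ).differentiableAt

lemma Continuous.nullSpectrum {X : Type*} [TopologicalSpace X]
    {f : X → Matrix (Fin M) (Fin M) ℂ} {g : X → ℂ} (hf : Continuous f) (hg : Continuous g)
    (r : ℕ) : Continuous fun p => nullSpectrum r (f p) (g p) := by
  simp only [_root_.nullSpectrum]
  refine continuous_finsetSum _ fun m _ => continuous_finsetSum _ fun l _ => ?_
  exact ((hf.matrix_elem m l).mul continuous_const).mul
    (Complex.continuous_exp.comp (continuous_const.mul hg))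

lemma nullSpectrum_sub (r : ℕ) (Q Q' : Matrix (Fin M) (Fin M) ℂ) (τ : ℂ) :
    nullSpectrum r (Q - Q') τ = nullSpectrum r Q τ - nullSpectrum r Q' τ := by
  simp only [nullSpectrum, ← Finset.sum_sub_distrib, Matrix.sub_apply, sub_mul]

/-- Schwarz reflection: zeros come in conjugate pairs, and all derivatives are real on the real
axis. -/
lemma nullSpectrum_conj {Q : Matrix (Fin M) (Fin M) ℂ} (hQ : Q.IsHermitian) (r : ℕ) (τ : ℂ) :
    nullSpectrum r Q (star τ) = star (nullSpectrum r Q τ) := by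
  unfold nullSpectrum
  rw [star_sum, Finset.sum_comm]
  refine Finset.sum_congr rfl fun m _ => ?_
  rw [star_sum]
  refine Finset.sum_congr rfl fun l _ => ?_
  have h0 : ∀ z : ℂ, star (Complex.exp z) = Complex.exp (star z) := fun z =>
    (Complex.exp_conj z).symm
  rw [star_mul', star_mul', star_pow, h0, hQ.apply l m]
  have h1 : star (Complex.I * ((m : ℕ) - (l : ℕ) : ℂ)) = Complex.I * ((l : ℕ) - (m : ℕ) : ℂ) := by
    simp only [star_mul', star_sub, star_natCast, Complex.star_def, Complex.conj_I]; ring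
  rw [h1, star_mul', h1]

lemma nullSpectrum_ofReal_im {Q : Matrix (Fin M) (Fin M) ℂ} (hQ : Q.IsHermitian) (r : ℕ) (x : ℝ) :
    (nullSpectrum r Q x).im = 0 := by
  have := nullSpectrum_conj hQ r x
  rw [Complex.star_def, Complex.conj_ofReal] at this
  exact Complex.conj_eq_iff_im.1 this.symm

lemma star_steering_mul_steering (x : ℝ) (m l : Fin M) :
    star (steering M x m) * steering M x l
      = Complex.exp (Complex.I * ((m : ℕ) - (l : ℕ)) * x) := by
  rw [steering, steering, Complex.star_def, ← Complex.exp_conj, ← Complex.exp_add]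
  congr 1
  simp only [map_neg, map_mul, Complex.conj_I, map_natCast, Complex.conj_ofReal]
  ring

lemma nullSpectrum_zero_ofReal (Q : Matrix (Fin M) (Fin M) ℂ) (x : ℝ) :
    nullSpectrum 0 Q x = star (steering M x) ⬝ᵥ (Q *ᵥ steering M x) := by
  simp only [nullSpectrum, dotProduct, mulVec, Finset.mul_sum, ← star_steering_mul_steering,
    pow_zero, Pi.star_apply]
  exact Finset.sum_congr rfl fun m _ => Finset.sum_congr rfl fun l _ => by ring

lemma nullSpectrum_one_ofReal (Q : Matrix (Fin M) (Fin M) ℂ) (x : ℝ) :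
    nullSpectrum 1 Q x = -Complex.I * (star (steeringOne M x) ⬝ᵥ (Q *ᵥ steering M x)
      - star (steering M x) ⬝ᵥ (Q *ᵥ steeringOne M x)) := by
  have h1 : ∀ m : Fin M, steeringOne M x m = -((m : ℕ) * steering M x m) := fun m => rfl
  simp only [nullSpectrum, dotProduct, mulVec, Finset.mul_sum, ← star_steering_mul_steering,
    pow_one, Pi.star_apply, ← Finset.sum_sub_distrib, h1, star_neg, star_mul', star_natCast]
  exact Finset.sum_congr rfl fun m _ => Finset.sum_congr rfl fun l _ => by ring

lemma nullSpectrum_two_ofReal {Q : Matrix (Fin M) (Fin M) ℂ} (hQ : Q.IsHermitian) {x : ℝ}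
    (hx : Q *ᵥ steering M x = 0) : nullSpectrum 2 Q x
      = 2 * (star (steeringOne M x) ⬝ᵥ (Q *ᵥ steeringOne M x)) := by
  have h1 : ∀ m : Fin M, steeringOne M x m = -((m : ℕ) * steering M x m) := fun m => rfl
  -- In (m − l)² = m² + l² − 2ml the two pure squares pair Q with the steering vector itself and
  -- vanish. Only the mixed term survives.
  let b : Fin M → ℂ := fun m => (m : ℕ) ^ 2 * steering M x m
  have h2 : star b ⬝ᵥ (Q *ᵥ steering M x) = 0 := by rw [hx, dotProduct_zero]
  have h3 : star (steering M x) ⬝ᵥ (Q *ᵥ b) = 0 := by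
    rw [dotProduct_mulVec, ← hQ.eq, ← star_mulVec, hx, star_zero, zero_dotProduct]
  have h4 : nullSpectrum 2 Q x = 2 * (star (steeringOne M x) ⬝ᵥ (Q *ᵥ steeringOne M x))
      - star b ⬝ᵥ (Q *ᵥ steering M x) - star (steering M x) ⬝ᵥ (Q *ᵥ b) := by
    simp only [nullSpectrum, dotProduct, mulVec, Finset.mul_sum, ← star_steering_mul_steering,
      Pi.star_apply, ← Finset.sum_sub_distrib, h1, b, star_neg, star_mul', star_natCast, star_pow]
    refine Finset.sum_congr rfl fun m _ => Finset.sum_congr rfl fun l _ => ?_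
    rw [mul_pow, Complex.I_sq]; ring
  rw [h4, h2, h3, sub_zero, sub_zero]

/-- Orthogonal projection matrices. -/
def IsOrthProj (Q : Matrix (Fin M) (Fin M) ℂ) : Prop := Q.IsHermitian ∧ Q * Q = Q

lemma IsOrthProj.mulVec_steering_eq_zero {Q : Matrix (Fin M) (Fin M) ℂ} (hQ : IsOrthProj Q)
    {x : ℝ} (hx : nullSpectrum 0 Q x = 0) : Q *ᵥ steering M x = 0 := by
  have : star (Q *ᵥ steering M x) ⬝ᵥ (Q *ᵥ steering M x) = 0 := by
    rw [star_mulVec, hQ.1.eq, ← dotProduct_mulVec, mulVec_mulVec, hQ.2,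
      ← nullSpectrum_zero_ofReal, hx]
  exact dotProduct_star_self_eq_zero.1 (this)

/-- Real zeros are at least double, since for a projection the null spectrum is ‖Q a‖² on the real
axis. -/
lemma nullSpectrum_one_eq_zero {Q : Matrix (Fin M) (Fin M) ℂ} (hQ : Q.IsHermitian) {x : ℝ}
    (hx : Q *ᵥ steering M x = 0) : nullSpectrum 1 Q x = 0 := by
  have h3 : star (steering M x) ⬝ᵥ (Q *ᵥ steeringOne M x) = 0 := by
    rw [dotProduct_mulVec, ← hQ.eq, ← star_mulVec, hx, star_zero, zero_dotProduct]
  rw [nullSpectrum_one_ofReal, h3, hx, dotProduct_zero, sub_zero, mul_zero]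

/-- The substitution z = e^{jτ} maps the closed upper half-plane to the punctured closed unit disc.
Real τ lie on the circle, and arg z is Re τ modulo 2π. -/
lemma mem_musicRoots_exp_iff {Q : Matrix (Fin M) (Fin M) ℂ} {τ : ℂ} :
    Complex.exp (Complex.I * τ) ∈ musicRoots Q ↔ 0 ≤ τ.im ∧ nullSpectrum 0 Q τ = 0 := by
  have h1 : steeringZ M (Complex.exp (Complex.I * τ))⁻¹
      ⬝ᵥ (Q *ᵥ steeringZ M (Complex.exp (Complex.I * τ))) = nullSpectrum 0 Q τ := by
    simp only [nullSpectrum, dotProduct, mulVec, Finset.mul_sum, steeringZ, inv_inv, pow_zero,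
      mul_one]
    refine Finset.sum_congr rfl fun m _ => Finset.sum_congr rfl fun l _ => ?_
    rw [← Complex.exp_neg, ← Complex.exp_nat_mul, ← Complex.exp_nat_mul, mul_left_comm,
      ← Complex.exp_add]
    congr 2; ring
  have h2 : ‖Complex.exp (Complex.I * τ)‖ ≤ 1 ↔ 0 ≤ τ.im := by
    rw [Complex.norm_exp]; simp
  rw [musicRoots, Set.mem_ofPred_eq, h1, h2]
  simp

end NullSpectrum

/-! ### Crude Taylor bounds and divided differences for holomorphic functions. -/

section Taylor

variable {f f₁ f₂ f₃ : ℂ → ℂ} {s : Set ℂ}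

lemma norm_taylor_zero_le (hf : ∀ z, HasDerivAt f (f₁ z) z) (hs : Convex ℝ s) {B : ℝ}
    (hB : ∀ z ∈ s, ‖f₁ z‖ ≤ B) {x w : ℂ} (hx : x ∈ s) (hw : w ∈ s) :
    ‖f w - f x‖ ≤ B * ‖w - x‖ :=
  hs.norm_image_sub_le_of_norm_hasDerivWithin_le (fun z _ => (hf z).hasDerivWithinAt) hB hx hw

/-- The mean value bound is applied to f minus its linear part on the segment from x to w. The sharp
factor 1/2 is not needed. -/
lemma norm_taylor_one_le (hf : ∀ z, HasDerivAt f (f₁ z) z) (hf₁ : ∀ z, HasDerivAt f₁ (f₂ z) z)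
    (hs : Convex ℝ s) {B : ℝ} (hB : ∀ z ∈ s, ‖f₂ z‖ ≤ B) {x w : ℂ} (hx : x ∈ s) (hw : w ∈ s) :
    ‖f w - f x - f₁ x * (w - x)‖ ≤ B * ‖w - x‖ ^ 2 := by
  have hB0 : 0 ≤ B := (norm_nonneg _).trans (hB x hx)
  have hseg := hs.segment_subset hx hw
  have hg : ∀ z, HasDerivAt (fun z => f z - f₁ x * (z - x)) (f₁ z - f₁ x) z := fun z => by
    simpa using (hf z).fun_sub (((hasDerivAt_id z).sub_const x).const_mul (f₁ x))
  have h1 : ∀ z ∈ segment ℝ x w, ‖f₁ z - f₁ x‖ ≤ B * ‖w - x‖ := fun z hz =>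
    (norm_taylor_zero_le hf₁ hs hB hx (hseg hz)).trans
      (mul_le_mul_of_nonneg_left (norm_sub_le_of_mem_segment hz) hB0)
  have h2 := norm_taylor_zero_le hg (convex_segment x w) h1 (left_mem_segment ℝ x w)
    (right_mem_segment ℝ x w)
  calc _ = ‖f w - f₁ x * (w - x) - (f x - f₁ x * (x - x))‖ := by congr 1; ring
    _ ≤ _ := h2
    _ = _ := by ring

lemma norm_taylor_two_le (hf : ∀ z, HasDerivAt f (f₁ z) z) (hf₁ : ∀ z, HasDerivAt f₁ (f₂ z) z)
    (hf₂ : ∀ z, HasDerivAt f₂ (f₃ z) z) (hs : Convex ℝ s) {B : ℝ} (hB : ∀ z ∈ s, ‖f₃ z‖ ≤ B)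
    {x w : ℂ} (hx : x ∈ s) (hw : w ∈ s) :
    ‖f w - f x - f₁ x * (w - x) - f₂ x * (w - x) ^ 2 / 2‖ ≤ B * ‖w - x‖ ^ 3 := by
  have hB0 : 0 ≤ B := (norm_nonneg _).trans (hB x hx)
  have hseg := hs.segment_subset hx hw
  have hg : ∀ z, HasDerivAt (fun z => f z - f₁ x * (z - x) - f₂ x * (z - x) ^ 2 / 2)
      (f₁ z - f₁ x - f₂ x * (z - x)) z := fun z => by
    have h1 := (hasDerivAt_id z).sub_const x
    refine (((hf z).fun_sub (h1.const_mul (f₁ x))).fun_sub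
      (((h1.fun_pow 2).const_mul (f₂ x)).div_const 2)).congr_deriv ?_
    simp only [id]; push_cast; ring
  have h1 : ∀ z ∈ segment ℝ x w, ‖f₁ z - f₁ x - f₂ x * (z - x)‖ ≤ B * ‖w - x‖ ^ 2 := fun z hz =>
    (norm_taylor_one_le hf₁ hf₂ hs hB hx (hseg hz)).trans
      (mul_le_mul_of_nonneg_left (pow_le_pow_left₀ (norm_nonneg _)
        (norm_sub_le_of_mem_segment hz) 2) hB0)
  have h2 := norm_taylor_zero_le hg (convex_segment x w) h1 (left_mem_segment ℝ x w)
    (right_mem_segment ℝ x w)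
  calc _ = ‖f w - f₁ x * (w - x) - f₂ x * (w - x) ^ 2 / 2
        - (f x - f₁ x * (x - x) - f₂ x * (x - x) ^ 2 / 2)‖ := by congr 1; ring
    _ ≤ _ := h2
    _ = _ := by ring

/-- Where the second derivative of `f` is nearly constant and nonzero, the difference quotient of
`f` at a fixed point is injective. -/
lemma integral_deriv_injOn (hf₁ : ∀ z, HasDerivAt f₁ (f₂ z) z)
    (hs : Convex ℝ s) {c : ℂ} (hc : c ≠ 0) (hB : ∀ z ∈ s, ‖f₂ z - c‖ ≤ ‖c‖ / 4) {x v w : ℂ}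
    (hx : x ∈ s) (hv : v ∈ s) (hw : w ∈ s)
    (h : ∫ t in (0 : ℝ)..1, f₁ (x + t • (v - x)) = ∫ t in (0 : ℝ)..1, f₁ (x + t • (w - x))) :
    -- With f₁ modelled by the linear function of slope c, the difference of the two integrals would
    -- be c (v − w)/2. The deviation from that model is at most ‖c‖ ‖v − w‖/4, so equality forces v
    -- = w.
    v = w := by
  have hf₁c : Continuous f₁ :=
    continuous_iff_continuousAt.2 fun z => (hf₁ z).continuousAt
  have hi : ∀ v, IntervalIntegrable (fun t : ℝ => f₁ (x + t • (v - x))) volume 0 1 := fun v =>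
    Continuous.intervalIntegrable (by fun_prop) _ _
  have h1 : ∫ t in (0 : ℝ)..1, (f₁ (x + t • (v - x)) - f₁ (x + t • (w - x)) - c * (t • (v - w)))
      = -(c / 2 * (v - w)) := by
    have h2 : ∫ t in (0 : ℝ)..1, c * (t • (v - w)) = c / 2 * (v - w) := by
      rw [intervalIntegral.integral_const_mul, intervalIntegral.integral_smul_const, integral_id]
      simp only [Complex.real_smul]
      push_cast; ring
    rw [intervalIntegral.integral_sub ((hi v).sub (hi w))
      (Continuous.intervalIntegrable (by fun_prop) _ _),
      intervalIntegral.integral_sub (hi v) (hi w),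
      h, h2]
    ring
  have h3 : ‖∫ t in (0 : ℝ)..1,
      (f₁ (x + t • (v - x)) - f₁ (x + t • (w - x)) - c * (t • (v - w)))‖
      ≤ ‖c‖ / 4 * ‖v - w‖ * |1 - 0| := by
    refine intervalIntegral.norm_integral_le_of_norm_le_const fun t ht => ?_
    rw [Set.uIoc_of_le zero_le_one] at ht
    have hmem : ∀ v ∈ s, x + t • (v - x) ∈ s := fun v hv =>
      hs.add_smul_sub_mem hx hv ⟨ht.1.le, ht.2⟩
    have hg : ∀ z, HasDerivAt (fun z => f₁ z - c * z) (f₂ z - c) z := fun z => by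
      simpa using (hf₁ z).fun_sub ((hasDerivAt_id z).const_mul c)
    have h4 := norm_taylor_zero_le hg hs hB (hmem w hw) (hmem v hv)
    have h5 : x + t • (v - x) - (x + t • (w - x)) = t • (v - w) := by
      rw [add_sub_add_left_eq_sub, ← smul_sub]; congr 1; ring
    calc _ = ‖f₁ (x + t • (v - x)) - c * (x + t • (v - x))
          - (f₁ (x + t • (w - x)) - c * (x + t • (w - x)))‖ := by
            rw [← h5]; congr 1; ring
      _ ≤ _ := h4
      _ ≤ _ := by
        rw [h5]
        refine mul_le_mul_of_nonneg_left ?_ (by positivity)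
        rw [norm_smul, Real.norm_eq_abs, abs_of_pos ht.1]
        exact mul_le_of_le_one_left (norm_nonneg _) ht.2
  rw [h1, norm_neg, norm_mul, norm_div] at h3
  have hc0 : 0 < ‖c‖ := norm_pos_iff.2 hc
  simp only [sub_zero, abs_one, mul_one, Complex.norm_ofNat] at h3
  have h6 : ‖c‖ * ‖v - w‖ ≤ 0 := by linarith
  have h7 : ‖v - w‖ ≤ 0 := by
    by_contra! h8
    nlinarith [mul_pos hc0 h8]
  exact sub_eq_zero.1 (norm_le_zero_iff.1 h7)

/-- The integral is the divided difference (f v − f x)/(v − x). A second zero of f is thus a zero of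
the divided difference, which allows zeros to be counted without a factorization. -/
lemma integral_deriv_eq_zero (hf : ∀ z, HasDerivAt f (f₁ z) z) (hf₁ : Continuous f₁) {x v : ℂ}
    (hx : f x = 0) (hv : f v = 0) (hxv : v ≠ x) :
    ∫ t in (0 : ℝ)..1, f₁ (x + t • (v - x)) = 0 := by
  have h := intervalIntegral.integral_unitInterval_deriv_eq_sub (𝕜 := ℂ) (f := f) (f' := f₁)
    (z₀ := x) (z₁ := v - x) (by fun_prop) fun t _ => hf _
  rw [add_sub_cancel, hx, hv, sub_zero, smul_eq_mul] at h
  exact (mul_eq_zero.1 h).resolve_left (sub_ne_zero.2 hxv)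

end Taylor

/-! ### Location of the roots: uniqueness, existence and isolation near the true angles. -/

section RootLocation

open Metric

variable {M K : ℕ} {Q₀ : Matrix (Fin M) (Fin M) ℂ}

/-- The zeros of the null spectrum near a nondegenerate double zero are unique up to conjugation. -/
lemma exists_nullSpectrum_zero_unique {x : ℝ}
    (hx2 : nullSpectrum 2 Q₀ x ≠ 0) :
    ∃ r > 0, ∀ᶠ Q in 𝓝 Q₀, IsOrthProj Q → ∀ τ₁ ∈ ball (x : ℂ) r, ∀ τ₂ ∈ ball (x : ℂ) r,
      0 ≤ τ₁.im → 0 ≤ τ₂.im → nullSpectrum 0 Q τ₁ = 0 → nullSpectrum 0 Q τ₂ = 0 → τ₁ = τ₂ := by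
  set c := nullSpectrum 2 Q₀ x with hc
  have h1 : ∀ᶠ p : Matrix (Fin M) (Fin M) ℂ × ℂ in 𝓝 (Q₀, (x : ℂ)),
      ‖nullSpectrum 2 p.1 p.2 - c‖ < ‖c‖ / 4 := by
    have hcont : Continuous fun p : Matrix (Fin M) (Fin M) ℂ × ℂ =>
        ‖nullSpectrum 2 p.1 p.2 - c‖ :=
      ((continuous_fst.nullSpectrum continuous_snd 2).sub continuous_const).norm
    refine hcont.continuousAt.eventually_lt continuousAt_const ?_
    simp only [← hc, sub_self, norm_zero]
    have := norm_pos_iff.2 hx2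
    positivity
  rw [nhds_prod_eq, eventually_prod_iff] at h1
  obtain ⟨pa, hpa, pb, hpb, hab⟩ := h1
  obtain ⟨r, hr, hrb⟩ := Metric.eventually_nhds_iff_ball.1 hpb
  refine ⟨r, hr, hpa.mono fun Q hQa hQ τ₁ h₁ τ₂ h₂ hi₁ hi₂ hz₁ hz₂ => ?_⟩
  have hB : ∀ z ∈ ball (x : ℂ) r, ‖nullSpectrum 2 Q z - c‖ ≤ ‖c‖ / 4 := fun z hz =>
    (hab hQa (hrb z hz)).le
  have hconv : Convex ℝ (ball (x : ℂ) r) := convex_ball _ _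
  have hcont : Continuous (nullSpectrum 1 Q) := (differentiable_nullSpectrum 1 Q).continuous
  by_contra hne
  have hI2 := integral_deriv_eq_zero (hasDerivAt_nullSpectrum 0 Q) hcont hz₁ hz₂ (Ne.symm hne)
  -- A real zero τ₁ is double, so the divided difference at τ₁ vanishes at τ₁ itself as well as at
  -- τ₂. If τ₁ is not real, it vanishes at conj τ₁ and τ₂, so injectivity would put τ₂ in the open
  -- lower half-plane.
  rcases hi₁.eq_or_lt with h0 | h0
  · have hreal : τ₁ = (τ₁.re : ℂ) := by
      apply Complex.ext <;> simp [← h0]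
    have hd : nullSpectrum 1 Q τ₁ = 0 := by
      rw [hreal] at hz₁ ⊢
      exact nullSpectrum_one_eq_zero hQ.1 (hQ.mulVec_steering_eq_zero hz₁)
    refine hne (integral_deriv_injOn (hasDerivAt_nullSpectrum 1 Q) hconv hx2 hB h₁ h₁ h₂ ?_)
    rw [hI2]
    simp [hd]
  · have hz₃ : nullSpectrum 0 Q (star τ₁) = 0 := by rw [nullSpectrum_conj hQ.1, hz₁, star_zero]
    have h₃ : star τ₁ ∈ ball (x : ℂ) r := by
      rw [mem_ball, dist_eq_norm] at h₁ ⊢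
      rw [← norm_star, star_sub, star_star]
      simpa using h₁
    have hne3 : star τ₁ ≠ τ₁ := fun h => by
      have := congrArg Complex.im h
      rw [Complex.star_def, Complex.conj_im] at this
      linarith
    have hI3 := integral_deriv_eq_zero (hasDerivAt_nullSpectrum 0 Q) hcont hz₁ hz₃ hne3
    have := integral_deriv_injOn (hasDerivAt_nullSpectrum 1 Q) hconv hx2 hB h₁ h₂ h₃
      (hI2.trans hI3.symm)
    rw [this, Complex.star_def, Complex.conj_im] at hi₂
    linarith

/-- Near an isolated zero of the null spectrum, perturbed null spectra have zeros. -/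
lemma eventually_exists_nullSpectrum_zero (hQ₀ : IsOrthProj Q₀) {x : ℝ}
    (hx : nullSpectrum 0 Q₀ x = 0) {ρ : ℝ} (hρ : 0 < ρ)
    (huniq : ∀ τ ∈ closedBall (x : ℂ) ρ, 0 ≤ τ.im → nullSpectrum 0 Q₀ τ = 0 → τ = x) :
    ∀ᶠ Q in 𝓝 Q₀, IsOrthProj Q →
      ∃ τ ∈ closedBall (x : ℂ) ρ, 0 ≤ τ.im ∧ nullSpectrum 0 Q τ = 0 := by
  have hconjmem : ∀ τ ∈ closedBall (x : ℂ) ρ, star τ ∈ closedBall (x : ℂ) ρ := by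
    intro τ hτ
    rw [mem_closedBall, dist_eq_norm] at hτ ⊢
    rw [← norm_star, star_sub, star_star]
    simpa using hτ
  have hS0 : ∀ τ ∈ sphere (x : ℂ) ρ, nullSpectrum 0 Q₀ τ ≠ 0 := by
    intro τ hτ h0
    have hτ' := sphere_subset_closedBall hτ
    have hne : τ ≠ x := fun h => by
      rw [h, mem_sphere, dist_self] at hτ
      exact hρ.ne hτ
    rcases le_total 0 τ.im with hi | hi
    · exact hne (huniq τ hτ' hi h0)
    · have := huniq (star τ) (hconjmem τ hτ') (by rw [Complex.star_def, Complex.conj_im]; linarith)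
        (by rw [nullSpectrum_conj hQ₀.1, h0, star_zero])
      apply hne
      rw [← star_star τ, this, Complex.star_def, Complex.conj_ofReal]
  have hcpt : IsCompact (sphere (x : ℂ) ρ) := isCompact_sphere _ _
  have hne : (sphere (x : ℂ) ρ).Nonempty := NormedSpace.sphere_nonempty.2 hρ.le
  obtain ⟨τ₀, hτ₀, hmin⟩ := hcpt.exists_isMinOn hne
    (differentiable_nullSpectrum 0 Q₀).continuous.norm.continuousOn
  set c := ‖nullSpectrum 0 Q₀ τ₀‖ with hcdef
  have hc : 0 < c := norm_pos_iff.2 (hS0 τ₀ hτ₀)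
  have hcont : Continuous fun p : Matrix (Fin M) (Fin M) ℂ × ℂ =>
      ‖nullSpectrum 0 p.1 p.2 - nullSpectrum 0 p.1 x‖ :=
    ((continuous_fst.nullSpectrum continuous_snd 0).sub
      (continuous_fst.nullSpectrum continuous_const 0)).norm
  -- The modulus of f_{Q₀} is at least c on the sphere. For nearby Q the deviation from the centre
  -- value stays above c/2, and the centre value itself stays below c/4. The open mapping bound with
  -- radius (c/2)/2 then reaches 0.
  have hE1 : ∀ᶠ Q in 𝓝 Q₀, ∀ z ∈ sphere (x : ℂ) ρ,
      c / 2 < ‖nullSpectrum 0 Q z - nullSpectrum 0 Q x‖ := by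
    refine hcpt.eventually_forall_of_forall_eventually fun z hz => ?_
    refine Filter.Tendsto.eventually_const_lt ?_ (hcont.tendsto (Q₀, z))
    simp only [hx, sub_zero]
    exact lt_of_lt_of_le (by linarith) (hmin hz)
  have hE2 : ∀ᶠ Q in 𝓝 Q₀, ‖nullSpectrum 0 Q x‖ < c / 4 := by
    have h : Continuous fun Q : Matrix (Fin M) (Fin M) ℂ => ‖nullSpectrum 0 Q x‖ :=
      (continuous_id.nullSpectrum continuous_const 0).norm
    refine Filter.Tendsto.eventually_lt_const ?_ (h.tendsto Q₀)
    simp only [hx, norm_zero]; positivity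
  filter_upwards [hE1, hE2] with Q hQ1 hQ2 hQ
  have hdiff := differentiable_nullSpectrum 0 Q
  have hfreq : ∃ᶠ z in 𝓝 (x : ℂ), nullSpectrum 0 Q z ≠ nullSpectrum 0 Q x := by
    intro hev
    simp only [not_not] at hev
    have hana : AnalyticOnNhd ℂ (nullSpectrum 0 Q) Set.univ := fun z _ => hdiff.analyticAt z
    have heq := hana.eq_of_eventuallyEq (g := fun _ => nullSpectrum 0 Q x)
      (fun z _ => analyticAt_const) hev
    have := hQ1 τ₀ hτ₀
    rw [congrFun heq τ₀] at this
    simp only [sub_self, norm_zero] at this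
    linarith
  have himg := hdiff.diffContOnCl.ball_subset_image_closedBall hρ
    (fun z hz => (hQ1 z hz).le) hfreq
  obtain ⟨τ, hτ, hτ0⟩ := himg (show (0 : ℂ) ∈ ball (nullSpectrum 0 Q x) (c / 2 / 2) by
    rw [mem_ball, dist_eq_norm, zero_sub, norm_neg]; linarith)
  -- A zero in the lower half-plane is reflected to the upper one.
  rcases le_total 0 τ.im with hi | hi
  · exact ⟨τ, hτ, hi, hτ0⟩
  · exact ⟨star τ, hconjmem τ hτ, by rw [Complex.star_def, Complex.conj_im]; linarith,
      by rw [nullSpectrum_conj hQ.1, hτ0, star_zero]⟩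

/-- Perturbed null spectra have no zeros close to the real axis away from the real zeros. -/
lemma exists_nullSpectrum_zero_isolated {x : Fin K → ℝ}
    (hx : ∀ y ∈ Set.Icc (-Real.pi) Real.pi, nullSpectrum 0 Q₀ (y : ℂ) = 0 → ∃ k, y = x k)
    {r : ℝ} (hr : 0 < r) :
    ∃ η > 0, ∀ᶠ Q in 𝓝 Q₀, ∀ τ : ℂ, τ.re ∈ Set.Icc (-Real.pi) Real.pi → 0 ≤ τ.im → τ.im ≤ η →
      nullSpectrum 0 Q τ = 0 → ∃ k, τ ∈ ball (x k : ℂ) r := by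
  -- X is compact and free of zeros of f_{Q₀}, so a strip above X of uniform height stays free of
  -- zeros for all nearby Q.
  set X : Set ℝ := Set.Icc (-Real.pi) Real.pi ∩ ⋂ k, {y | r / 2 ≤ |y - x k|} with hX
  have hcl : ∀ k, IsClosed {y | r / 2 ≤ |y - x k|} := fun k =>
    isClosed_le continuous_const (continuous_abs.comp (continuous_id.sub continuous_const))
  have hcpt : IsCompact X := isCompact_Icc.inter_right (isClosed_iInter hcl)
  have hcont : Continuous fun p : (Matrix (Fin M) (Fin M) ℂ × ℝ) × ℝ =>
      nullSpectrum 0 p.1.1 (p.2 + p.1.2 * Complex.I) :=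
    continuous_fst.fst.nullSpectrum (by fun_prop) 0
  have hE : ∀ᶠ p : Matrix (Fin M) (Fin M) ℂ × ℝ in 𝓝 (Q₀, (0 : ℝ)), ∀ y ∈ X,
      nullSpectrum 0 p.1 (y + p.2 * Complex.I) ≠ 0 := by
    refine hcpt.eventually_forall_of_forall_eventually fun y hy => ?_
    have hne : nullSpectrum 0 Q₀ ((y : ℂ) + ((0 : ℝ) : ℂ) * Complex.I) ≠ 0 := by
      rw [Complex.ofReal_zero, zero_mul, add_zero]
      intro h0
      obtain ⟨k, rfl⟩ := hx y hy.1 h0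
      have := Set.mem_iInter.1 hy.2 k
      simp only [Set.mem_ofPred_eq, sub_self, abs_zero] at this
      linarith
    have hc := hcont.continuousAt (x := ((Q₀, (0 : ℝ)), y))
    exact hc.eventually_ne hne
  rw [nhds_prod_eq, eventually_prod_iff] at hE
  obtain ⟨pa, hpa, pb, hpb, hab⟩ := hE
  obtain ⟨η, hη, hηb⟩ := Metric.eventually_nhds_iff_ball.1 hpb
  refine ⟨min (η / 2) (r / 4), by positivity, hpa.mono fun Q hQ τ hre h0 hi hz => ?_⟩
  have hτ : τ = τ.re + τ.im * Complex.I := (Complex.re_add_im τ).symm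
  have him : τ.im ∈ ball (0 : ℝ) η := by
    rw [mem_ball, Real.dist_eq, sub_zero, abs_of_nonneg h0]
    have := hi.trans (min_le_left _ _)
    linarith
  have hnot : τ.re ∉ X := fun hmem => by
    have := hab hQ (hηb _ him) τ.re hmem
    rw [← hτ] at this
    exact this hz
  have : ∃ k, |τ.re - x k| < r / 2 := by
    by_contra! hall
    exact hnot ⟨hre, Set.mem_iInter.2 hall⟩
  obtain ⟨k, hk⟩ := this
  refine ⟨k, ?_⟩
  rw [mem_ball, dist_eq_norm]
  have h1 := Complex.norm_le_abs_re_add_abs_im (τ - x k)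
  simp only [Complex.sub_re, Complex.ofReal_re, Complex.sub_im, Complex.ofReal_im, sub_zero,
    abs_of_nonneg h0] at h1
  have := hi.trans (min_le_right _ _)
  linarith

/-- The roots `z` are the `K` roots inside the unit circle that are closest to it. -/
def IsClosestRoots (Q : Matrix (Fin M) (Fin M) ℂ) (z : Fin K → ℂ) : Prop :=
  Function.Injective z ∧ (∀ k, z k ∈ musicRoots Q) ∧
    ∀ w ∈ musicRoots Q, w ∉ Set.range z → ∀ k, 1 - ‖z k‖ ≤ 1 - ‖w‖

lemma exp_arg_sub_log {w : ℂ} (hw : w ≠ 0) :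
    Complex.exp (Complex.I * (Complex.arg w - Real.log ‖w‖ * Complex.I)) = w := by
  have : Complex.I * (Complex.arg w - Real.log ‖w‖ * Complex.I) = Complex.log w := by
    apply Complex.ext <;> simp [Complex.log_re, Complex.log_im]
  rw [this, Complex.exp_log hw]

/-- For projections near `Q₀` the closest roots lie near the roots of `Q₀` on the circle. -/
lemma eventually_closestRoots (hQ₀ : IsOrthProj Q₀) {x : Fin K → ℝ} (hxmono : StrictMono x)
    (hxmem : ∀ k, x k ∈ Set.Ioo (-Real.pi) Real.pi) (hx0 : ∀ k, nullSpectrum 0 Q₀ (x k) = 0)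
    (hx2 : ∀ k, nullSpectrum 2 Q₀ (x k) ≠ 0)
    (hx : ∀ y ∈ Set.Icc (-Real.pi) Real.pi, nullSpectrum 0 Q₀ (y : ℂ) = 0 → ∃ k, y = x k)
    {ρ : ℝ} (hρ : 0 < ρ) :
    ∀ᶠ Q in 𝓝 Q₀, IsOrthProj Q → ∃ T : Fin K → ℂ,
      (∀ k, T k ∈ ball (x k : ℂ) ρ ∧ nullSpectrum 0 Q (T k) = 0) ∧
      (StrictMono fun k => (T k).re) ∧
      (∀ k, Complex.arg (Complex.exp (Complex.I * T k)) = (T k).re) ∧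
      IsClosestRoots Q (fun k => Complex.exp (Complex.I * T k)) ∧
      ∀ z : Fin K → ℂ, IsClosestRoots Q z → (Monotone fun k => Complex.arg (z k)) →
        z = fun k => Complex.exp (Complex.I * T k) := by
  have hsmall : ∃ r > 0, r ≤ ρ ∧ (∀ k, x k + r < Real.pi) ∧ (∀ k, -Real.pi < x k - r) ∧
      (∀ i j, i < j → x i + r < x j - r) := by
    have h1 : ∀ᶠ r in 𝓝[>] (0 : ℝ), r ≤ ρ ∧ (∀ k, x k + r < Real.pi) ∧
        (∀ k, -Real.pi < x k - r) ∧ (∀ i j, i < j → x i + r < x j - r) := by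
      refine Filter.Eventually.filter_mono nhdsWithin_le_nhds ?_
      have hlt : ∀ {a b : ℝ → ℝ}, Continuous a → Continuous b → a 0 < b 0 →
          ∀ᶠ r in 𝓝 (0 : ℝ), a r < b r := fun ha hb h =>
        ha.continuousAt.eventually_lt hb.continuousAt h
      refine ((hlt continuous_id continuous_const hρ).mono fun r h => le_of_lt h).and
        ((eventually_all.2 fun k => hlt (by fun_prop) (by fun_prop) ?_).and
        ((eventually_all.2 fun k => hlt (by fun_prop) (by fun_prop) ?_).and
        (eventually_all.2 fun i => eventually_all.2 fun j => ?_)))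
      · simpa using (hxmem k).2
      · simpa using (hxmem k).1
      · by_cases hij : i < j
        · simp only [hij, forall_const]
          exact hlt (by fun_prop) (by fun_prop) (by simpa using hxmono hij)
        · simp [hij]
    obtain ⟨r, hr1, hr2⟩ := (h1.and self_mem_nhdsWithin).exists
    exact ⟨r, hr2, hr1⟩
  obtain ⟨r₁, hr₁, hr₁ρ, hup, hlow, hgap⟩ := hsmall
  choose r₀ hr₀ hU using fun k => exists_nullSpectrum_zero_unique (hx2 k)
  obtain ⟨r, hr, hrr₁, hrr₀⟩ : ∃ r > 0, r ≤ r₁ ∧ ∀ k, r ≤ r₀ k := by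
    rcases isEmpty_or_nonempty (Fin K) with hemp | hne
    · exact ⟨r₁, hr₁, le_rfl, fun k => hemp.elim k⟩
    · obtain ⟨k₀, hk₀⟩ := Finite.exists_min r₀
      exact ⟨min r₁ (r₀ k₀), lt_min hr₁ (hr₀ k₀), min_le_left _ _,
        fun k => (min_le_right _ _).trans (hk₀ k)⟩
  obtain ⟨η, hη, hiso⟩ := exists_nullSpectrum_zero_isolated hx hr
  -- Less than r, so that uniqueness applies. Less than η, so that the roots found have modulus
  -- above e^{-η}, while all other roots will have modulus below it.
  set ρ' := min r η / 2 with hρ'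
  have hρ'0 : 0 < ρ' := by positivity
  have hρ'r : ρ' < r := by have := min_le_left r η; have := lt_min hr hη; rw [hρ']; linarith
  have hρ'η : ρ' < η := by have := min_le_right r η; have := lt_min hr hη; rw [hρ']; linarith
  have hex : ∀ k, ∀ᶠ Q in 𝓝 Q₀, IsOrthProj Q →
      ∃ τ ∈ closedBall (x k : ℂ) ρ', 0 ≤ τ.im ∧ nullSpectrum 0 Q τ = 0 := fun k =>
    eventually_exists_nullSpectrum_zero hQ₀ (hx0 k) hρ'0 fun τ hτ hi h0 =>
      (hU k).self_of_nhds hQ₀ τ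
        (closedBall_subset_ball (lt_of_lt_of_le hρ'r (hrr₀ k)) hτ) _ (mem_ball_self (hr₀ k)) hi
        (by simp) h0 (hx0 k)
  filter_upwards [eventually_all.2 hex, eventually_all.2 hU, hiso] with Q hexQ hUQ hisoQ hQ
  choose T hTmem hTim hT0 using fun k => hexQ k hQ
  have hTre : ∀ k, |(T k).re - x k| ≤ ρ' := fun k => by
    have h1 := hTmem k
    rw [mem_closedBall, dist_eq_norm] at h1
    have h2 := Complex.abs_re_le_norm (T k - x k)
    simp only [Complex.sub_re, Complex.ofReal_re] at h2
    exact h2.trans h1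
  have hTimle : ∀ k, (T k).im ≤ ρ' := fun k => by
    have h1 := hTmem k
    rw [mem_closedBall, dist_eq_norm] at h1
    have h2 := Complex.abs_im_le_norm (T k - x k)
    simp only [Complex.sub_im, Complex.ofReal_im, sub_zero] at h2
    exact (le_abs_self _).trans (h2.trans h1)
  have hmono : StrictMono fun k => (T k).re := fun i j hij => by
    have h1 := hgap i j hij
    have h2 := abs_le.1 (hTre i)
    have h3 := abs_le.1 (hTre j)
    simp only
    linarith
  have hTarg : ∀ k, Complex.arg (Complex.exp (Complex.I * T k)) = (T k).re := fun k => by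
    have h1 := hup k
    have h2 := hlow k
    have h3 := abs_le.1 (hTre k)
    have h4 : (Complex.I * T k).im = (T k).re := by simp
    rw [Complex.arg_exp, h4, toIocMod_eq_self]
    constructor <;> linarith
  have hTnorm : ∀ k, Real.exp (-η) < ‖Complex.exp (Complex.I * T k)‖ := fun k => by
    rw [Complex.norm_exp, Real.exp_lt_exp]
    have := hTimle k
    simp only [Complex.mul_re, Complex.I_re, zero_mul, Complex.I_im, one_mul, zero_sub]
    linarith
  have hTinj : Function.Injective fun k => Complex.exp (Complex.I * T k) := fun i j hij => by
    have := congrArg Complex.arg hij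
    simp only [hTarg] at this
    exact hmono.injective this
  have hTroot : ∀ k, Complex.exp (Complex.I * T k) ∈ musicRoots Q := fun k =>
    mem_musicRoots_exp_iff.2 ⟨hTim k, hT0 k⟩
  have hfar : ∀ w ∈ musicRoots Q, w ∉ Set.range (fun k => Complex.exp (Complex.I * T k)) →
      ‖w‖ < Real.exp (-η) := by
    intro w hw hwr
    by_contra! hle
    have hw0 : w ≠ 0 := hw.1
    have hwexp := exp_arg_sub_log hw0
    set τ : ℂ := Complex.arg w - Real.log ‖w‖ * Complex.I with hτ
    have hτre : τ.re = Complex.arg w := by simp [hτ]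
    have hτim : τ.im = -Real.log ‖w‖ := by simp [hτ]
    have hw' := hw
    rw [← hwexp, mem_musicRoots_exp_iff] at hw'
    have hlog : -η ≤ Real.log ‖w‖ := (Real.le_log_iff_exp_le (norm_pos_iff.2 hw0)).2 hle
    obtain ⟨k, hk⟩ := hisoQ τ (by
      rw [hτre]; exact ⟨(Complex.neg_pi_lt_arg w).le, Complex.arg_le_pi w⟩) hw'.1
      (by rw [hτim]; linarith) hw'.2
    have := hUQ k hQ τ (ball_subset_ball (hrr₀ k) hk) (T k)
      (closedBall_subset_ball (lt_of_lt_of_le hρ'r (hrr₀ k)) (hTmem k)) hw'.1 (hTim k) hw'.2 (hT0 k)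
    apply hwr
    refine ⟨k, ?_⟩
    simp only
    rw [← this, hwexp]
  refine ⟨T, fun k => ⟨closedBall_subset_ball (by linarith) (hTmem k), hT0 k⟩, hmono, hTarg,
    ⟨hTinj, hTroot, fun w hw hwr k => ?_⟩, fun z hz hzmono => ?_⟩
  · have h1 := hfar w hw hwr
    have h2 := hTnorm k
    simp only
    linarith
  -- If some selected root were not one of the K near ones, then by counting some near root would be
  -- left unselected although it is strictly closer to the circle.
  · have hsub : ∀ k, z k ∈ Set.range (fun k => Complex.exp (Complex.I * T k)) := by
      intro k
      by_contra hk
      have h1 := hfar (z k) (hz.2.1 k) hk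
      obtain ⟨j, hj⟩ : ∃ j, Complex.exp (Complex.I * T j) ∉ Set.range z := by
        by_contra! hall
        choose g hg using hall
        have hginj : Function.Injective g := fun a b hab => hTinj (by
          simp only; rw [← hg a, ← hg b, hab])
        obtain ⟨j, hj⟩ := (Finite.injective_iff_surjective.1 hginj) k
        exact hk ⟨j, by simp only; rw [← hg j, hj]⟩
      have h2 := hz.2.2 _ (hTroot j) hj k
      have h3 := hTnorm j
      linarith
    choose g hg using hsub
    have hginj : Function.Injective g := fun a b hab => hz.1 (by rw [← hg a, ← hg b, hab])
    have hgmono : Monotone g := fun a b hab => by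
      have h1 := hzmono hab
      simp only [← hg, hTarg] at h1
      exact hmono.le_iff_le.1 h1
    -- Both lists are ordered by argument, and a strictly monotone self-map of `Fin K` is the
    -- identity. So estimates are matched to true angles index by index.
    have hid : g = id := ((hgmono.strictMono_of_injective hginj).range_inj strictMono_id).1
      (by rw [Set.range_id, (Finite.injective_iff_surjective.1 hginj).range_eq])
    ext k
    rw [← hg k, hid]
    rfl

end RootLocation

/-! ### First-order accuracy of a perturbed double root. -/

section RootAccuracy

open Asymptotics Metric

variable {M : ℕ} {Q₀ : Matrix (Fin M) (Fin M) ℂ}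

lemma norm_nullSpectrum_ofReal_le (r : ℕ) (Q : Matrix (Fin M) (Fin M) ℂ) (x : ℝ) :
    ‖nullSpectrum r Q x‖
      ≤ ∑ m : Fin M, ∑ l : Fin M, ‖(Complex.I * ((m : ℕ) - (l : ℕ) : ℂ)) ^ r‖ * ‖Q m l‖ := by
  unfold nullSpectrum
  refine (norm_sum_le _ _).trans (Finset.sum_le_sum fun m _ => (norm_sum_le _ _).trans
    (Finset.sum_le_sum fun l _ => ?_))
  have : ‖Complex.exp (Complex.I * ((m : ℕ) - (l : ℕ)) * x)‖ = 1 := by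
    rw [Complex.norm_exp]; simp
  rw [norm_mul, norm_mul, this, mul_one, mul_comm]

variable {ι : Type*} {l : Filter ι} {ε : ι → ℝ} {Q Q₁ : ι → Matrix (Fin M) (Fin M) ℂ}

lemma isBigO_nullSpectrum (r : ℕ) (x : ℝ) {X : ι → Matrix (Fin M) (Fin M) ℂ} {g : ι → ℝ}
    (h : ∀ m n, (fun i => X i m n) =O[l] g) : (fun i => nullSpectrum r (X i) x) =O[l] g := by
  have h1 : (fun i => ∑ m : Fin M, ∑ n : Fin M,
      ‖(Complex.I * ((m : ℕ) - (n : ℕ) : ℂ)) ^ r‖ * ‖X i m n‖)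
      =O[l] g :=
    IsBigO.fun_sum fun m _ => IsBigO.fun_sum fun n _ => (h m n).norm_left.const_mul_left _
  refine (IsBigO.of_bound 1 (Eventually.of_forall fun i => ?_)).trans h1
  rw [one_mul]
  exact (norm_nullSpectrum_ofReal_le _ _ _).trans (le_abs_self _)

/-- Zeros of the null spectrum near a simple root of its derivative: bounds by Taylor expansion. -/
lemma nullSpectrum_zero_bounds {Q : Matrix (Fin M) (Fin M) ℂ} (hQ : IsOrthProj Q) {x r B b : ℝ}
    (hB : ∀ z ∈ ball (x : ℂ) r, ‖nullSpectrum 3 Q z‖ ≤ B)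
    (hb2 : ∀ z ∈ ball (x : ℂ) r, b ≤ (nullSpectrum 2 Q z).re) {τ : ℂ} (hτ : τ ∈ ball (x : ℂ) r)
    (hτB : B * |τ.im| ≤ b / 4) (h0 : nullSpectrum 0 Q τ = 0) :
    ‖nullSpectrum 1 Q τ.re‖ ≤ B * τ.im ^ 2 ∧ τ.im ^ 2 * (b / 4) ≤ ‖nullSpectrum 0 Q τ.re‖ := by
  set X : ℝ := τ.re with hX
  set y : ℝ := τ.im with hy
  have hXmem : (X : ℂ) ∈ ball (x : ℂ) r := by
    rw [mem_ball, dist_eq_norm] at hτ ⊢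
    refine lt_of_le_of_lt ?_ hτ
    rw [← Complex.ofReal_sub, Complex.norm_real, Real.norm_eq_abs]
    simpa using Complex.abs_re_le_norm (τ - x)
  have hB0 : 0 ≤ B := (norm_nonneg _).trans (hB _ hXmem)
  have hT := norm_taylor_two_le (hasDerivAt_nullSpectrum 0 Q) (hasDerivAt_nullSpectrum 1 Q)
    (hasDerivAt_nullSpectrum 2 Q) (convex_ball (x : ℂ) r) hB hXmem hτ
  have hsub : τ - X = y * Complex.I := by
    apply Complex.ext <;> simp [hX, hy]
  have hnorm : ‖τ - X‖ = |y| := by rw [hsub]; simp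
  set E := nullSpectrum 0 Q τ - nullSpectrum 0 Q X - nullSpectrum (0 + 1) Q X * (τ - X)
    - nullSpectrum (1 + 1) Q X * (τ - X) ^ 2 / 2 with hE
  rw [hnorm] at hT
  have i0 := nullSpectrum_ofReal_im hQ.1 0 X
  have i1 := nullSpectrum_ofReal_im hQ.1 1 X
  have i2 := nullSpectrum_ofReal_im hQ.1 2 X
  have r0 : nullSpectrum 0 Q X = ((nullSpectrum 0 Q X).re : ℂ) := Complex.ext rfl (by simp [i0])
  have r1 : nullSpectrum 1 Q X = ((nullSpectrum 1 Q X).re : ℂ) := Complex.ext rfl (by simp [i1])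
  have r2 : nullSpectrum 2 Q X = ((nullSpectrum 2 Q X).re : ℂ) := Complex.ext rfl (by simp [i2])
  set a0 := (nullSpectrum 0 Q X).re with ha0
  set a1 := (nullSpectrum 1 Q X).re with ha1
  set a2 := (nullSpectrum 2 Q X).re with ha2
  -- The expansion is taken about the real part X of τ, where all derivatives are real, and the
  -- increment j y is purely imaginary. So even and odd orders separate: the real part bounds y² by
  -- f(X), and the imaginary part bounds f′(X) by y².
  have hEeq : E = ((-a0 + a2 * y ^ 2 / 2 : ℝ) : ℂ) + ((-a1 * y : ℝ) : ℂ) * Complex.I := by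
    rw [hE, h0, zero_add, one_add_one_eq_two, r0, r1, r2, hsub, mul_pow, Complex.I_sq]
    push_cast; ring
  have hEre : |-a0 + a2 * y ^ 2 / 2| ≤ B * |y| ^ 3 := by
    have h1 : E.re = -a0 + a2 * y ^ 2 / 2 := by
      rw [hEeq, Complex.add_re, Complex.ofReal_re, Complex.re_ofReal_mul, Complex.I_re, mul_zero,
        add_zero]
    rw [← h1]
    exact (Complex.abs_re_le_norm E).trans hT
  have hEim : |a1 * y| ≤ B * |y| ^ 3 := by
    have h1 : E.im = -(a1 * y) := by
      rw [hEeq, Complex.add_im, Complex.ofReal_im, Complex.im_ofReal_mul, Complex.I_im, mul_one,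
        zero_add, neg_mul]
    rw [← abs_neg, ← h1]
    exact (Complex.abs_im_le_norm E).trans hT
  have ha2b : b ≤ a2 := hb2 _ hXmem
  have hn0 : ‖nullSpectrum 0 Q X‖ = |a0| := by rw [r0]; simp
  have hn1 : ‖nullSpectrum 1 Q X‖ = |a1| := by rw [r1]; simp
  rw [hn0, hn1]
  constructor
  · rcases eq_or_ne y 0 with hy0 | hy0
    · have hτX : τ = X := by rw [← sub_eq_zero, hsub, hy0]; simp
      rw [hτX] at h0
      have h1 := nullSpectrum_one_eq_zero hQ.1 (hQ.mulVec_steering_eq_zero h0)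
      rw [← hn1, h1, hy0]; simp
    · have hpos : 0 < |y| := abs_pos.2 hy0
      rw [abs_mul] at hEim
      have : |a1| * |y| ≤ B * |y| ^ 2 * |y| := by nlinarith
      have h2 := le_of_mul_le_mul_right this hpos
      rwa [sq_abs] at h2
  · have h1 : |y| ^ 3 = |y| * y ^ 2 := by rw [← sq_abs]; ring
    have h2 : B * |y| ^ 3 ≤ b / 4 * y ^ 2 := by
      rw [h1, ← mul_assoc]
      exact mul_le_mul_of_nonneg_right hτB (sq_nonneg _)
    have h3 := (abs_le.1 hEre).2
    have h4 : b * y ^ 2 ≤ a2 * y ^ 2 := mul_le_mul_of_nonneg_right ha2b (sq_nonneg _)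
    have h5 := le_abs_self a0
    linarith

/-- The first order perturbation of a root of the null spectrum on the unit circle. -/
lemma isBigO_root_sub (hQ₀ : IsOrthProj Q₀) {x : ℝ} (hx : nullSpectrum 0 Q₀ x = 0)
    (hx2 : 0 < (nullSpectrum 2 Q₀ x).re) (hε : Tendsto ε l (𝓝 0))
    (hQ : ∀ᶠ i in l, IsOrthProj (Q i)) (hQQ₀ : ∀ m n, (fun i => Q i m n - Q₀ m n) =O[l] ε)
    (hQQ₁ : ∀ m n, (fun i => Q i m n - Q₀ m n - Q₁ i m n) =O[l] fun i => ε i ^ 2)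
    {T : ι → ℂ} (hT : Tendsto T l (𝓝 x)) (hT0 : ∀ᶠ i in l, nullSpectrum 0 (Q i) (T i) = 0) :
    (fun i => (((T i).re - x : ℝ) : ℂ) + nullSpectrum 1 (Q₁ i) x / nullSpectrum 2 Q₀ x)
      =O[l] fun i => ε i ^ 2 := by
  set c := nullSpectrum 2 Q₀ x with hc
  have hc0 : c ≠ 0 := fun h => by rw [h] at hx2; simp at hx2
  have hQ₀x := hQ₀.mulVec_steering_eq_zero hx
  have hQt : Tendsto Q l (𝓝 Q₀) := by
    refine tendsto_pi_nhds.2 fun m => tendsto_pi_nhds.2 fun n => ?_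
    exact tendsto_sub_nhds_zero_iff.1 ((hQQ₀ m n).trans_tendsto hε)
  set b := c.re / 2 with hb
  have hb0 : 0 < b := by positivity
  set B := ‖nullSpectrum 3 Q₀ x‖ + ‖c‖ + 1 with hB
  have hB0 : 0 < B := by positivity
  have hloc : ∀ᶠ p : Matrix (Fin M) (Fin M) ℂ × ℂ in 𝓝 (Q₀, (x : ℂ)),
      ‖nullSpectrum 3 p.1 p.2‖ ≤ B ∧ ‖nullSpectrum 2 p.1 p.2‖ ≤ B
        ∧ b ≤ (nullSpectrum 2 p.1 p.2).re := by
    have h3 := (continuous_fst.nullSpectrum continuous_snd 3 :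
      Continuous fun p : Matrix (Fin M) (Fin M) ℂ × ℂ => nullSpectrum 3 p.1 p.2)
    have h2 := (continuous_fst.nullSpectrum continuous_snd 2 :
      Continuous fun p : Matrix (Fin M) (Fin M) ℂ × ℂ => nullSpectrum 2 p.1 p.2)
    have e3 : ∀ᶠ p : Matrix (Fin M) (Fin M) ℂ × ℂ in 𝓝 (Q₀, (x : ℂ)),
        ‖nullSpectrum 3 p.1 p.2‖ < B :=
      (h3.norm.tendsto (Q₀, (x : ℂ))).eventually_lt_const (by
        simp only; rw [hB]; have := norm_nonneg c; linarith)
    have e2 : ∀ᶠ p : Matrix (Fin M) (Fin M) ℂ × ℂ in 𝓝 (Q₀, (x : ℂ)),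
        ‖nullSpectrum 2 p.1 p.2‖ < B :=
      (h2.norm.tendsto (Q₀, (x : ℂ))).eventually_lt_const (by
        simp only; rw [← hc, hB]; have := norm_nonneg (nullSpectrum 3 Q₀ x); linarith)
    have e1 : ∀ᶠ p : Matrix (Fin M) (Fin M) ℂ × ℂ in 𝓝 (Q₀, (x : ℂ)),
        b < (nullSpectrum 2 p.1 p.2).re :=
      ((Complex.continuous_re.comp h2).tendsto (Q₀, (x : ℂ))).eventually_const_lt (by
        simp only [Function.comp]; rw [← hc, hb]; linarith)
    filter_upwards [e3, e2, e1] with p h3 h2 h1 using ⟨h3.le, h2.le, h1.le⟩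
  rw [nhds_prod_eq, eventually_prod_iff] at hloc
  obtain ⟨pa, hpa, pb, hpb, hab⟩ := hloc
  obtain ⟨r, hr, hrb⟩ := Metric.eventually_nhds_iff_ball.1 hpb
  have hTball : ∀ᶠ i in l, T i ∈ ball (x : ℂ) r := hT.eventually (ball_mem_nhds _ hr)
  have hTim : ∀ᶠ i in l, B * |(T i).im| ≤ b / 4 := by
    have h1 : Tendsto (fun i => B * |(T i).im|) l (𝓝 (B * |((x : ℂ)).im|)) :=
      ((((Complex.continuous_im.tendsto _).comp hT).abs).const_mul B)
    rw [Complex.ofReal_im, abs_zero, mul_zero] at h1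
    exact (h1.eventually_lt_const (by positivity)).mono fun i h => h.le
  have hδ : Tendsto (fun i => (T i).re - x) l (𝓝 0) := by
    have := ((Complex.continuous_re.tendsto _).comp hT).sub_const x
    simpa using this
  -- the value and the first two derivatives at `x`
  have n0 : (fun i => nullSpectrum 0 (Q i) x) =O[l] fun i => ε i ^ 2 := by
    have hv : ∀ m, (fun i => (Q i *ᵥ steering M x) m) =O[l] ε := fun m => by
      have h1 : (fun i => ∑ n, (Q i m n - Q₀ m n) * steering M x n) =O[l] ε :=
        IsBigO.fun_sum fun n _ => by
          simpa only [mul_comm] using (hQQ₀ m n).const_mul_left (steering M x n)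
      refine h1.congr_left fun i => ?_
      have h2 : ((Q i - Q₀) *ᵥ steering M x) m = (Q i *ᵥ steering M x) m := by
        rw [sub_mulVec, hQ₀x, sub_zero]
      rw [← h2]; rfl
    -- Since Q₀ a = 0, the vector Q a is first order, and aᴴ Q a = ‖Q a‖² is therefore second order.
    have h1 : (fun i => ∑ m, star ((Q i *ᵥ steering M x) m) * (Q i *ᵥ steering M x) m)
        =O[l] fun i => ε i ^ 2 := IsBigO.fun_sum fun m _ => by
      have h2 : (fun i => star ((Q i *ᵥ steering M x) m)) =O[l] ε := by
        rw [← isBigO_norm_left]; simpa only [norm_star] using (hv m).norm_left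
      simpa only [sq] using h2.mul (hv m)
    refine h1.congr' ?_ EventuallyEq.rfl
    filter_upwards [hQ] with i hQi
    rw [nullSpectrum_zero_ofReal]
    have : star (steering M x) ⬝ᵥ (Q i *ᵥ steering M x)
        = star (Q i *ᵥ steering M x) ⬝ᵥ (Q i *ᵥ steering M x) := by
      rw [star_mulVec, hQi.1.eq, ← dotProduct_mulVec, mulVec_mulVec, hQi.2]
    rw [this]; rfl
  have n1 : (fun i => nullSpectrum 1 (Q i) x) =O[l] ε := by
    refine (isBigO_nullSpectrum 1 x (X := fun i => Q i - Q₀) hQQ₀).congr_left fun i => ?_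
    rw [nullSpectrum_sub, nullSpectrum_one_eq_zero hQ₀.1 hQ₀x, sub_zero]
  have n2 : (fun i => nullSpectrum 2 (Q i) x - c) =O[l] ε := by
    refine (isBigO_nullSpectrum 2 x (X := fun i => Q i - Q₀) hQQ₀).congr_left fun i => ?_
    rw [nullSpectrum_sub]
  set δ : ι → ℝ := fun i => (T i).re - x with hδdef
  -- The size of δ is not yet known, so errors are first measured by ε² + δ². The δ² part is
  -- absorbed below.
  set g : ι → ℝ := fun i => ε i ^ 2 + δ i ^ 2 with hg
  have hεg : (fun i => ε i ^ 2) =O[l] g := IsBigO.of_bound 1 (Eventually.of_forall fun i => by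
    rw [one_mul, Real.norm_eq_abs, Real.norm_eq_abs, abs_of_nonneg (by positivity),
      abs_of_nonneg (by positivity)]
    have := sq_nonneg (δ i); simp only [hg]; linarith)
  have hδg : (fun i => δ i ^ 2) =O[l] g := IsBigO.of_bound 1 (Eventually.of_forall fun i => by
    rw [one_mul, Real.norm_eq_abs, Real.norm_eq_abs, abs_of_nonneg (by positivity),
      abs_of_nonneg (by positivity)]
    have := sq_nonneg (ε i); simp only [hg]; linarith)
  have hεδg : (fun i => ε i * δ i) =O[l] g := IsBigO.of_bound 1 (Eventually.of_forall fun i => by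
    rw [one_mul, Real.norm_eq_abs, Real.norm_eq_abs, abs_of_nonneg (by positivity : 0 ≤ g i),
      abs_le]
    simp only [hg]
    constructor <;> nlinarith [sq_nonneg (ε i + δ i), sq_nonneg (ε i - δ i)])
  have hδC : (fun i => (δ i : ℂ)) =O[l] δ :=
    IsBigO.of_bound 1 (Eventually.of_forall fun i => by simp)
  have hXball : ∀ᶠ i in l, (((T i).re : ℝ) : ℂ) ∈ ball (x : ℂ) r := by
    filter_upwards [hTball] with i hi
    rw [mem_ball, dist_eq_norm] at hi ⊢
    refine lt_of_le_of_lt ?_ hi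
    rw [← Complex.ofReal_sub, Complex.norm_real, Real.norm_eq_abs]
    simpa using Complex.abs_re_le_norm (T i - x)
  have hxball : (x : ℂ) ∈ ball (x : ℂ) r := mem_ball_self hr
  have t0 : (fun i => nullSpectrum 0 (Q i) ((T i).re : ℂ)) =O[l] g := by
    have h1 : (fun i => nullSpectrum 0 (Q i) ((T i).re : ℂ) - nullSpectrum 0 (Q i) x
        - nullSpectrum 1 (Q i) x * (δ i : ℂ)) =O[l] fun i => δ i ^ 2 := by
      refine IsBigO.of_bound B ?_
      filter_upwards [hXball, hQt.eventually hpa] with i hi hpai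
      have := norm_taylor_one_le (hasDerivAt_nullSpectrum 0 (Q i)) (hasDerivAt_nullSpectrum 1 (Q i))
        (convex_ball (x : ℂ) r) (fun z hz => (hab hpai (hrb z hz)).2.1) hxball hi
      rw [← Complex.ofReal_sub, Complex.norm_real] at this
      rw [Real.norm_eq_abs, abs_of_nonneg (sq_nonneg _)]
      simpa [hδdef] using this
    have h2 := ((h1.trans hδg).add ((n1.mul hδC).trans hεδg)).add (n0.trans hεg)
    refine h2.congr_left fun i => ?_
    ring
  have hy : (fun i => (T i).im ^ 2) =O[l] g := by
    refine IsBigO.trans (IsBigO.of_bound (4 / b) ?_) t0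
    filter_upwards [hQ, hTball, hTim, hT0, hQt.eventually hpa] with i hQi hTi hTimi hT0i hpai
    have := (nullSpectrum_zero_bounds hQi (fun z hz => (hab hpai (hrb z hz)).1)
      (fun z hz => (hab hpai (hrb z hz)).2.2) hTi hTimi hT0i).2
    rw [Real.norm_eq_abs, abs_of_nonneg (sq_nonneg _), div_mul_eq_mul_div, le_div_iff₀ hb0]
    linarith
  have t1 : (fun i => nullSpectrum 1 (Q i) ((T i).re : ℂ)) =O[l] g := by
    refine IsBigO.trans (IsBigO.of_bound B ?_) hy
    filter_upwards [hQ, hTball, hTim, hT0, hQt.eventually hpa] with i hQi hTi hTimi hT0i hpai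
    have := (nullSpectrum_zero_bounds hQi (fun z hz => (hab hpai (hrb z hz)).1)
      (fun z hz => (hab hpai (hrb z hz)).2.2) hTi hTimi hT0i).1
    rwa [Real.norm_eq_abs, abs_of_nonneg (sq_nonneg _)]
  have key : (fun i => c * (δ i : ℂ) + nullSpectrum 1 (Q i) x) =O[l] g := by
    have h1 : (fun i => nullSpectrum 1 (Q i) ((T i).re : ℂ) - nullSpectrum 1 (Q i) x
        - nullSpectrum 2 (Q i) x * (δ i : ℂ)) =O[l] fun i => δ i ^ 2 := by
      refine IsBigO.of_bound B ?_
      filter_upwards [hXball, hQt.eventually hpa] with i hi hpai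
      have := norm_taylor_one_le (hasDerivAt_nullSpectrum 1 (Q i)) (hasDerivAt_nullSpectrum 2 (Q i))
        (convex_ball (x : ℂ) r) (fun z hz => (hab hpai (hrb z hz)).1) hxball hi
      rw [← Complex.ofReal_sub, Complex.norm_real] at this
      rw [Real.norm_eq_abs, abs_of_nonneg (sq_nonneg _)]
      simpa [hδdef] using this
    have h2 := (t1.sub (h1.trans hδg)).sub ((n2.mul hδC).trans hεδg)
    refine h2.congr_left fun i => ?_
    ring
  have hε2 : (fun i => ε i ^ 2) =O[l] ε := by
    have h1 : (fun i => ε i * ε i) =O[l] fun i => (1 : ℝ) * ε i :=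
      ((hε.isBigO_one ℝ)).mul (isBigO_refl ε l)
    simpa [sq] using h1
  -- Bootstrap: ‖c‖|δ| ≤ ‖f′(x)‖ + C(ε² + δ²), and δ → 0 makes C δ² at most half of the left side.
  have hδO : δ =O[l] ε := by
    have h1 : (fun i => δ i ^ 2) =o[l] δ := by
      have h2 : (fun i => δ i * δ i) =o[l] fun i => (1 : ℝ) * δ i :=
        ((isLittleO_one_iff ℝ).2 hδ).mul_isBigO (isBigO_refl δ l)
      simpa [sq] using h2
    obtain ⟨C, hC0, hC⟩ := key.exists_pos
    have hC' := hC.bound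
    have hn := ((n1.norm_left).add (hε2.const_mul_left C))
    have h3 : (fun i => ‖c‖ / 2 * |δ i|) =O[l] ε := by
      refine IsBigO.trans (IsBigO.of_bound 1 ?_) hn
      have hcpos : 0 < ‖c‖ := norm_pos_iff.2 hc0
      filter_upwards [hC', h1.def (show 0 < ‖c‖ / (2 * C) by positivity)] with i hi h1i
      rw [Real.norm_eq_abs, abs_of_nonneg (by positivity), one_mul]
      refine le_trans ?_ (le_abs_self _)
      rw [Real.norm_eq_abs, Real.norm_eq_abs, abs_of_nonneg (sq_nonneg _)] at h1i
      rw [Real.norm_eq_abs (g i), abs_of_nonneg (by positivity)] at hi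
      have h4 : ‖c * (δ i : ℂ)‖ ≤ ‖c * (δ i : ℂ) + nullSpectrum 1 (Q i) x‖
          + ‖nullSpectrum 1 (Q i) x‖ := by
        simpa using norm_sub_le (c * (δ i : ℂ) + nullSpectrum 1 (Q i) x) (nullSpectrum 1 (Q i) x)
      rw [norm_mul, Complex.norm_real, Real.norm_eq_abs] at h4
      have h5 : C * δ i ^ 2 ≤ ‖c‖ / 2 * |δ i| := by
        calc C * δ i ^ 2 ≤ C * (‖c‖ / (2 * C) * |δ i|) := mul_le_mul_of_nonneg_left h1i hC0.le
          _ = _ := by field_simp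
      simp only [hg] at hi
      linarith
    have h6 := h3.const_mul_left (2 / ‖c‖)
    have hcpos : ‖c‖ ≠ 0 := norm_ne_zero_iff.2 hc0
    refine (IsBigO.of_bound 1 (Eventually.of_forall fun i => ?_)).trans h6
    rw [one_mul, Real.norm_eq_abs, Real.norm_eq_abs]
    have : 2 / ‖c‖ * (‖c‖ / 2 * |δ i|) = |δ i| := by field_simp
    rw [this, abs_abs]
  have hgε : g =O[l] fun i => ε i ^ 2 := (isBigO_refl _ _).add (by
    simpa only [sq] using hδO.mul hδO)
  have hQ₁ : (fun i => nullSpectrum 1 (Q i) x - nullSpectrum 1 (Q₁ i) x) =O[l]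
      fun i => ε i ^ 2 := by
    refine (isBigO_nullSpectrum 1 x (X := fun i => Q i - Q₀ - Q₁ i) hQQ₁).congr_left fun i => ?_
    rw [nullSpectrum_sub, nullSpectrum_sub, nullSpectrum_one_eq_zero hQ₀.1 hQ₀x, sub_zero]
  have hfin := ((key.trans hgε).sub hQ₁).const_mul_left c⁻¹
  refine hfin.congr_left fun i => ?_
  simp only [hδdef]
  field_simp
  ring

end RootAccuracy

/-! ### Root-MUSIC errors and the actual leakage of the second step. -/

section RootMusic

open Asymptotics Metric

variable {M K : ℕ} {ω : Fin K → ℝ} {S : Matrix (Fin K) (Fin K) ℂ} {σ : ℝ} {μ : Fin K → ℝ}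
  {e : Fin K → Fin M → ℂ}

lemma isOrthProj_noiseProj {R : Matrix (Fin M) (Fin M) ℂ} (he : IsSignalEigensystem R μ e) :
    IsOrthProj (noiseProj e) := ⟨noiseProj_isHermitian e, he.noiseProj_mul_self⟩

lemma nullSpectrum_zero_noiseProj (hω : Function.Injective fun k => steering M (ω k))
    (hKM : K < M) (hS : S.PosDef) (he : IsSignalEigensystem (dataCov M ω S σ) μ e) (k : Fin K) :
    nullSpectrum 0 (noiseProj e) (ω k) = 0 := by
  rw [nullSpectrum_zero_ofReal, noiseProj_mulVec_steering hω hKM.le hS he, dotProduct_zero]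

lemma nullSpectrum_two_noiseProj (hω : Function.Injective fun k => steering M (ω k))
    (hKM : K < M) (hS : S.PosDef) (he : IsSignalEigensystem (dataCov M ω S σ) μ e) (k : Fin K) :
    nullSpectrum 2 (noiseProj e) (ω k)
      = 2 * (star (steeringOne M (ω k)) ⬝ᵥ (noiseProj e *ᵥ steeringOne M (ω k))) :=
  nullSpectrum_two_ofReal (noiseProj_isHermitian e) (noiseProj_mulVec_steering hω hKM.le hS he k)

lemma nullSpectrum_two_noiseProj_pos (hω : Function.Injective fun k => steering M (ω k))
    (hKM : K < M) (hS : S.PosDef) (he : IsSignalEigensystem (dataCov M ω S σ) μ e) (k : Fin K) :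
    0 < (nullSpectrum 2 (noiseProj e) (ω k)).re := by
  rw [nullSpectrum_two_noiseProj hω hKM hS he]
  have := (Complex.lt_def.1 (noise_quadratic_pos hω hKM hS he k)).1
  simp only [Complex.zero_re] at this
  simpa using this

lemma eq_angle_of_nullSpectrum_eq_zero (hω : Function.Injective fun k => steering M (ω k))
    (hKM : K < M) (hS : S.PosDef) (he : IsSignalEigensystem (dataCov M ω S σ) μ e)
    (hmem : ∀ k, ω k ∈ Set.Ioo (-Real.pi) Real.pi) {y : ℝ}
    (hy : y ∈ Set.Icc (-Real.pi) Real.pi) (h0 : nullSpectrum 0 (noiseProj e) (y : ℂ) = 0) :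
    ∃ k, y = ω k := by
  obtain ⟨c, hc⟩ := exists_mulVec_eq_of_noiseProj_mulVec hω hKM.le hS he
    ((isOrthProj_noiseProj he).mulVec_steering_eq_zero h0)
  obtain ⟨k, hk⟩ := exists_exp_eq_of_mulVec_eq_steering hKM hc
  refine ⟨k, ?_⟩
  obtain ⟨n, hn⟩ := Complex.exp_eq_exp_iff_exists_int.1 hk
  have h1 : y = ω k - n * (2 * Real.pi) := by
    have h2 : Complex.I * (y : ℂ) = Complex.I * ((ω k - n * (2 * Real.pi) : ℝ) : ℂ) := by
      push_cast
      linear_combination -hn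
    exact_mod_cast mul_left_cancel₀ Complex.I_ne_zero h2
  have hpi := Real.pi_pos
  have hk1 := hmem k
  -- No aliasing: ω_k lies strictly inside the period, so a point of [−π, π] cannot differ from it
  -- by a full turn.
  have hn0 : n = 0 := by
    have h2 : |(n : ℝ) * (2 * Real.pi)| < 1 * (2 * Real.pi) := by
      rw [abs_lt]
      constructor <;> linarith [hk1.1, hk1.2, hy.1, hy.2]
    rw [abs_mul, abs_of_pos (by positivity : (0 : ℝ) < 2 * Real.pi)] at h2
    have h3 := lt_of_mul_lt_mul_right h2 (by positivity)
    have h4 : |n| < 1 := by exact_mod_cast h3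
    exact Int.abs_lt_one_iff.1 h4
  rw [h1, hn0]; simp

/-- The displayed fraction is the Newton step −f′/f″ at the true angle, with f′ taken along the
first-order change −(W Δ Q + Q Δ W) of the noise projection. The other two pairings vanish because Q
a_k = 0. -/
lemma freqError_eq (hω : Function.Injective fun k => steering M (ω k))
    (hKM : K < M) (hS : S.PosDef) (he : IsSignalEigensystem (dataCov M ω S σ) μ e)
    (W Δ : Matrix (Fin M) (Fin M) ℂ) (k : Fin K) :
    freqError M ω (noiseProj e) W Δ k
      = -(nullSpectrum 1 (-(W * Δ * noiseProj e + noiseProj e * Δ * W)) (ω k)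
        / nullSpectrum 2 (noiseProj e) (ω k)) := by
  have hQa := noiseProj_mulVec_steering hω hKM.le hS he k
  have haQ : ∀ v, star (steering M (ω k)) ⬝ᵥ (noiseProj e *ᵥ v) = 0 := fun v => by
    have h1 := star_mulVec (noiseProj e) (steering M (ω k))
    rw [(noiseProj_isHermitian e).eq, hQa, star_zero] at h1
    rw [dotProduct_mulVec, ← h1, zero_dotProduct]
  rw [nullSpectrum_two_noiseProj hω hKM hS he, nullSpectrum_one_ofReal, freqError]
  have h1 : (W * Δ * noiseProj e) *ᵥ steering M (ω k) = 0 := by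
    rw [← mulVec_mulVec, hQa, mulVec_zero]
  have h2 : star (steering M (ω k)) ⬝ᵥ ((noiseProj e * Δ * W) *ᵥ steeringOne M (ω k)) = 0 := by
    rw [Matrix.mul_assoc, ← mulVec_mulVec, haQ]
  rw [neg_mulVec, neg_mulVec, add_mulVec, add_mulVec, h1, zero_add, dotProduct_neg, dotProduct_neg,
    dotProduct_add, h2, add_zero]
  have hI : Complex.I ≠ 0 := Complex.I_ne_zero
  have hD := (noise_quadratic_pos hω hKM hS he k).ne'
  field_simp
  rw [Complex.I_sq]
  ring

lemma electricalAngle_eq_arg {d lam : ℝ} (hd : 0 < d) (hlam : 0 < lam) {x y : ℝ}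
    (h : Real.sin x = y * (lam / (2 * Real.pi * d))) : electricalAngle d lam x = y := by
  rw [electricalAngle, h]
  have := Real.pi_pos
  field_simp

lemma isClosestRoots_of_isRootMusicEstimate {d lam : ℝ} (hd : 0 < d) (hlam : 0 < lam)
    {R : Matrix (Fin M) (Fin M) ℂ} {θhat : Fin K → ℝ} (h : IsRootMusicEstimate d lam R θhat) :
    ∃ (μ : Fin K → ℝ) (e : Fin K → Fin M → ℂ) (z : Fin K → ℂ), IsSignalEigensystem R μ e ∧
      IsClosestRoots (noiseProj e) z ∧ (Monotone fun k => Complex.arg (z k)) ∧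
      ∀ k, electricalAngle d lam (θhat k) = Complex.arg (z k) := by
  obtain ⟨μ, e, z, he, hinj, hroot, hclose, hsin, hmono⟩ := h
  have hang : ∀ k, electricalAngle d lam (θhat k) = Complex.arg (z k) := fun k =>
    electricalAngle_eq_arg hd hlam (hsin k).2
  refine ⟨μ, e, z, he, ⟨hinj, hroot, hclose⟩, fun a b hab => ?_, hang⟩
  simp only [← hang, electricalAngle]
  have := Real.pi_pos
  exact mul_le_mul_of_nonneg_left (Real.monotoneOn_sin (hsin a).1 (hsin b).1 (hmono hab))
    (by positivity)

open scoped Matrix.Norms.Frobenius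

variable {ι : Type*} {l : Filter ι} {ε : ι → ℝ} {Δ : ι → Matrix (Fin M) (Fin M) ℂ}

lemma dataCov_eq (ω : Fin K → ℝ) (S : Matrix (Fin K) (Fin K) ℂ) (σ : ℝ) :
    dataCov M ω S σ = arrayMatrix M ω * S * (arrayMatrix M ω)ᴴ + ((σ ^ 2 : ℝ) : ℂ) • 1 := rfl

lemma isBigO_noiseProj (hK : 0 < K) (hω : Function.Injective fun k => steering M (ω k))
    (hKM : K < M) (hS : S.PosDef) (he : IsSignalEigensystem (dataCov M ω S σ) μ e)
    (hΔ : ∀ᶠ i in l, (Δ i).IsHermitian) (hΔε : Δ =O[l] ε)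
    {μ₁ : ι → Fin K → ℝ} {e₁ : ι → Fin K → Fin M → ℂ}
    (he₁ : ∀ᶠ i in l, IsSignalEigensystem (dataCov M ω S σ + Δ i) (μ₁ i) (e₁ i)) :
    (fun i => noiseProj (e₁ i) - noiseProj e) =O[l] ε ∧
    (fun i => noiseProj (e₁ i) - noiseProj e - -(pinvV σ μ e * Δ i * noiseProj e
      + noiseProj e * Δ i * pinvV σ μ e)) =O[l] fun i => ε i ^ 2 := by
  obtain ⟨h1, h2⟩ := isBigO_signalProj (isPinvSystem hK hω hKM.le hS he) he.trace_signalProj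
    (dataCov_eq ω S σ) (dataCov_isHermitian hS ω σ) hΔ hΔε he₁
  constructor
  · refine h1.neg_left.congr_left fun i => ?_
    simp only [noiseProj]; abel
  · refine h2.neg_left.congr_left fun i => ?_
    simp only [noiseProj]; abel

/-- The noise projection matrix is a continuous function of the covariance matrix. -/
lemma tendsto_noiseProj (hK : 0 < K) (hω : Function.Injective fun k => steering M (ω k))
    (hKM : K < M) (hS : S.PosDef) (he : IsSignalEigensystem (dataCov M ω S σ) μ e)
    (hε : Tendsto ε l (𝓝 0)) (hΔ : ∀ᶠ i in l, (Δ i).IsHermitian) (hΔε : Δ =O[l] ε)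
    {μ₁ : ι → Fin K → ℝ} {e₁ : ι → Fin K → Fin M → ℂ}
    (he₁ : ∀ᶠ i in l, IsSignalEigensystem (dataCov M ω S σ + Δ i) (μ₁ i) (e₁ i)) :
    Tendsto (fun i => noiseProj (e₁ i)) l (𝓝 (noiseProj e)) := by
  have h1 := isBigO_matrix_iff.1 (isBigO_noiseProj hK hω hKM hS he hΔ hΔε he₁).1
  refine tendsto_pi_nhds.2 fun m => tendsto_pi_nhds.2 fun n => ?_
  exact tendsto_sub_nhds_zero_iff.1 ((h1 m n).trans_tendsto hε)

lemma eventually_closestRoots_noiseProj (hω : Function.Injective fun k => steering M (ω k))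
    (hKM : K < M) (hS : S.PosDef) (he : IsSignalEigensystem (dataCov M ω S σ) μ e)
    (hmono : StrictMono ω) (hmem : ∀ k, ω k ∈ Set.Ioo (-Real.pi) Real.pi)
    {ρ : ℝ} (hρ : 0 < ρ) :
    ∀ᶠ Q in 𝓝 (noiseProj e), IsOrthProj Q → ∃ T : Fin K → ℂ,
      (∀ k, T k ∈ ball (ω k : ℂ) ρ ∧ nullSpectrum 0 Q (T k) = 0) ∧
      (StrictMono fun k => (T k).re) ∧
      (∀ k, Complex.arg (Complex.exp (Complex.I * T k)) = (T k).re) ∧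
      IsClosestRoots Q (fun k => Complex.exp (Complex.I * T k)) ∧
      ∀ z : Fin K → ℂ, IsClosestRoots Q z → (Monotone fun k => Complex.arg (z k)) →
        z = fun k => Complex.exp (Complex.I * T k) :=
  eventually_closestRoots (isOrthProj_noiseProj he) hmono hmem
    (nullSpectrum_zero_noiseProj hω hKM hS he)
    (fun k h => by
      have := nullSpectrum_two_noiseProj_pos hω hKM hS he k
      rw [h] at this; simp at this)
    (fun _ hy h0 => eq_angle_of_nullSpectrum_eq_zero hω hKM hS he hmem hy h0) hρ

/-- Root-MUSIC estimates have the stated first order errors. -/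
lemma isBigO_rootMusic (hK : 0 < K) (hω : Function.Injective fun k => steering M (ω k))
    (hKM : K < M) (hS : S.PosDef) (he : IsSignalEigensystem (dataCov M ω S σ) μ e)
    (hmono : StrictMono ω) (hmem : ∀ k, ω k ∈ Set.Ioo (-Real.pi) Real.pi)
    {d lam : ℝ} (hd : 0 < d) (hlam : 0 < lam)
    (hε : Tendsto ε l (𝓝 0)) (hΔ : ∀ᶠ i in l, (Δ i).IsHermitian) (hΔε : Δ =O[l] ε)
    {θhat : ι → Fin K → ℝ}
    (hθ : ∀ᶠ i in l, IsRootMusicEstimate d lam (dataCov M ω S σ + Δ i) (θhat i)) (k : Fin K) :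
    (fun i => ((electricalAngle d lam (θhat i k) - ω k : ℝ) : ℂ)
      - freqError M ω (noiseProj e) (pinvV σ μ e) (Δ i) k) =O[l] (fun i => ε i ^ 2) ∧
    (fun i => electricalAngle d lam (θhat i k) - ω k) =O[l] ε := by
  have hch : ∀ i, IsRootMusicEstimate d lam (dataCov M ω S σ + Δ i) (θhat i) →
      ∃ (μ₁ : Fin K → ℝ) (e₁ : Fin K → Fin M → ℂ) (z : Fin K → ℂ),
      IsSignalEigensystem (dataCov M ω S σ + Δ i) μ₁ e₁ ∧
      IsClosestRoots (noiseProj e₁) z ∧ (Monotone fun k => Complex.arg (z k)) ∧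
      ∀ k, electricalAngle d lam (θhat i k) = Complex.arg (z k) :=
    fun i h => isClosestRoots_of_isRootMusicEstimate hd hlam h
  choose! μ₁ e₁ z hz using hch
  have he₁ : ∀ᶠ i in l, IsSignalEigensystem (dataCov M ω S σ + Δ i) (μ₁ i) (e₁ i) :=
    hθ.mono fun i hi => (hz i hi).1
  obtain ⟨hO1, hO2⟩ := isBigO_noiseProj hK hω hKM hS he hΔ hΔε he₁
  have hQt := tendsto_noiseProj hK hω hKM hS he hε hΔ hΔε he₁
  -- The principal complex angle with e^{jT} = z. Its real part is the estimated electrical angle.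
  set T : ι → ℂ := fun i => Complex.arg (z i k) - Real.log ‖z i k‖ * Complex.I with hTdef
  have hTre : ∀ i, (T i).re = Complex.arg (z i k) := fun i => by simp [hTdef]
  have hnear : ∀ ρ > 0, ∀ᶠ i in l, T i ∈ ball (ω k : ℂ) ρ ∧
      nullSpectrum 0 (noiseProj (e₁ i)) (T i) = 0 := by
    intro ρ hρ
    filter_upwards [hθ, he₁,
      hQt.eventually (eventually_closestRoots_noiseProj hω hKM hS he hmono hmem hρ)]
      with i hi hei hroots
    obtain ⟨T', hT', -, hTarg, -, hsel⟩ := hroots (isOrthProj_noiseProj hei)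
    have hzT := congrFun (hsel (z i) (hz i hi).2.1 (hz i hi).2.2.1) k
    have hTT' : T i = T' k := by
      have hlog : Real.log ‖z i k‖ = -(T' k).im := by
        rw [hzT, Complex.norm_exp, Real.log_exp]; simp
      apply Complex.ext
      · rw [hTre, hzT, hTarg]
      · simp [hTdef, hlog]
    rw [hTT']
    exact hT' k
  have hT : Tendsto T l (𝓝 (ω k : ℂ)) :=
    Metric.tendsto_nhds.2 fun ρ hρ => (hnear ρ hρ).mono fun i hi => hi.1
  have hroot := isBigO_root_sub (isOrthProj_noiseProj he)
    (nullSpectrum_zero_noiseProj hω hKM hS he k) (nullSpectrum_two_noiseProj_pos hω hKM hS he k)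
    hε (he₁.mono fun i hi => isOrthProj_noiseProj hi) (isBigO_matrix_iff.1 hO1)
    (isBigO_matrix_iff.1 hO2) hT ((hnear 1 one_pos).mono fun i hi => hi.2)
  have hmain : (fun i => ((electricalAngle d lam (θhat i k) - ω k : ℝ) : ℂ)
      - freqError M ω (noiseProj e) (pinvV σ μ e) (Δ i) k) =O[l] (fun i => ε i ^ 2) := by
    refine hroot.congr' ?_ EventuallyEq.rfl
    filter_upwards [hθ] with i hi
    rw [freqError_eq hω hKM hS he, hTre, ← (hz i hi).2.2.2 k]
    ring
  refine ⟨hmain, ?_⟩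
  have hε2 : (fun i => ε i ^ 2) =O[l] ε := by
    have h1 : (fun i => ε i * ε i) =O[l] fun i => (1 : ℝ) * ε i :=
      (hε.isBigO_one ℝ).mul (isBigO_refl ε l)
    simpa [sq] using h1
  have hf : (fun i => freqError M ω (noiseProj e) (pinvV σ μ e) (Δ i) k) =O[l] ε := by
    have h1 : (fun i => -(pinvV σ μ e * Δ i * noiseProj e + noiseProj e * Δ i * pinvV σ μ e))
        =O[l] ε :=
      ((isBigO_mul_const_matrix (isBigO_const_mul_matrix _ hΔε) _).add
        (isBigO_mul_const_matrix (isBigO_const_mul_matrix _ hΔε) _)).neg_left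
    have h2 := isBigO_nullSpectrum 1 (ω k) (isBigO_matrix_iff.1 h1)
    have h3 := h2.const_mul_left (-(nullSpectrum 2 (noiseProj e) (ω k))⁻¹)
    refine h3.congr_left fun i => ?_
    rw [freqError_eq hω hKM hS he]
    ring
  have hsum := (hmain.trans hε2).add hf
  rw [← isBigO_norm_left] at hsum ⊢
  refine hsum.congr_left fun i => ?_
  rw [sub_add_cancel, Complex.norm_real]

/-- The leading order of the subspace leakage after the second step. -/
lemma isBigO_secondStep (hK : 0 < K) (hω : Function.Injective fun k => steering M (ω k))
    (hKM : K < M) (hS : S.PosDef) (he : IsSignalEigensystem (dataCov M ω S σ) μ e)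
    (hε : Tendsto ε l (𝓝 0)) (hΔ : ∀ᶠ i in l, (Δ i).IsHermitian) (hΔε : Δ =O[l] ε) (γ : ℝ)
    {ωhat : ι → Fin K → ℝ} (hωhat : ∀ k, (fun i => ωhat i k - ω k) =O[l] ε)
    {μ₂ : ι → Fin K → ℝ} {e₂ : ι → Fin K → Fin M → ℂ}
    (he₂ : ∀ᶠ i in l, IsSignalEigensystem
      (modifiedCov γ (dataCov M ω S σ + Δ i) (projA M (ωhat i))) (μ₂ i) (e₂ i)) :
    (fun i => (subspaceLeakage (noiseProj e) (e₂ i) : ℂ)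
      - rho2Formula K γ (noiseProj e) (pinvV σ μ e) (Δ i)
        (dProj M ω fun k => ((ωhat i k - ω k : ℝ) : ℂ))) =O[l] fun i => ε i ^ 3 := by
  have hu := isUnit_det_gram hω hKM.le
  have hPA := projA_eq_signalProj hω hKM.le hS he
  have hmodel := isPinvSystem hK hω hKM.le hS he
  have hRH := dataCov_isHermitian (M := M) hS ω σ
  set R := dataCov M ω S σ with hR
  set P := signalProj e with hP
  have hQ : noiseProj e = 1 - P := rfl
  set Q := noiseProj e with hQdef
  set W := pinvV σ μ e with hW
  set D : ι → Matrix (Fin M) (Fin M) ℂ := fun i => dProj M ω fun k => ((ωhat i k - ω k : ℝ) : ℂ)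
    with hD
  have hvec : (fun i => ωhat i - ω) =O[l] ε := isBigO_pi.2 hωhat
  have hvec0 : Tendsto (fun i => ωhat i - ω) l (𝓝 0) := hvec.trans_tendsto hε
  have hE : (fun i => projA M (ωhat i) - P - D i) =O[l] fun i => ε i ^ 2 := by
    refine isBigO_matrix_iff.2 fun m n => ?_
    have h1 := (isBigO_projA_sub hu m n).comp_tendsto hvec0
    have h2 : (fun i => ‖ωhat i - ω‖ ^ 2) =O[l] fun i => ε i ^ 2 := hvec.norm_left.pow 2
    refine (h1.trans h2).congr_left fun i => ?_
    simp only [Function.comp, add_sub_cancel, hPA]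
    rfl
  have hDε : D =O[l] ε := by
    refine isBigO_matrix_iff.2 fun m n => ?_
    simp only [hD, dProj, Matrix.sum_apply, Matrix.smul_apply, smul_eq_mul]
    refine IsBigO.fun_sum fun k _ => ?_
    have h1 : (fun i => ((ωhat i k - ω k : ℝ) : ℂ)) =O[l] ε := by
      rw [← isBigO_norm_left]
      simpa only [Complex.norm_real] using (hωhat k).norm_left
    simpa only [mul_comm] using h1.const_mul_left (partialProjA M ω k m n)
  have hε2 : (fun i => ε i ^ 2) =O[l] ε := by
    have h1 : (fun i => ε i * ε i) =O[l] fun i => (1 : ℝ) * ε i :=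
      (hε.isBigO_one ℝ).mul (isBigO_refl ε l)
    simpa [sq] using h1
  set F : ι → Matrix (Fin M) (Fin M) ℂ := fun i => projA M (ωhat i) - P with hF
  have hFε : F =O[l] ε := by
    refine ((hE.trans hε2).add hDε).congr_left fun i => ?_
    simp only [hF]; abel
  have hF1 : F =O[l] fun _ => (1 : ℝ) := hFε.trans (hε.isBigO_one ℝ)
  -- The cross term has no zeroth-order part, because R leaves the signal space invariant.
  have hPRQ : P * R * Q = 0 := by
    rw [hR, dataCov_eq, hQ, Matrix.mul_add, hmodel.PV, Matrix.add_mul, Matrix.mul_sub, hmodel.VP]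
    simp [Matrix.mul_sub, hmodel.PP]
  have h1Q : 1 - Q = P := by rw [hQ]; abel
  -- the cross term agrees with its first order part up to second order
  have hT : (fun i => crossTerm (R + Δ i) (projA M (ωhat i)) - crossTermFirstOrder R Q (Δ i) (D i))
      =O[l] fun i => ε i ^ 2 := by
    have hFF : (fun i => F i * (R * F i)) =O[l] fun i => ε i ^ 2 := by
      simpa only [sq] using hFε.mul (isBigO_const_mul_matrix R hFε)
    have hΔF : (fun i => Δ i * F i) =O[l] fun i => ε i ^ 2 := by
      simpa only [sq] using hΔε.mul hFε
    have hFΔ : (fun i => F i * Δ i) =O[l] fun i => ε i ^ 2 := by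
      simpa only [sq] using hFε.mul hΔε
    have hFΔF : (fun i => F i * (Δ i * F i)) =O[l] fun i => ε i ^ 2 := by
      simpa only [one_mul] using hF1.mul hΔF
    have hall := ((((isBigO_const_mul_matrix (P * R) hE).neg_left.add
      (isBigO_mul_const_matrix hE (R * Q))).sub (isBigO_const_mul_matrix P hΔF)).add
      (isBigO_mul_const_matrix hFΔ Q)).sub (hFF.add hFΔF)
    refine hall.congr_left fun i => ?_
    have hi : projA M (ωhat i) = P + F i := by simp only [hF]; abel
    have hEi : projA M (ωhat i) - P - D i = F i - D i := rfl
    have hcomp : (1 : Matrix (Fin M) (Fin M) ℂ) - (P + F i) = Q - F i := by rw [hQ]; abel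
    rw [hEi, crossTerm, crossTermFirstOrder, h1Q, hi, hcomp]
    have hexp : (P + F i) * (R + Δ i) * (Q - F i) = P * R * Q + P * Δ i * Q - P * R * F i
        - P * (Δ i * F i) + F i * (R * Q) + F i * Δ i * Q - F i * (R * F i)
        - F i * (Δ i * F i) := by
      noncomm_ring
    rw [hexp, hPRQ]
    noncomm_ring
  set T : ι → Matrix (Fin M) (Fin M) ℂ := fun i => crossTerm (R + Δ i) (projA M (ωhat i)) with hTd
  set T₁ : ι → Matrix (Fin M) (Fin M) ℂ := fun i => crossTermFirstOrder R Q (Δ i) (D i) with hT₁d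
  have hTH : (fun i => (T i)ᴴ - (T₁ i)ᴴ) =O[l] fun i => ε i ^ 2 := by
    rw [← isBigO_norm_left] at hT ⊢
    refine hT.congr_left fun i => ?_
    rw [← conjTranspose_sub, frobenius_norm_conjTranspose]
  have hT₁ε : T₁ =O[l] ε := by
    refine (((isBigO_const_mul_matrix (P * R) hDε).neg_left.add
      (isBigO_mul_const_matrix (isBigO_const_mul_matrix P hΔε) Q)).add
      (isBigO_mul_const_matrix hDε (R * Q))).congr_left fun i => ?_
    simp only [hT₁d, crossTermFirstOrder, h1Q, Matrix.mul_assoc]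
  have hT₁Hε : (fun i => (T₁ i)ᴴ) =O[l] ε := by
    rw [← isBigO_norm_left] at hT₁ε ⊢
    simpa only [frobenius_norm_conjTranspose] using hT₁ε
  set Δ₁ : ι → Matrix (Fin M) (Fin M) ℂ := fun i => Δ i - (γ : ℂ) • (T₁ i + (T₁ i)ᴴ) with hΔ₁
  set Δ₂ : ι → Matrix (Fin M) (Fin M) ℂ := fun i => Δ i - (γ : ℂ) • (T i + (T i)ᴴ) with hΔ₂
  have hΔ₁ε : Δ₁ =O[l] ε := hΔε.sub ((hT₁ε.add hT₁Hε).const_smul_left (γ : ℂ))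
  have hdiff : (fun i => Δ₂ i - Δ₁ i) =O[l] fun i => ε i ^ 2 := by
    refine ((hT.add hTH).const_smul_left (-(γ : ℂ))).congr_left fun i => ?_
    simp only [hΔ₁, hΔ₂, Pi.smul_apply]
    module
  have hΔ₂ε : Δ₂ =O[l] ε := by
    refine ((hdiff.trans hε2).add hΔ₁ε).congr_left fun i => ?_
    abel
  have hΔ₂H : ∀ᶠ i in l, (Δ₂ i).IsHermitian := hΔ.mono fun i hi => by
    refine hi.sub ?_
    rw [IsHermitian, conjTranspose_smul, conjTranspose_add, conjTranspose_conjTranspose, add_comm]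
    simp
  have he₂' : ∀ᶠ i in l, IsSignalEigensystem (R + Δ₂ i) (μ₂ i) (e₂ i) := he₂.mono fun i hi => by
    have : R + Δ₂ i = modifiedCov γ (R + Δ i) (projA M (ωhat i)) := by
      simp only [hΔ₂, modifiedCov, hTd]; abel
    rw [this]; exact hi
  have hleak := isBigO_subspaceLeakage hmodel he.trace_signalProj (dataCov_eq ω S σ) hRH hΔ₂H hΔ₂ε
    he₂'
  -- The modified covariance is R plus a first-order Hermitian perturbation, so the first-step
  -- leakage expansion applies to it. The true T is then exchanged for its linear part.
  have hrho := isBigO_rho1_sub (K := K) (Q := 1 - P) (W := W) hΔ₂ε hΔ₁ε hdiff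
  refine (hleak.add hrho).congr' ?_ EventuallyEq.rfl
  filter_upwards [hΔ] with i hi
  have hDH : (D i).IsHermitian := dProj_isHermitian hu fun k => by
    rw [Complex.star_def, Complex.conj_ofReal]
  have hQDQ : Q * D i * Q = 0 := by
    rw [hQ, ← hPA]; exact compl_mul_dProj_mul_compl hu _
  have := rho2_eq_rho2Formula (K := K) hmodel (dataCov_eq ω S σ) hi hDH hQ hQDQ γ
  rw [← this, rho2, hQ]
  simp only [hΔ₁, hT₁d, hQ]
  abel

end RootMusic

/-! ### From filter asymptotics to explicit uniform constants. -/

section Uniformity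

open Asymptotics Metric
open scoped Matrix.Norms.Frobenius

/-- The index i can carry a perturbation together with a choice of eigenvectors and estimates, and
the filter only asks that the perturbation be small. An eventual statement is therefore uniform over
all those choices. -/
lemma exists_forall_of_eventually_entry {M : ℕ} {α : Type*} {Δ : α → Matrix (Fin M) (Fin M) ℂ}
    {s : Set α} {p : α → Prop}
    (h : ∀ᶠ i in comap (fun i => ‖Δ i‖) (𝓝 0) ⊓ 𝓟 s, p i) :
    ∃ δ > 0, ∀ ε ≤ δ, ∀ i ∈ s, (∀ a b, ‖Δ i a b‖ ≤ ε) → p i := by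
  rw [eventually_inf_principal, eventually_comap] at h
  obtain ⟨δ, hδ, h⟩ := Metric.eventually_nhds_iff.1 h
  refine ⟨δ / ((M : ℝ) * M + 1), by positivity, fun ε hε i hi hent => ?_⟩
  refine h ?_ i rfl hi
  rw [Real.dist_eq, sub_zero, abs_norm]
  have h1 : ‖Δ i‖ ≤ (M : ℝ) * M * ε := by
    refine (norm_le_sum_norm_entry _).trans
      ((Finset.sum_le_sum fun a _ => Finset.sum_le_sum fun b _ => hent a b).trans_eq ?_)
    simp [mul_assoc]
  have h2 : (M : ℝ) * M * ε ≤ (M : ℝ) * M * (δ / ((M : ℝ) * M + 1)) := by gcongr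
  refine (h1.trans h2).trans_lt ?_
  rw [← mul_div_assoc, div_lt_iff₀ (by positivity)]
  nlinarith

lemma exists_bound_of_isBigO_entry {M : ℕ} (hM : 0 < M) {α F : Type*} [SeminormedAddCommGroup F]
    {Δ : α → Matrix (Fin M) (Fin M) ℂ} {s : Set α} {f : α → F} {k : ℕ}
    (h : f =O[comap (fun i => ‖Δ i‖) (𝓝 0) ⊓ 𝓟 s] fun i => ‖Δ i‖ ^ k) :
    ∃ C δ : ℝ, 0 ≤ C ∧ 0 < δ ∧ ∀ ε ≤ δ, ∀ i ∈ s, (∀ a b, ‖Δ i a b‖ ≤ ε) →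
      ‖f i‖ ≤ C * ε ^ k := by
  obtain ⟨C, hC, h⟩ := h.exists_pos
  obtain ⟨δ, hδ, h⟩ := exists_forall_of_eventually_entry h.bound
  refine ⟨C * ((M : ℝ) * M) ^ k, δ, by positivity, hδ, fun ε hε i hi hent => ?_⟩
  refine (h ε hε i hi hent).trans ?_
  have hε0 : 0 ≤ ε := (norm_nonneg _).trans (hent ⟨0, hM⟩ ⟨0, hM⟩)
  have h1 : ‖Δ i‖ ≤ (M : ℝ) * M * ε := by
    refine (norm_le_sum_norm_entry _).trans
      ((Finset.sum_le_sum fun a _ => Finset.sum_le_sum fun b _ => hent a b).trans_eq ?_)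
    simp [mul_assoc]
  rw [norm_pow, norm_norm, mul_assoc, ← mul_pow]
  gcongr

end Uniformity

/-! ### The uniform expansion of the two-step method. -/

section TwoStep

open Asymptotics Metric
open scoped Matrix.Norms.Frobenius

variable {M K : ℕ} {ω : Fin K → ℝ} {S : Matrix (Fin K) (Fin K) ℂ} {σ : ℝ} {μ : Fin K → ℝ}
  {e : Fin K → Fin M → ℂ}

lemma strictMono_electricalAngle {d lam : ℝ} (hd : 0 < d) (hlam : 0 < lam) {θ : Fin K → ℝ}
    (hθ : Monotone θ) (hθ_mem : ∀ k, θ k ∈ Set.Icc (-(Real.pi / 2)) (Real.pi / 2))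
    (hθ_inj : Function.Injective fun k => steering M (electricalAngle d lam (θ k))) :
    StrictMono fun k => electricalAngle d lam (θ k) := by
  have hinj : Function.Injective θ := fun a b hab => hθ_inj (by simp only [hab])
  intro a b hab
  have := Real.pi_pos
  exact mul_lt_mul_of_pos_left
    (Real.strictMonoOn_sin (hθ_mem a) (hθ_mem b) (hθ.strictMono_of_injective hinj hab))
    (by positivity)

lemma abs_sin_lt_one {x : ℝ} (hx : x ∈ Set.Ioo (-(Real.pi / 2)) (Real.pi / 2)) :
    |Real.sin x| < 1 := by
  rw [abs_lt]
  have h1 := Real.cos_pos_of_mem_Ioo hx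
  have h2 := Real.sin_sq_add_cos_sq x
  constructor <;> nlinarith

lemma electricalAngle_mem_Ioo {d lam x : ℝ} (hd : 0 < d) (hlam : 0 < lam) (hdlam : d ≤ lam / 2)
    (hx : x ∈ Set.Ioo (-(Real.pi / 2)) (Real.pi / 2)) :
    electricalAngle d lam x ∈ Set.Ioo (-Real.pi) Real.pi := by
  rw [Set.mem_Ioo, ← abs_lt, electricalAngle, abs_mul]
  have hpi := Real.pi_pos
  rw [abs_of_pos (by positivity : 0 < 2 * Real.pi * (d / lam))]
  have h1 : d / lam ≤ 1 / 2 := by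
    rw [div_le_iff₀ hlam]; linarith
  have h2 := abs_sin_lt_one hx
  calc 2 * Real.pi * (d / lam) * |Real.sin x| < 2 * Real.pi * (d / lam) * 1 := by gcongr
    _ ≤ 2 * Real.pi * (1 / 2) * 1 := by gcongr
    _ = Real.pi := by ring

/-- Root-MUSIC estimates exist when the roots near the true ones are the closest roots. -/
lemma exists_isRootMusicEstimate {R : Matrix (Fin M) (Fin M) ℂ} {μ₁ : Fin K → ℝ}
    {e₁ : Fin K → Fin M → ℂ} (he₁ : IsSignalEigensystem R μ₁ e₁) {d lam ρ : ℝ} (hd : 0 < d)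
    (hlam : 0 < lam) (hρ : ∀ k, (|ω k| + ρ) * (lam / (2 * Real.pi * d)) < 1) {T : Fin K → ℂ}
    (hT : ∀ k, T k ∈ ball (ω k : ℂ) ρ) (hmono : StrictMono fun k => (T k).re)
    (harg : ∀ k, Complex.arg (Complex.exp (Complex.I * T k)) = (T k).re)
    (hclose : IsClosestRoots (noiseProj e₁) fun k => Complex.exp (Complex.I * T k)) :
    ∃ θhat : Fin K → ℝ, IsRootMusicEstimate d lam R θhat := by
  have hpi := Real.pi_pos
  have hc : 0 < lam / (2 * Real.pi * d) := by positivity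
  have hbound : ∀ k, |(T k).re * (lam / (2 * Real.pi * d))| ≤ 1 := fun k => by
    rw [abs_mul, abs_of_pos hc]
    refine le_trans ?_ (hρ k).le
    gcongr
    have h1 : |(T k).re - ω k| < ρ := by
      have h2 := Complex.abs_re_le_norm (T k - ω k)
      rw [Complex.sub_re, Complex.ofReal_re] at h2
      exact h2.trans_lt (mem_ball_iff_norm.1 (hT k))
    have h3 := abs_add_le (ω k) ((T k).re - ω k)
    rw [add_sub_cancel] at h3
    linarith
  refine ⟨fun k => Real.arcsin ((T k).re * (lam / (2 * Real.pi * d))), μ₁, e₁, _, he₁, hclose.1,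
    hclose.2.1, hclose.2.2, fun k => ⟨Real.arcsin_mem_Icc _, ?_⟩, fun a b hab => ?_⟩
  · rw [Real.sin_arcsin (abs_le.1 (hbound k)).1 (abs_le.1 (hbound k)).2, harg]
  · exact Real.monotone_arcsin (mul_le_mul_of_nonneg_right (hmono.monotone hab) hc.le)

/-- The subspace leakages of the two steps and the errors of root-MUSIC to leading order. -/
lemma twoStep_expansion (hK : 0 < K) (hKM : K < M) {d lam : ℝ} (hd : 0 < d) (hlam : 0 < lam)
    (hdlam : d ≤ lam / 2) {θ : Fin K → ℝ}
    (hω_def : ω = fun k => electricalAngle d lam (θ k))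
    (hω : Function.Injective fun k => steering M (ω k))
    (hmono : StrictMono ω) (hS : S.PosDef) (he : IsSignalEigensystem (dataCov M ω S σ) μ e)
    (hθ : ∀ k, θ k ∈ Set.Ioo (-(Real.pi / 2)) (Real.pi / 2)) (γ : ℝ) :
    ∃ C δ : ℝ, 0 < δ ∧ ∀ ε ≤ δ, ∀ ΔR : Matrix (Fin M) (Fin M) ℂ,
      ΔR.IsHermitian → (∀ i j, ‖ΔR i j‖ ≤ ε) →
      (∃ θhat : Fin K → ℝ, IsRootMusicEstimate d lam (dataCov M ω S σ + ΔR) θhat) ∧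
      (∀ (μ₁ : Fin K → ℝ) (e₁ : Fin K → Fin M → ℂ),
        IsSignalEigensystem (dataCov M ω S σ + ΔR) μ₁ e₁ →
        ‖(subspaceLeakage (noiseProj e) e₁ : ℂ) - rho1 K (noiseProj e) (pinvV σ μ e) ΔR‖
          ≤ C * ε ^ 3) ∧
      ∀ θhat : Fin K → ℝ, IsRootMusicEstimate d lam (dataCov M ω S σ + ΔR) θhat →
        (∀ k, ‖((electricalAngle d lam (θhat k) - ω k : ℝ) : ℂ)
          - freqError M ω (noiseProj e) (pinvV σ μ e) ΔR k‖ ≤ C * ε ^ 2) ∧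
        ∀ (μ₂ : Fin K → ℝ) (e₂ : Fin K → Fin M → ℂ),
          IsSignalEigensystem (modifiedCov γ (dataCov M ω S σ + ΔR)
            (projA M fun k => electricalAngle d lam (θhat k))) μ₂ e₂ →
          ‖(subspaceLeakage (noiseProj e) e₂ : ℂ) - rho2Formula K γ (noiseProj e) (pinvV σ μ e) ΔR
            (dProj M ω fun k => ((electricalAngle d lam (θhat k) - ω k : ℝ) : ℂ))‖
              ≤ C * ε ^ 3 := by
  have hM : 0 < M := hK.trans hKM
  have hmem : ∀ k, ω k ∈ Set.Ioo (-Real.pi) Real.pi := fun k => by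
    rw [hω_def]; exact electricalAngle_mem_Ioo hd hlam hdlam (hθ k)
  have hpi := Real.pi_pos
  -- Since |sin θ_k| < 1, the angles have room to move by ρ with the argument of the inverse sine
  -- kept in [−1, 1]. This uses that no source is at endfire.
  obtain ⟨ρ, hρ, hρ0⟩ : ∃ ρ : ℝ, (∀ k, (|ω k| + ρ) * (lam / (2 * Real.pi * d)) < 1) ∧ 0 < ρ := by
    have h1 : ∀ᶠ ρ : ℝ in 𝓝 0, ∀ k, (|ω k| + ρ) * (lam / (2 * Real.pi * d)) < 1 := by
      refine eventually_all.2 fun k => ?_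
      refine ContinuousAt.eventually_lt (by fun_prop) continuousAt_const ?_
      have h2 : (|ω k| + 0) * (lam / (2 * Real.pi * d)) = |Real.sin (θ k)| := by
        rw [hω_def]
        simp only [electricalAngle]
        rw [abs_mul, abs_of_pos (by positivity : 0 < 2 * Real.pi * (d / lam))]
        field_simp
        ring
      rw [h2]; exact abs_sin_lt_one (hθ k)
    exact ((h1.filter_mono nhdsWithin_le_nhds).and self_mem_nhdsWithin).exists (f := 𝓝[>] 0)
  have hlim : ∀ {α : Type} (Δ : α → Matrix (Fin M) (Fin M) ℂ) (s : Set α),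
      Tendsto (fun i => ‖Δ i‖) (comap (fun i => ‖Δ i‖) (𝓝 0) ⊓ 𝓟 s) (𝓝 0) :=
    fun Δ s => tendsto_comap.mono_left inf_le_left
  have hbig : ∀ {α : Type} (Δ : α → Matrix (Fin M) (Fin M) ℂ) (l : Filter α),
      Δ =O[l] fun i => ‖Δ i‖ := fun Δ l => (isBigO_refl Δ l).norm_right
  -- existence of estimates and the first step
  let s₁ : Set (Matrix (Fin M) (Fin M) ℂ × (Fin K → ℝ) × (Fin K → Fin M → ℂ)) :=
    {p | p.1.IsHermitian ∧ IsSignalEigensystem (dataCov M ω S σ + p.1) p.2.1 p.2.2}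
  have hs₁ : ∀ᶠ p in comap (fun p => ‖Prod.fst p‖) (𝓝 0) ⊓ 𝓟 s₁, p ∈ s₁ :=
    mem_inf_of_right (mem_principal_self _)
  -- Perturbations are indexed jointly with an eigensystem, so that the threshold does not depend on
  -- which eigenvectors are chosen.
  obtain ⟨δ₀, hδ₀, h₀⟩ := exists_forall_of_eventually_entry (Δ := Prod.fst) (s := s₁)
    (p := fun p => ∃ θhat : Fin K → ℝ, IsRootMusicEstimate d lam (dataCov M ω S σ + p.1) θhat) (by
      filter_upwards [hs₁, (tendsto_noiseProj hK hω hKM hS he (hlim _ _)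
        (hs₁.mono fun p hp => hp.1) (hbig _ _) (hs₁.mono fun p hp => hp.2)).eventually
          (eventually_closestRoots_noiseProj hω hKM hS he hmono hmem hρ0)] with p hp hroots
      obtain ⟨T, hT, hTm, harg, hclose, -⟩ := hroots (isOrthProj_noiseProj hp.2)
      exact exists_isRootMusicEstimate hp.2 hd hlam hρ (fun k => (hT k).1) hTm harg hclose)
  obtain ⟨C₁, δ₁, hC₁, hδ₁, h₁⟩ := exists_bound_of_isBigO_entry hM (isBigO_subspaceLeakage
    (isPinvSystem hK hω hKM.le hS he) he.trace_signalProj (dataCov_eq ω S σ)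
    (dataCov_isHermitian hS ω σ) (hs₁.mono fun p hp => hp.1) (hbig _ _)
    (hs₁.mono fun p hp => hp.2))
  -- the errors of root-MUSIC
  let s₂ : Set (Matrix (Fin M) (Fin M) ℂ × (Fin K → ℝ)) :=
    {p | p.1.IsHermitian ∧ IsRootMusicEstimate d lam (dataCov M ω S σ + p.1) p.2}
  have hs₂ : ∀ᶠ p in comap (fun p => ‖Prod.fst p‖) (𝓝 0) ⊓ 𝓟 s₂, p ∈ s₂ :=
    mem_inf_of_right (mem_principal_self _)
  obtain ⟨C₂, δ₂, hC₂, hδ₂, h₂⟩ := exists_bound_of_isBigO_entry hM (isBigO_pi.2 fun k =>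
    (isBigO_rootMusic hK hω hKM hS he hmono hmem hd hlam (hlim _ _) (hs₂.mono fun p hp => hp.1)
      (hbig _ _) (hs₂.mono fun p hp => hp.2) k).1)
  -- the second step
  let s₃ : Set (Matrix (Fin M) (Fin M) ℂ × (Fin K → ℝ) × (Fin K → ℝ) × (Fin K → Fin M → ℂ)) :=
    {p | p.1.IsHermitian ∧ IsRootMusicEstimate d lam (dataCov M ω S σ + p.1) p.2.1 ∧
      IsSignalEigensystem (modifiedCov γ (dataCov M ω S σ + p.1)
        (projA M fun k => electricalAngle d lam (p.2.1 k))) p.2.2.1 p.2.2.2}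
  have hs₃ : ∀ᶠ p in comap (fun p => ‖Prod.fst p‖) (𝓝 0) ⊓ 𝓟 s₃, p ∈ s₃ :=
    mem_inf_of_right (mem_principal_self _)
  obtain ⟨C₃, δ₃, hC₃, hδ₃, h₃⟩ := exists_bound_of_isBigO_entry hM
    (isBigO_secondStep hK hω hKM hS he (hlim _ _) (hs₃.mono fun p hp => hp.1) (hbig _ _) γ
      (fun k => (isBigO_rootMusic hK hω hKM hS he hmono hmem hd hlam (hlim _ _)
        (hs₃.mono fun p hp => hp.1) (hbig _ _) (hs₃.mono fun p hp => hp.2.1) k).2)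
      (hs₃.mono fun p hp => hp.2.2))
  refine ⟨C₁ + C₂ + C₃, min (min δ₀ δ₁) (min δ₂ δ₃), by positivity, fun ε hε ΔR hΔ hent => ?_⟩
  simp only [le_min_iff] at hε
  have hε0 : 0 ≤ ε := (norm_nonneg _).trans (hent ⟨0, hM⟩ ⟨0, hM⟩)
  refine ⟨?_, fun μ₁ e₁ he₁ => ?_, fun θhat hθhat => ⟨fun k => ?_, fun μ₂ e₂ he₂ => ?_⟩⟩
  · obtain ⟨μ₁, e₁, he₁⟩ := exists_isSignalEigensystem (K := K) hKM.le
      ((dataCov_isHermitian (M := M) hS ω σ).add hΔ)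
    exact h₀ ε hε.1.1 (ΔR, μ₁, e₁) ⟨hΔ, he₁⟩ hent
  · refine (h₁ ε hε.1.2 (ΔR, μ₁, e₁) ⟨hΔ, he₁⟩ hent).trans ?_
    gcongr; linarith
  · refine (norm_le_pi_norm _ k).trans ((h₂ ε hε.2.1 (ΔR, θhat) ⟨hΔ, hθhat⟩ hent).trans ?_)
    gcongr; linarith
  · refine (h₃ ε hε.2.2 (ΔR, θhat, μ₂, e₂) ⟨hΔ, hθhat, he₂⟩ hent).trans ?_
    gcongr; linarith

end TwoStep

/-! ### Second moments of linear combinations. -/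

section SecondMoments

variable {Ω : Type*} [MeasurableSpace Ω] {P : Measure Ω}

lemma integral_sum_mul_sum {ι κ : Type*} [Fintype ι] [Fintype κ] {f : ι → Ω → ℂ} {g : κ → Ω → ℂ}
    (hfg : ∀ i j, Integrable (fun w => f i w * g j w) P) (a : ι → ℂ) (b : κ → ℂ) :
    Integrable (fun w => (∑ i, a i * f i w) * ∑ j, b j * g j w) P ∧
    ∫ w, (∑ i, a i * f i w) * ∑ j, b j * g j w ∂P
      = ∑ i, ∑ j, a i * b j * ∫ w, f i w * g j w ∂P := by
  have h1 : ∀ w, (∑ i, a i * f i w) * ∑ j, b j * g j w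
      = ∑ i, ∑ j, a i * b j * (f i w * g j w) := fun w => by
    rw [Finset.sum_mul_sum]
    exact Finset.sum_congr rfl fun i _ => Finset.sum_congr rfl fun j _ => by ring
  simp only [h1]
  have h2 : ∀ i j, Integrable (fun w => a i * b j * (f i w * g j w)) P :=
    fun i j => (hfg i j).const_mul _
  refine ⟨integrable_finsetSum _ fun i _ => integrable_finsetSum _ fun j _ => h2 i j, ?_⟩
  rw [integral_finsetSum _ fun i _ => integrable_finsetSum _ fun j _ => h2 i j]
  refine Finset.sum_congr rfl fun i _ => ?_
  rw [integral_finsetSum _ fun j _ => h2 i j]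
  exact Finset.sum_congr rfl fun j _ => integral_const_mul _ _

lemma integrable_mul_star {f g : Ω → ℂ} (hf : MemLp f 2 P) (hg : MemLp g 2 P) :
    Integrable (fun w => f w * star (g w)) P := hf.integrable_mul hg.star

end SecondMoments

/-! ### Moments of the circular complex Gaussian law. -/

section ComplexGaussian

instance isGaussian_complexGaussian (v : ℝ) : IsGaussian (complexGaussian v) := by
  have h : (fun p : ℝ × ℝ => (p.1 : ℂ) + (p.2 : ℂ) * Complex.I)
      = Complex.equivRealProdCLM.symm := by
    ext p; rw [Complex.equivRealProdCLM_symm_apply]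
  rw [complexGaussian, h]
  infer_instance

lemma memLp_id_complexGaussian (v : ℝ) : MemLp (fun z : ℂ => z) 2 (complexGaussian v) :=
  IsGaussian.memLp_two_id

lemma integral_sq_gaussianReal (w : NNReal) : ∫ x, (x : ℂ) ^ 2 ∂gaussianReal 0 w = w := by
  have h := variance_id_gaussianReal (μ := 0) (v := w)
  rw [variance_of_integral_eq_zero aemeasurable_id (by simp)] at h
  simp only [id] at h
  have h2 : ∫ x, (x : ℂ) ^ 2 ∂gaussianReal 0 w = ((∫ x, x ^ 2 ∂gaussianReal 0 w : ℝ) : ℂ) := by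
    rw [← integral_complex_ofReal]; simp
  rw [h2, h]

lemma integral_ofReal_gaussianReal (w : NNReal) : ∫ x, (x : ℂ) ∂gaussianReal 0 w = 0 := by
  rw [integral_complex_ofReal]; simp

lemma integrable_pow_mul_pow_gaussianReal (w : NNReal) (a b : ℕ) :
    Integrable (fun p : ℝ × ℝ => (p.1 : ℂ) ^ a * (p.2 : ℂ) ^ b)
      ((gaussianReal 0 w).prod (gaussianReal 0 w)) := by
  have h : ∀ a : ℕ, Integrable (fun x : ℝ => (x : ℂ) ^ a) (gaussianReal 0 w) := fun a => by
    have h1 := (memLp_id_gaussianReal (μ := 0) (v := w) a).integrable_norm_pow'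
    have h2 : AEStronglyMeasurable (fun x : ℝ => (x : ℂ) ^ a) (gaussianReal 0 w) := by fun_prop
    refine (integrable_norm_iff h2).1 (h1.congr ?_)
    filter_upwards with x
    simp
  exact (h a).mul_prod (h b)

lemma integral_pow_mul_pow_gaussianReal (w : NNReal) (a b : ℕ) :
    ∫ p : ℝ × ℝ, (p.1 : ℂ) ^ a * (p.2 : ℂ) ^ b ∂(gaussianReal 0 w).prod (gaussianReal 0 w)
      = (∫ x, (x : ℂ) ^ a ∂gaussianReal 0 w) * ∫ x, (x : ℂ) ^ b ∂gaussianReal 0 w :=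
  integral_prod_mul (fun x : ℝ => (x : ℂ) ^ a) fun x : ℝ => (x : ℂ) ^ b

lemma integral_complexGaussian {f : ℂ → ℂ} (hf : Continuous f) (v : ℝ) :
    ∫ z, f z ∂complexGaussian v = ∫ p : ℝ × ℝ, f ((p.1 : ℂ) + (p.2 : ℂ) * Complex.I)
      ∂(gaussianReal 0 (v / 2).toNNReal).prod (gaussianReal 0 (v / 2).toNNReal) := by
  rw [complexGaussian, integral_map (by fun_prop) hf.aestronglyMeasurable]

lemma integral_id_complexGaussian (v : ℝ) : ∫ z, z ∂complexGaussian v = 0 := by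
  rw [integral_complexGaussian continuous_id']
  set w := (v / 2).toNNReal
  have h1 := integral_pow_mul_pow_gaussianReal w 1 0
  have h2 := integral_pow_mul_pow_gaussianReal w 0 1
  have i1 := integrable_pow_mul_pow_gaussianReal w 1 0
  have i2 := integrable_pow_mul_pow_gaussianReal w 0 1
  simp only [pow_one, pow_zero, mul_one, one_mul, integral_ofReal_gaussianReal, zero_mul,
    mul_zero] at h1 h2 i1 i2
  rw [integral_add i1 (i2.mul_const _), integral_mul_const, h1, h2]
  simp

lemma integral_mul_star_complexGaussian {v : ℝ} (hv : 0 ≤ v) :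
    ∫ z, z * star z ∂complexGaussian v = v := by
  rw [integral_complexGaussian (by fun_prop)]
  have hw : (((v / 2).toNNReal : ℝ) : ℂ) = v / 2 := by
    rw [Real.coe_toNNReal _ (by positivity)]; push_cast; ring
  set w := (v / 2).toNNReal
  have h1 := integral_pow_mul_pow_gaussianReal w 2 0
  have h2 := integral_pow_mul_pow_gaussianReal w 0 2
  have i1 := integrable_pow_mul_pow_gaussianReal w 2 0
  have i2 := integrable_pow_mul_pow_gaussianReal w 0 2
  have hexp : ∀ p : ℝ × ℝ, ((p.1 : ℂ) + (p.2 : ℂ) * Complex.I)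
      * star ((p.1 : ℂ) + (p.2 : ℂ) * Complex.I)
      = (p.1 : ℂ) ^ 2 * (p.2 : ℂ) ^ 0 + (p.1 : ℂ) ^ 0 * (p.2 : ℂ) ^ 2 := fun p => by
    simp only [star_add, star_mul, Complex.star_def, Complex.conj_ofReal, Complex.conj_I]
    linear_combination -(p.2 : ℂ) ^ 2 * Complex.I_sq
  simp only [hexp]
  rw [integral_add i1 i2, h1, h2, integral_sq_gaussianReal]
  simp [hw]

/-- Circularity: the real and imaginary parts have equal variance and are uncorrelated. This makes
the pseudo-covariance terms vanish in the expected leakages. -/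
lemma integral_mul_self_complexGaussian (v : ℝ) : ∫ z, z * z ∂complexGaussian v = 0 := by
  rw [integral_complexGaussian (by fun_prop)]
  set w := (v / 2).toNNReal
  have h1 := integral_pow_mul_pow_gaussianReal w 2 0
  have h2 := integral_pow_mul_pow_gaussianReal w 0 2
  have h3 := integral_pow_mul_pow_gaussianReal w 1 1
  have i1 := integrable_pow_mul_pow_gaussianReal w 2 0
  have i2 := integrable_pow_mul_pow_gaussianReal w 0 2
  have i3 := integrable_pow_mul_pow_gaussianReal w 1 1
  have hexp : ∀ p : ℝ × ℝ, ((p.1 : ℂ) + (p.2 : ℂ) * Complex.I)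
      * ((p.1 : ℂ) + (p.2 : ℂ) * Complex.I)
      = ((p.1 : ℂ) ^ 2 * (p.2 : ℂ) ^ 0 - (p.1 : ℂ) ^ 0 * (p.2 : ℂ) ^ 2)
        + 2 * Complex.I * ((p.1 : ℂ) ^ 1 * (p.2 : ℂ) ^ 1) := fun p => by
    linear_combination (p.2 : ℂ) ^ 2 * Complex.I_sq
  simp only [hexp]
  have i12 : Integrable (fun p : ℝ × ℝ => (p.1 : ℂ) ^ 2 * (p.2 : ℂ) ^ 0
      - (p.1 : ℂ) ^ 0 * (p.2 : ℂ) ^ 2) ((gaussianReal 0 w).prod (gaussianReal 0 w)) := i1.sub i2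
  rw [integral_add i12 (i3.const_mul _), integral_sub i1 i2, integral_const_mul, h1, h2,
    h3]
  simp [integral_ofReal_gaussianReal]

end ComplexGaussian

/-! ### Circular white noise: uncorrelated linear images are independent. -/

section WhiteNoise

variable {Ω : Type*} [MeasurableSpace Ω] {P : Measure Ω} {ι κ κ' : Type*}

/-- Circular white noise of variance `v`, up to second moments. -/
structure IsWhite [DecidableEq ι] (n : ι → Ω → ℂ) (v : ℂ) (P : Measure Ω) : Prop where
  memLp : ∀ i, MemLp (n i) 2 P
  mean : ∀ i, ∫ w, n i w ∂P = 0
  mul_star : ∀ i j, ∫ w, n i w * star (n j w) ∂P = if i = j then v else 0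
  mul_self : ∀ i j, ∫ w, n i w * n j w ∂P = 0

lemma isWhite_of_iIndepFun [DecidableEq ι] [IsProbabilityMeasure P] {n : ι → Ω → ℂ}
    (hm : ∀ i, Measurable (n i)) {v : ℝ} (hv : 0 ≤ v)
    (hlaw : ∀ i, P.map (n i) = complexGaussian v) (hind : iIndepFun n P) :
    IsWhite n v P := by
  have hint : ∀ i {f : ℂ → ℂ}, Continuous f → ∫ w, f (n i w) ∂P = ∫ z, f z ∂complexGaussian v :=
    fun i f hf => by
      rw [← hlaw i, integral_map (hm i).aemeasurable hf.aestronglyMeasurable]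
  have hmean : ∀ i, ∫ w, n i w ∂P = 0 := fun i => by
    rw [hint i continuous_id', integral_id_complexGaussian]
  refine ⟨fun i => ?_, hmean, fun i j => ?_, fun i j => ?_⟩
  · have h := memLp_id_complexGaussian v
    rw [← hlaw i] at h
    exact (memLp_map_measure_iff h.aestronglyMeasurable (hm i).aemeasurable).1 h
  · split_ifs with hij
    · subst hij
      rw [hint i (f := fun z => z * star z) (by fun_prop), integral_mul_star_complexGaussian hv]
    · rw [(hind.indepFun hij).integral_fun_comp_mul_comp (f := fun z => z) (g := fun z => star z)
        (hm i).aemeasurable (hm j).aemeasurable continuous_id'.aestronglyMeasurable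
        continuous_star.aestronglyMeasurable, hmean, zero_mul]
  · by_cases hij : i = j
    · subst hij
      rw [hint i (f := fun z => z * z) (by fun_prop), integral_mul_self_complexGaussian]
    · rw [(hind.indepFun hij).integral_fun_comp_mul_comp (f := fun z => z) (g := fun z => z)
        (hm i).aemeasurable (hm j).aemeasurable continuous_id'.aestronglyMeasurable
        continuous_id'.aestronglyMeasurable, hmean, zero_mul]

variable [Fintype ι] [DecidableEq ι] {n : ι → Ω → ℂ} {v : ℂ}

lemma IsWhite.integral_linear_mul_star (h : IsWhite n v P) (a b : ι → ℂ) :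
    ∫ w, (∑ i, a i * n i w) * star (∑ i, b i * n i w) ∂P = v * ∑ i, a i * star (b i) := by
  simp only [star_sum, star_mul']
  rw [(integral_sum_mul_sum (fun i j => integrable_mul_star (h.memLp i) (h.memLp j)) a
    fun i => star (b i)).2]
  simp only [h.mul_star, mul_ite, mul_zero, Finset.sum_ite_eq, Finset.mem_univ, if_true,
    Finset.mul_sum]
  exact Finset.sum_congr rfl fun i _ => by ring

lemma IsWhite.integral_linear_mul_linear (h : IsWhite n v P) (a b : ι → ℂ) :
    ∫ w, (∑ i, a i * n i w) * (∑ i, b i * n i w) ∂P = 0 := by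
  rw [(integral_sum_mul_sum (fun i j => (h.memLp i).integrable_mul (h.memLp j)) a b).2]
  simp [h.mul_self]

lemma IsWhite.memLp_linear (h : IsWhite n v P) (a : ι → ℂ) :
    MemLp (fun w => ∑ i, a i * n i w) 2 P :=
  memLp_finsetSum _ fun i _ => (h.memLp i).const_mul _

lemma IsWhite.integral_linear [IsProbabilityMeasure P] (h : IsWhite n v P) (a : ι → ℂ) :
    ∫ w, ∑ i, a i * n i w ∂P = 0 := by
  rw [integral_finsetSum _ fun i _ => ((h.memLp i).integrable one_le_two).const_mul _]
  simp [integral_const_mul, h.mean]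

/-- Re u · Re v = Re(u v + u v̄)/2. The first mean vanishes by circularity, and the second by
orthogonality of the coefficients. -/
lemma IsWhite.covariance_re [IsProbabilityMeasure P] (h : IsWhite n v P) {a b : ι → ℂ}
    (hab : ∑ i, a i * star (b i) = 0) :
    cov[fun w => (∑ i, a i * n i w).re, fun w => (∑ i, b i * n i w).re; P] = 0 := by
  have ha := h.memLp_linear a
  have hb := h.memLp_linear b
  have i1 : Integrable (fun w => (∑ i, a i * n i w) * ∑ i, b i * n i w) P := ha.integrable_mul hb
  have i2 := integrable_mul_star ha hb
  have hre : ∀ {f : Ω → ℂ}, Integrable f P → ∫ w, f w ∂P = 0 → ∫ w, (f w).re ∂P = 0 :=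
    fun hf h0 => by
      have h1 := integral_re hf
      rw [h0] at h1
      simpa using h1
  have h1 := hre i1 (h.integral_linear_mul_linear a b)
  have h2 := hre i2 (by rw [h.integral_linear_mul_star, hab, mul_zero])
  refine (covariance_eq_sub ha.re hb.re).trans ?_
  have hmean : P[fun w => RCLike.re (∑ i, a i * n i w)] = 0 :=
    hre (ha.integrable one_le_two) (h.integral_linear a)
  rw [hmean, zero_mul, sub_zero]
  have h3 : ∀ w, ((fun w => RCLike.re (∑ i, a i * n i w)) *
      fun w => RCLike.re (∑ i, b i * n i w)) w
      = (((∑ i, a i * n i w) * ∑ i, b i * n i w).re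
        + ((∑ i, a i * n i w) * star (∑ i, b i * n i w)).re) / 2 := fun w => by
    simp only [Pi.mul_apply, RCLike.re_to_complex, Complex.mul_re, Complex.star_def,
      Complex.conj_re, Complex.conj_im]
    ring
  simp only [h3]
  have i3 : Integrable (fun w => ((∑ i, a i * n i w) * ∑ i, b i * n i w).re) P := i1.re
  have i4 : Integrable (fun w => ((∑ i, a i * n i w) * star (∑ i, b i * n i w)).re) P := i2.re
  rw [integral_div, integral_add i3 i4, h1, h2, add_zero, zero_div]

/-- Every real-linear functional is the real part of a complex-linear one. The covariances in the
Gaussian independence criterion thus reduce to `IsWhite.covariance_re`. -/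
lemma exists_strongDual_mulVec_eq {ι κ : Type*} [Fintype ι] [Fintype κ] (L : Matrix κ ι ℂ)
    (f : StrongDual ℝ (κ → ℂ)) :
    ∃ c : κ → ℂ, ∀ x, f (L *ᵥ x) = (∑ i, (c ᵥ* L) i * x i).re := by
  classical
  let g : Module.Dual ℂ (κ → ℂ) := Module.Dual.extendRCLike (𝕜 := ℂ) (f : (κ → ℂ) →ₗ[ℝ] ℝ)
  refine ⟨fun k => g (Pi.single k 1), fun x => ?_⟩
  have h1 : g (L *ᵥ x) = (fun k => g (Pi.single k 1)) ⬝ᵥ (L *ᵥ x) := by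
    rw [LinearMap.pi_apply_eq_sum_univ g (L *ᵥ x), dotProduct]
    refine Finset.sum_congr rfl fun k _ => ?_
    rw [smul_eq_mul, mul_comm]
    congr 2
    ext j
    simp [Pi.single_apply, eq_comm]
  have h2 : f (L *ᵥ x) = (g (L *ᵥ x)).re :=
    (Module.Dual.re_extendRCLike_apply (𝕜 := ℂ) (f : (κ → ℂ) →ₗ[ℝ] ℝ) (L *ᵥ x)).symm
  rw [h2, h1, dotProduct_mulVec]
  rfl

/-- Linear images of Gaussian white noise under matrices with orthogonal rows are independent. -/
lemma IsWhite.indepFun_mulVec [Fintype κ] [Fintype κ'] [IsProbabilityMeasure P]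
    (h : IsWhite n v P) (hg : HasGaussianLaw (fun w i => n i w) P) {L : Matrix κ ι ℂ}
    {L' : Matrix κ' ι ℂ} (hL : L * L'ᴴ = 0) :
    IndepFun (fun w => L *ᵥ fun i => n i w) (fun w => L' *ᵥ fun i => n i w) P := by
  classical
  let F : (ι → ℂ) →L[ℝ] (κ → ℂ) := LinearMap.toContinuousLinearMap (L.mulVecLin.restrictScalars ℝ)
  let F' : (ι → ℂ) →L[ℝ] (κ' → ℂ) :=
    LinearMap.toContinuousLinearMap (L'.mulVecLin.restrictScalars ℝ)
  refine HasGaussianLaw.indepFun_of_covariance_strongDual (hg.map_fun (F.prod F')) fun f f' => ?_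
  obtain ⟨c, hc⟩ := exists_strongDual_mulVec_eq L f
  obtain ⟨c', hc'⟩ := exists_strongDual_mulVec_eq L' f'
  have h1 : (f ∘ fun w => L *ᵥ fun i => n i w) = fun w => (∑ i, (c ᵥ* L) i * n i w).re :=
    funext fun w => hc _
  have h2 : (f' ∘ fun w => L' *ᵥ fun i => n i w) = fun w => (∑ i, (c' ᵥ* L') i * n i w).re :=
    funext fun w => hc' _
  rw [h1, h2]
  refine h.covariance_re ?_
  change (c ᵥ* L) ⬝ᵥ star (c' ᵥ* L') = 0
  rw [star_vecMul, dotProduct_mulVec, vecMul_vecMul, hL, vecMul_zero, zero_dotProduct]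

end WhiteNoise

/-! ### Moments of a sum of outer products with independent factors. -/

section CrossMoments

variable {Ω : Type*} [MeasurableSpace Ω] {P : Measure Ω}

/-- The hypotheses make the joint law of s, X, Z a triple product measure, which is then regrouped
with X on its own. -/
lemma indepFun_prodMk_of_indepFun [IsProbabilityMeasure P] {α β γ : Type*} [MeasurableSpace α]
    [MeasurableSpace β] [MeasurableSpace γ] {X : Ω → α} {s : Ω → β} {Z : Ω → γ}
    (hX : Measurable X) (hs : Measurable s) (hZ : Measurable Z)
    (h₁ : IndepFun s (fun w => (X w, Z w)) P) (h₂ : IndepFun X Z P) :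
    IndepFun X (fun w => (s w, Z w)) P := by
  have := Measure.isProbabilityMeasure_map (μ := P) hX.aemeasurable
  have := Measure.isProbabilityMeasure_map (μ := P) hs.aemeasurable
  have := Measure.isProbabilityMeasure_map (μ := P) hZ.aemeasurable
  have hsZ : IndepFun s Z P := h₁.comp measurable_id measurable_snd
  rw [indepFun_iff_map_prod_eq_prod_map_map (by fun_prop) (by fun_prop)] at h₁ h₂ hsZ ⊢
  rw [h₂] at h₁
  rw [hsZ]
  have e₁ := (measurePreserving_prodAssoc (P.map s) (P.map X) (P.map Z)).symm
  have e₂ := (Measure.measurePreserving_swap (μ := P.map s) (ν := P.map X)).prod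
    (MeasurePreserving.id (P.map Z))
  have e₃ := measurePreserving_prodAssoc (P.map X) (P.map s) (P.map Z)
  have h := (e₃.comp (e₂.comp e₁)).map_eq
  rw [← h₁, Measure.map_map (e₃.comp (e₂.comp e₁)).measurable (by fun_prop)] at h
  exact h

lemma integral_mulVec_mul_star {ι κ : Type*} [Fintype ι] {x : Ω → ι → ℂ}
    (hx : ∀ i, MemLp (fun w => x w i) 2 P) {R : Matrix ι ι ℂ}
    (hR : ∀ i j, ∫ w, x w i * star (x w j) ∂P = R i j) (L : Matrix κ ι ℂ) (a b : κ) :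
    ∫ w, (L *ᵥ x w) a * star ((L *ᵥ x w) b) ∂P = (L * R * Lᴴ) a b := by
  simp only [mulVec, dotProduct, star_sum, star_mul']
  rw [(integral_sum_mul_sum (fun i j => integrable_mul_star (hx i) (hx j)) (L a)
    fun j => star (L b j)).2]
  simp only [hR, mul_apply, Finset.sum_mul, conjTranspose_apply]
  rw [Finset.sum_comm]
  exact Finset.sum_congr rfl fun i _ => Finset.sum_congr rfl fun j _ => by ring

lemma memLp_mulVec {ι κ : Type*} [Fintype ι] {x : Ω → ι → ℂ}
    (hx : ∀ i, MemLp (fun w => x w i) 2 P) (L : Matrix κ ι ℂ) (a : κ) :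
    MemLp (fun w => (L *ᵥ x w) a) 2 P :=
  memLp_finsetSum _ fun i _ => (hx i).const_mul _

variable {M N : ℕ}

/-- The second moments of the random matrix `(1/N) ∑ₜ X(t) B(t)ᴴ` whose independent factors have
covariance matrices `N c Q` and `G`, the first one being circular. -/
structure HasCrossMoments (Y : Ω → Matrix (Fin M) (Fin M) ℂ) (c : ℂ)
    (Q G : Matrix (Fin M) (Fin M) ℂ) (P : Measure Ω) : Prop where
  integrable_star : ∀ i j k l, Integrable (fun w => Y w i j * star (Y w k l)) P
  integrable : ∀ i j k l, Integrable (fun w => Y w i j * Y w k l) P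
  integral_star : ∀ i j k l, ∫ w, Y w i j * star (Y w k l) ∂P = c * Q i k * G l j
  integral : ∀ i j k l, ∫ w, Y w i j * Y w k l ∂P = 0

/-- Each moment factors into an X-part and a B-part. The X-part vanishes for distinct times, so B
may be correlated in time; the N diagonal terms over N² leave v/N. -/
lemma hasCrossMoments_of_indepFun (hN : 0 < N) {X B : Fin N → Ω → Fin M → ℂ} {v : ℂ}
    {Q G : Matrix (Fin M) (Fin M) ℂ}
    (hX : ∀ t i, MemLp (fun w => X t w i) 2 P) (hB : ∀ t i, MemLp (fun w => B t w i) 2 P)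
    (hind : IndepFun (fun w t => X t w) (fun w t => B t w) P)
    (hXX : ∀ t u i k, ∫ w, X t w i * X u w k ∂P = 0)
    (hXs : ∀ t u i k, ∫ w, X t w i * star (X u w k) ∂P = if t = u then v * Q i k else 0)
    (hBs : ∀ t j l, ∫ w, B t w j * star (B t w l) ∂P = G j l) :
    HasCrossMoments (fun w => (1 / (N : ℂ)) • ∑ t, vecMulVec (X t w) (star (B t w))) (v / N) Q G
      P := by
  have hY : ∀ w i j, ((1 / (N : ℂ)) • ∑ t, vecMulVec (X t w) (star (B t w))) i j
      = ∑ t, (1 / (N : ℂ)) * (X t w i * star (B t w j)) := fun w i j => by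
    simp [Matrix.sum_apply, vecMulVec_apply, Finset.mul_sum]
  have hYs : ∀ w i j, star (((1 / (N : ℂ)) • ∑ t, vecMulVec (X t w) (star (B t w))) i j)
      = ∑ t, (1 / (N : ℂ)) * (star (X t w i) * B t w j) := fun w i j => by
    rw [hY]; simp
  have hN0 : (N : ℂ) ≠ 0 := by exact_mod_cast hN.ne'
  have hcomp : ∀ {f g : (Fin N → Fin M → ℂ) → ℂ}, Measurable f → Measurable g →
      IndepFun (fun w => f fun t => X t w) (fun w => g fun t => B t w) P :=
    fun hf hg => hind.comp hf hg
  have i₁ : ∀ t u i j k l, Integrable (fun w => X t w i * star (B t w j)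
      * (star (X u w k) * B u w l)) P ∧
      ∫ w, X t w i * star (B t w j) * (star (X u w k) * B u w l) ∂P
        = (∫ w, X t w i * star (X u w k) ∂P) * ∫ w, B u w l * star (B t w j) ∂P := by
    intro t u i j k l
    have h1 := integrable_mul_star (hX t i) (hX u k)
    have h2 := integrable_mul_star (hB u l) (hB t j)
    have h3 := hcomp (f := fun x => x t i * star (x u k)) (g := fun y => y u l * star (y t j))
      (by fun_prop) (by fun_prop)
    have h4 : ∀ w, X t w i * star (B t w j) * (star (X u w k) * B u w l)
        = X t w i * star (X u w k) * (B u w l * star (B t w j)) := fun w => by ring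
    simp only [h4]
    exact ⟨h3.integrable_mul h1 h2,
      h3.integral_mul_eq_mul_integral h1.aestronglyMeasurable h2.aestronglyMeasurable⟩
  have i₂ : ∀ t u i j k l, Integrable (fun w => X t w i * star (B t w j)
      * (X u w k * star (B u w l))) P ∧
      ∫ w, X t w i * star (B t w j) * (X u w k * star (B u w l)) ∂P
        = (∫ w, X t w i * X u w k ∂P) * ∫ w, star (B t w j) * star (B u w l) ∂P := by
    intro t u i j k l
    have h1 : Integrable (fun w => X t w i * X u w k) P := (hX t i).integrable_mul (hX u k)
    have h2 : Integrable (fun w => star (B t w j) * star (B u w l)) P :=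
      (hB t j).star.integrable_mul (hB u l).star
    have h3 := hcomp (f := fun x => x t i * x u k) (g := fun y => star (y t j) * star (y u l))
      (by fun_prop) (by fun_prop)
    have h4 : ∀ w, X t w i * star (B t w j) * (X u w k * star (B u w l))
        = X t w i * X u w k * (star (B t w j) * star (B u w l)) := fun w => by ring
    simp only [h4]
    exact ⟨h3.integrable_mul h1 h2,
      h3.integral_mul_eq_mul_integral h1.aestronglyMeasurable h2.aestronglyMeasurable⟩
  have j₁ := fun i j k l => integral_sum_mul_sum (fun t u => (i₁ t u i j k l).1)
    (fun _ => 1 / (N : ℂ)) fun _ => 1 / (N : ℂ)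
  have j₂ := fun i j k l => integral_sum_mul_sum (fun t u => (i₂ t u i j k l).1)
    (fun _ => 1 / (N : ℂ)) fun _ => 1 / (N : ℂ)
  refine ⟨fun i j k l => ?_, fun i j k l => ?_, fun i j k l => ?_, fun i j k l => ?_⟩
  · simp only [hYs]; simp only [hY]
    exact (j₁ i j k l).1
  · simp only [hY]
    exact (j₂ i j k l).1
  · simp only [hYs]; simp only [hY]
    rw [(j₁ i j k l).2]
    have h5 : ∀ t u : Fin N, 1 / (N : ℂ) * (1 / N) *
        ∫ w, X t w i * star (B t w j) * (star (X u w k) * B u w l) ∂P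
        = if t = u then 1 / (N : ℂ) * (1 / N) * (v * Q i k * G l j) else 0 := fun t u => by
      rw [(i₁ t u i j k l).2, hXs]
      split_ifs with h
      · rw [h, hBs]
      · simp
    simp only [h5, Finset.sum_ite_eq, Finset.mem_univ, if_true, Finset.sum_const,
      Finset.card_univ, Fintype.card_fin, nsmul_eq_mul]
    field_simp
  · simp only [hY]
    rw [(j₂ i j k l).2]
    simp only [(i₂ _ _ i j k l).2, hXX, zero_mul, mul_zero, Finset.sum_const_zero]

namespace HasCrossMoments

variable {Y : Ω → Matrix (Fin M) (Fin M) ℂ} {c : ℂ} {Q G : Matrix (Fin M) (Fin M) ℂ}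

lemma trace_mul_eq (C Z : Matrix (Fin M) (Fin M) ℂ) :
    (C * Z).trace = ∑ p : Fin M × Fin M, C p.2 p.1 * Z p.1 p.2 := by
  simp only [trace, diag, mul_apply, Fintype.sum_prod_type]
  rw [Finset.sum_comm]

lemma star_trace_mul_eq (C Z : Matrix (Fin M) (Fin M) ℂ) :
    star (C * Z).trace = ∑ p : Fin M × Fin M, star (C p.2 p.1) * star (Z p.1 p.2) := by
  rw [trace_mul_eq]; simp

/-- The basic contraction rule: the moment of a pair of linear functionals of Y, the second
conjugated, contracts their coefficient matrices through Q and G. -/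
lemma trace_mul_star (h : HasCrossMoments Y c Q G P) (C D : Matrix (Fin M) (Fin M) ℂ) :
    Integrable (fun w => (C * Y w).trace * star (D * Y w).trace) P ∧
    ∫ w, (C * Y w).trace * star (D * Y w).trace ∂P = c * (C * Q * Dᴴ * G).trace := by
  simp only [star_trace_mul_eq]
  simp only [trace_mul_eq C]
  have h1 := integral_sum_mul_sum (f := fun (p : Fin M × Fin M) w => Y w p.1 p.2)
    (g := fun (p : Fin M × Fin M) w => star (Y w p.1 p.2))
    (fun p q => h.integrable_star p.1 p.2 q.1 q.2) (fun p => C p.2 p.1) fun p => star (D p.2 p.1)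
  refine ⟨h1.1, h1.2.trans ?_⟩
  simp only [h.integral_star, trace, diag, mul_apply, Fintype.sum_prod_type, Finset.mul_sum,
    Finset.sum_mul, conjTranspose_apply]
  rw [Finset.sum_comm]
  refine Finset.sum_congr rfl fun b _ => ?_
  rw [Finset.sum_congr rfl fun a _ => Finset.sum_comm, Finset.sum_comm]
  refine Finset.sum_congr rfl fun d _ => ?_
  rw [Finset.sum_comm]
  refine Finset.sum_congr rfl fun i _ => Finset.sum_congr rfl fun j _ => ?_
  ring

lemma trace_mul (h : HasCrossMoments Y c Q G P) (C D : Matrix (Fin M) (Fin M) ℂ) :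
    Integrable (fun w => (C * Y w).trace * (D * Y w).trace) P ∧
    ∫ w, (C * Y w).trace * (D * Y w).trace ∂P = 0 := by
  simp only [trace_mul_eq]
  have h1 := integral_sum_mul_sum (f := fun (p : Fin M × Fin M) w => Y w p.1 p.2)
    (g := fun (p : Fin M × Fin M) w => Y w p.1 p.2)
    (fun p q => h.integrable p.1 p.2 q.1 q.2) (fun p => C p.2 p.1) fun p => D p.2 p.1
  refine ⟨h1.1, h1.2.trans ?_⟩
  simp [h.integral]

lemma star_trace_mul (h : HasCrossMoments Y c Q G P) (C D : Matrix (Fin M) (Fin M) ℂ) :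
    Integrable (fun w => star (C * Y w).trace * star (D * Y w).trace) P ∧
    ∫ w, star (C * Y w).trace * star (D * Y w).trace ∂P = 0 := by
  have h1 := h.trace_mul C D
  have h2 : ∀ w, star (C * Y w).trace * star (D * Y w).trace
      = (starRingEnd ℂ) ((C * Y w).trace * (D * Y w).trace) := fun w => by
    rw [map_mul]; rfl
  simp only [h2]
  refine ⟨(Complex.conjCLE : ℂ →L[ℝ] ℂ).integrable_comp h1.1, ?_⟩
  rw [integral_conj, h1.2, map_zero]

lemma trace_star_mul_self (h : HasCrossMoments Y c Q G P) :
    Integrable (fun w => ((Y w)ᴴ * Y w).trace) P ∧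
    ∫ w, ((Y w)ᴴ * Y w).trace ∂P = c * (Q.trace * G.trace) := by
  have h1 : ∀ w, ((Y w)ᴴ * Y w).trace = ∑ j, ∑ i, Y w i j * star (Y w i j) := fun w => by
    simp only [trace, diag, mul_apply, conjTranspose_apply]
    exact Finset.sum_congr rfl fun j _ => Finset.sum_congr rfl fun i _ => mul_comm _ _
  simp only [h1]
  refine ⟨integrable_finsetSum _ fun j _ => integrable_finsetSum _ fun i _ =>
    h.integrable_star i j i j, ?_⟩
  rw [integral_finsetSum _ fun j _ => integrable_finsetSum _ fun i _ => h.integrable_star i j i j]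
  have h2 : ∀ j, ∫ w, ∑ i, Y w i j * star (Y w i j) ∂P = c * Q.trace * G j j := fun j => by
    rw [integral_finsetSum _ fun i _ => h.integrable_star i j i j]
    simp only [h.integral_star, trace, diag, Finset.mul_sum, Finset.sum_mul]
  simp only [h2, ← Finset.mul_sum, mul_assoc]
  rfl

end HasCrossMoments

end CrossMoments

/-! ### Moments of the sandwiched sample covariance error Q ΔR W. -/

section SampleCovariance

open scoped Kronecker

variable {M K N : ℕ} {ω : Fin K → ℝ} {S : Matrix (Fin K) (Fin K) ℂ} {σ : ℝ} {μ : Fin K → ℝ}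
  {e : Fin K → Fin M → ℂ} {Ω : Type*} [MeasurableSpace Ω] {P : Measure Ω}
  {s : Fin N → Ω → Fin K → ℂ} {n : Fin N → Ω → Fin M → ℂ}

lemma one_kronecker_mulVec (Q : Matrix (Fin M) (Fin M) ℂ) (x : Fin N × Fin M → ℂ)
    (p : Fin N × Fin M) :
    (((1 : Matrix (Fin N) (Fin N) ℂ) ⊗ₖ Q) *ᵥ x) p = (Q *ᵥ fun i => x (p.1, i)) p.2 := by
  simp only [mulVec, dotProduct, kroneckerMap_apply, Fintype.sum_prod_type, one_apply, ite_mul,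
    one_mul, zero_mul]
  rw [Finset.sum_eq_single p.1] <;> simp +contextual [eq_comm]

lemma map_eval_complexGaussian {v : ℝ} (hn_meas : ∀ t, Measurable (n t))
    (hn_law : ∀ t, P.map (n t) = Measure.pi fun _ : Fin M => complexGaussian v) (t : Fin N)
    (i : Fin M) : P.map (fun w => n t w i) = complexGaussian v := by
  have h1 := (measurePreserving_eval (fun _ : Fin M => complexGaussian v) i).map_eq
  rw [← hn_law t, Measure.map_map (measurable_pi_apply i) (hn_meas t)] at h1
  exact h1

lemma iIndepFun_noise [IsProbabilityMeasure P] {v : ℝ} (hn_meas : ∀ t, Measurable (n t))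
    (hn_law : ∀ t, P.map (n t) = Measure.pi fun _ : Fin M => complexGaussian v)
    (hn_indep : iIndepFun n P) :
    iIndepFun (fun (p : Fin N × Fin M) w => n p.1 w p.2) P := by
  refine iIndepFun_uncurry' (X := fun t i w => n t w i) (fun t i => by fun_prop) hn_indep
    fun t => ?_
  rw [iIndepFun_iff_map_fun_eq_pi_map fun i => by fun_prop]
  simp only [map_eval_complexGaussian hn_meas hn_law]
  exact hn_law t

/-- The covariance matrix of a snapshot. -/
lemma integral_snapshot [IsProbabilityMeasure P] {x : Ω → Fin K → ℂ} {y : Ω → Fin M → ℂ}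
    (A : Matrix (Fin M) (Fin K) ℂ) {v : ℂ} (hx : ∀ i, MemLp (fun w => x w i) 2 P)
    (hy : ∀ i, MemLp (fun w => y w i) 2 P) (hxS : ∀ i j, ∫ w, x w i * star (x w j) ∂P = S i j)
    (hy0 : ∀ i, ∫ w, y w i ∂P = 0)
    (hyv : ∀ i j, ∫ w, y w i * star (y w j) ∂P = if i = j then v else 0)
    (hxy : IndepFun x y P) (i j : Fin M) :
    ∫ w, (A *ᵥ x w + y w) i * star ((A *ᵥ x w + y w) j) ∂P
      = (A * S * Aᴴ + v • (1 : Matrix (Fin M) (Fin M) ℂ)) i j := by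
  have hAx := memLp_mulVec hx A
  have hc : ∀ i j, ∫ w, (A *ᵥ x w) i * star (y w j) ∂P = 0 := fun i j => by
    have h1 : IndepFun (fun w => (A *ᵥ x w) i) (fun w => star (y w j)) P :=
      hxy.comp (φ := fun u => (A *ᵥ u) i) (ψ := fun u : Fin M → ℂ => star (u j))
        (by unfold mulVec dotProduct; fun_prop) (by fun_prop)
    rw [h1.integral_fun_mul_eq_mul_integral (hAx i).aestronglyMeasurable
      (hy j).star.aestronglyMeasurable]
    have h2 : ∫ w, star (y w j) ∂P = 0 := by
      have h3 := integral_conj (μ := P) (f := fun w => y w j)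
      rw [hy0, map_zero] at h3
      exact h3
    rw [h2, mul_zero]
  have hc' : ∀ i j, ∫ w, y w i * star ((A *ᵥ x w) j) ∂P = 0 := fun i j => by
    have h3 := integral_conj (μ := P) (f := fun w => (A *ᵥ x w) j * star (y w i))
    rw [hc, map_zero] at h3
    rw [← h3]
    refine integral_congr_ae (Eventually.of_forall fun w => ?_)
    simp [mul_comm]
  have hexp : ∀ w, (A *ᵥ x w + y w) i * star ((A *ᵥ x w + y w) j)
      = ((A *ᵥ x w) i * star ((A *ᵥ x w) j) + (A *ᵥ x w) i * star (y w j))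
        + (y w i * star ((A *ᵥ x w) j) + y w i * star (y w j)) := fun w => by
    simp only [Pi.add_apply, star_add]; ring
  have k₁ := integrable_mul_star (hAx i) (hAx j)
  have k₂ := integrable_mul_star (hAx i) (hy j)
  have k₃ := integrable_mul_star (hy i) (hAx j)
  have k₄ := integrable_mul_star (hy i) (hy j)
  have k₁₂ : Integrable (fun w => (A *ᵥ x w) i * star ((A *ᵥ x w) j)
      + (A *ᵥ x w) i * star (y w j)) P := k₁.add k₂
  have k₃₄ : Integrable (fun w => y w i * star ((A *ᵥ x w) j) + y w i * star (y w j)) P :=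
    k₃.add k₄
  simp only [hexp]
  rw [integral_add k₁₂ k₃₄, integral_add k₁ k₂, integral_add k₃ k₄, hc, hc', hyv,
    integral_mulVec_mul_star hx hxS]
  simp [one_apply]

/-- The sandwiched sample covariance error. -/
lemma noise_mul_sampleCov_mul {Q W R : Matrix (Fin M) (Fin M) ℂ} {A : Matrix (Fin M) (Fin K) ℂ}
    (hQA : Q * A = 0) (hQRW : Q * R * W = 0) (hW : W.IsHermitian) (x : Fin N → Fin K → ℂ)
    (y : Fin N → Fin M → ℂ) :
    Q * (sampleCov (fun t => A *ᵥ x t + y t) - R) * W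
      = (1 / (N : ℂ)) • ∑ t, vecMulVec (Q *ᵥ y t) (star (W *ᵥ (A *ᵥ x t + y t))) := by
  rw [Matrix.mul_sub, Matrix.sub_mul, hQRW, sub_zero, sampleCov, Matrix.mul_smul,
    Matrix.smul_mul, Matrix.mul_sum, Matrix.sum_mul]
  congr 1
  refine Finset.sum_congr rfl fun t _ => ?_
  rw [mul_vecMulVec, vecMulVec_mul, mulVec_add, mulVec_mulVec, hQA, zero_mulVec, zero_add,
    star_mulVec, hW.eq]

/-- Because Q A = 0, the left factors are pure noise Q n(t). Because Q W = 0, they are independent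
of the noise W n in the right factors, and so of all the W x(t). -/
lemma hasCrossMoments_sampleCov [IsProbabilityMeasure P] (hK : 0 < K)
    (hω : Function.Injective fun k => steering M (ω k)) (hKM : K < M) (hN : 0 < N)
    (hS : S.PosDef) (he : IsSignalEigensystem (dataCov M ω S σ) μ e)
    (hs_meas : ∀ t, Measurable (s t)) (hn_meas : ∀ t, Measurable (n t))
    (hs_mem : ∀ t i, MemLp (fun w => s t w i) 2 P)
    (hs_cov : ∀ t i j, ∫ w, s t w i * star (s t w j) ∂P = S i j)
    (hn_law : ∀ t, P.map (n t) = Measure.pi fun _ : Fin M => complexGaussian (σ ^ 2))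
    (hn_indep : iIndepFun n P) (hsn_indep : IndepFun (fun w t => s t w) (fun w t => n t w) P) :
    HasCrossMoments (fun w => noiseProj e * (sampleCov (fun t => arrayMatrix M ω *ᵥ s t w + n t w)
      - dataCov M ω S σ) * pinvV σ μ e) (((σ ^ 2 : ℝ) : ℂ) / N) (noiseProj e)
      (pinvV σ μ e * dataCov M ω S σ * pinvV σ μ e) P := by
  have hmodel := isPinvSystem hK hω hKM.le hS he
  have hQA := noiseProj_mul_arrayMatrix hω hKM.le hS he
  have hQH := noiseProj_isHermitian e
  have hQQ := he.noiseProj_mul_self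
  have hWH := pinvV_isHermitian σ μ e
  have hQW : noiseProj e * pinvV σ μ e = 0 := by
    rw [noiseProj, Matrix.sub_mul, Matrix.one_mul, hmodel.PW, sub_self]
  have hQRW : noiseProj e * dataCov M ω S σ * pinvV σ μ e = 0 := by
    rw [dataCov_eq, Matrix.mul_add, Matrix.mul_assoc (arrayMatrix M ω),
      ← Matrix.mul_assoc _ _ (S * _),
      hQA, Matrix.zero_mul, zero_add, Matrix.mul_smul, Matrix.mul_one, Matrix.smul_mul, hQW,
      smul_zero]
  set Q := noiseProj e
  set W := pinvV σ μ e
  set A := arrayMatrix M ω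
  have hind := iIndepFun_noise hn_meas hn_law hn_indep
  have hlaw := map_eval_complexGaussian hn_meas hn_law
  have hwhite := isWhite_of_iIndepFun (n := fun (p : Fin N × Fin M) w => n p.1 w p.2)
    (fun p => by fun_prop) (sq_nonneg σ)
    (fun p => hlaw p.1 p.2) hind
  have hg : HasGaussianLaw (fun w (p : Fin N × Fin M) => n p.1 w p.2) P :=
    iIndepFun.hasGaussianLaw (fun p => ⟨by rw [hlaw p.1 p.2]; infer_instance⟩) hind
  -- The Kronecker products act on all snapshots stacked as one vector, so independence holds
  -- jointly over all times.
  have hXZ := hwhite.indepFun_mulVec hg (L := (1 : Matrix (Fin N) (Fin N) ℂ) ⊗ₖ Q)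
    (L' := (1 : Matrix (Fin N) (Fin N) ℂ) ⊗ₖ W) (by
      rw [conjTranspose_kronecker, ← mul_kronecker_mul, hWH.eq, hQW, kronecker_zero])
  set X' : Ω → Fin N × Fin M → ℂ :=
    fun w => ((1 : Matrix (Fin N) (Fin N) ℂ) ⊗ₖ Q) *ᵥ fun p => n p.1 w p.2 with hX'
  set Z' : Ω → Fin N × Fin M → ℂ :=
    fun w => ((1 : Matrix (Fin N) (Fin N) ℂ) ⊗ₖ W) *ᵥ fun p => n p.1 w p.2 with hZ'
  have hmulVec : ∀ L : Matrix (Fin N × Fin M) (Fin N × Fin M) ℂ,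
      Measurable fun (y : Fin N → Fin M → ℂ) => L *ᵥ fun p => y p.1 p.2 := fun L => by
    unfold mulVec dotProduct; fun_prop
  have hn_all : Measurable fun w t => n t w := measurable_pi_lambda _ hn_meas
  have hs_all : Measurable fun w t => s t w := measurable_pi_lambda _ hs_meas
  have hXsZ : IndepFun X' (fun w => ((fun t => s t w), Z' w)) P :=
    indepFun_prodMk_of_indepFun ((hmulVec _).comp hn_all) hs_all ((hmulVec _).comp hn_all)
      (hsn_indep.comp measurable_id ((hmulVec _).prodMk (hmulVec _))) hXZ
  have hXB : IndepFun (fun w t => Q *ᵥ n t w) (fun w t => W *ᵥ (A *ᵥ s t w + n t w)) P := by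
    have h1 : (fun w t => Q *ᵥ n t w) = (fun (x : Fin N × Fin M → ℂ) t i => x (t, i)) ∘ X' := by
      funext w t i
      simp only [hX', Function.comp, one_kronecker_mulVec]
    have h2 : (fun w t => W *ᵥ (A *ᵥ s t w + n t w))
        = (fun (q : (Fin N → Fin K → ℂ) × (Fin N × Fin M → ℂ)) t i =>
            ((W * A) *ᵥ q.1 t) i + q.2 (t, i)) ∘ fun w => ((fun t => s t w), Z' w) := by
      funext w t i
      simp only [hZ', Function.comp, one_kronecker_mulVec, mulVec_add, mulVec_mulVec, Pi.add_apply]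
    rw [h1, h2]
    exact hXsZ.comp (by fun_prop) (by unfold mulVec dotProduct; fun_prop)
  have hn_mem : ∀ t i, MemLp (fun w => n t w i) 2 P := fun t i => hwhite.memLp (t, i)
  have hx_mem : ∀ t i, MemLp (fun w => (A *ᵥ s t w + n t w) i) 2 P := fun t i =>
    (memLp_mulVec (hs_mem t) A i).add (hn_mem t i)
  have hsn : ∀ t, IndepFun (s t) (n t) P := fun t =>
    hsn_indep.comp (measurable_pi_apply t) (measurable_pi_apply t)
  simp only [noise_mul_sampleCov_mul hQA hQRW hWH]
  refine hasCrossMoments_of_indepFun hN (fun t => memLp_mulVec (hn_mem t) Q)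
    (fun t => memLp_mulVec (hx_mem t) W) hXB (fun t u i k => ?_) (fun t u i k => ?_)
    fun t j l => ?_
  · have := hwhite.integral_linear_mul_linear
      (fun p => ((1 : Matrix (Fin N) (Fin N) ℂ) ⊗ₖ Q) (t, i) p)
      (fun p => ((1 : Matrix (Fin N) (Fin N) ℂ) ⊗ₖ Q) (u, k) p)
    rw [← this]
    refine integral_congr_ae (Eventually.of_forall fun w => ?_)
    simp only [← one_kronecker_mulVec Q (fun p => n p.1 w p.2) (t, i),
      ← one_kronecker_mulVec Q (fun p => n p.1 w p.2) (u, k)]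
    rfl
  · have h1 := integral_mulVec_mul_star (x := fun w (p : Fin N × Fin M) => n p.1 w p.2)
      (R := ((σ ^ 2 : ℝ) : ℂ) • 1) hwhite.memLp (fun p q => by
        rw [hwhite.mul_star]; simp [one_apply])
      ((1 : Matrix (Fin N) (Fin N) ℂ) ⊗ₖ Q) (t, i) (u, k)
    simp only [one_kronecker_mulVec] at h1
    rw [h1, Matrix.mul_smul, Matrix.mul_one, Matrix.smul_mul, conjTranspose_kronecker,
      ← mul_kronecker_mul, hQH.eq, hQQ, conjTranspose_one, Matrix.mul_one]
    simp [kroneckerMap_apply, one_apply]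
  · rw [integral_mulVec_mul_star (hx_mem t) (integral_snapshot (v := ((σ ^ 2 : ℝ) : ℂ)) A
      (hs_mem t) (hn_mem t) (hs_cov t)
      (fun i => hwhite.mean (t, i)) (fun i j => by
        rw [hwhite.mul_star (t, i) (t, j)]; simp) (hsn t)), hWH.eq]
    rfl

end SampleCovariance

/-! ### Leakage terms as quadratic functionals of Y = Q ΔR W. -/

section ExpectedLeakage

variable {M K N : ℕ} {ω : Fin K → ℝ} {Q W Δ : Matrix (Fin M) (Fin M) ℂ}

/-- The rank one matrix `a_k a_k⁽¹⁾ᴴ`. -/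
noncomputable def steeringOuter (M : ℕ) (ω : Fin K → ℝ) (k : Fin K) : Matrix (Fin M) (Fin M) ℂ :=
  vecMulVec (steering M (ω k)) (star (steeringOne M (ω k)))

/-- The matrix `P⊥ (∂A/∂ω_k) (AᴴA)⁻¹ Aᴴ`. -/
noncomputable def complPartial (Q : Matrix (Fin M) (Fin M) ℂ) (ω : Fin K → ℝ) (k : Fin K) :
    Matrix (Fin M) (Fin M) ℂ :=
  Q * (partialA M ω k * (((arrayMatrix M ω)ᴴ * arrayMatrix M ω)⁻¹ * (arrayMatrix M ω)ᴴ))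

lemma trace_vecMulVec_mul (a u : Fin M → ℂ) (Z : Matrix (Fin M) (Fin M) ℂ) :
    (vecMulVec a (star u) * Z).trace = star u ⬝ᵥ (Z *ᵥ a) := by
  rw [vecMulVec_mul, trace_vecMulVec, dotProduct_comm, dotProduct_mulVec]

lemma star_dotProduct_mulVec (a u : Fin M → ℂ) (Z : Matrix (Fin M) (Fin M) ℂ) :
    star (star u ⬝ᵥ (Z *ᵥ a)) = star a ⬝ᵥ (Zᴴ *ᵥ u) := by
  rw [← star_dotProduct_star, star_star, star_mulVec, ← dotProduct_mulVec]

lemma trace_steeringOuter_mul_mul (k i : Fin K) (G : Matrix (Fin M) (Fin M) ℂ) :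
    (steeringOuter M ω k * Q * (steeringOuter M ω i)ᴴ * G).trace
      = (star (steering M (ω i)) ⬝ᵥ (G *ᵥ steering M (ω k)))
        * (star (steeringOne M (ω k)) ⬝ᵥ (Q *ᵥ steeringOne M (ω i))) := by
  rw [Matrix.mul_assoc, Matrix.mul_assoc, steeringOuter, trace_vecMulVec_mul, steeringOuter,
    conjTranspose_vecMulVec, star_star, ← mulVec_mulVec, ← mulVec_mulVec, vecMulVec_mulVec]
  simp [mulVec_smul]

/-- The angle error has the form (y − ȳ)/(2j q) with y linear in Y and q the quadratic form of Q at
a_k⁽¹⁾. It is therefore real, and its moments reduce to those of Y. -/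
lemma freqError_eq_trace (hQ : Q.IsHermitian) (hW : W.IsHermitian) (hΔ : Δ.IsHermitian)
    (k : Fin K) : freqError M ω Q W Δ k
      = ((steeringOuter M ω k * (Q * Δ * W)).trace - star (steeringOuter M ω k * (Q * Δ * W)).trace)
        / (2 * Complex.I * (star (steeringOne M (ω k)) ⬝ᵥ (Q *ᵥ steeringOne M (ω k)))) := by
  rw [steeringOuter, trace_vecMulVec_mul, star_dotProduct_mulVec, conjTranspose_mul,
    conjTranspose_mul, hQ.eq, hW.eq, hΔ.eq, ← Matrix.mul_assoc, freqError]

lemma star_freqError (hQ : Q.IsHermitian) (hW : W.IsHermitian) (hΔ : Δ.IsHermitian)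
    (k : Fin K) : star (freqError M ω Q W Δ k) = freqError M ω Q W Δ k := by
  have h1 := star_dotProduct_mulVec (steeringOne M (ω k)) (steeringOne M (ω k)) Q
  rw [hQ.eq] at h1
  rw [freqError_eq_trace hQ hW hΔ, star_div₀, star_mul, h1, star_sub, star_star]
  simp only [star_mul, Complex.star_def, Complex.conj_I, map_ofNat]
  rw [← neg_div_neg_eq]
  congr 1 <;> ring

lemma rho1_eq_trace (hQ : Q.IsHermitian) (hQQ : Q * Q = Q) (hW : W.IsHermitian)
    (hΔ : Δ.IsHermitian) :
    rho1 K Q W Δ = 1 / (K : ℂ) * ((Q * Δ * W)ᴴ * (Q * Δ * W)).trace := by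
  have h1 : (Q * Δ * W)ᴴ * (Q * Δ * W) = W * Δ * Q * Δ * W := by
    rw [conjTranspose_mul, conjTranspose_mul, hQ.eq, hW.eq, hΔ.eq]
    simp only [← Matrix.mul_assoc]
    rw [Matrix.mul_assoc (W * Δ) Q Q, hQQ]
  rw [rho1, h1]

lemma compl_mul_dProj (hω : IsUnit ((arrayMatrix M ω)ᴴ * arrayMatrix M ω).det)
    (hQ : Q = 1 - projA M ω) (Δω : Fin K → ℂ) :
    Q * dProj M ω Δω = ∑ k, Δω k • complPartial Q ω k := by
  rw [dProj, Finset.mul_sum]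
  refine Finset.sum_congr rfl fun k _ => ?_
  rw [Matrix.mul_smul, hQ, compl_mul_partialProjA hω, complPartial]

lemma trace_cross_eq (hQ : Q.IsHermitian) (hQQ : Q * Q = Q) (hW : W.IsHermitian)
    (hΔ : Δ.IsHermitian) {D : Matrix (Fin M) (Fin M) ℂ} {x : Fin K → ℂ}
    (hD : Q * D = ∑ k, x k • complPartial Q ω k) :
    (W * Δ * Q * D).trace = ∑ k, x k * star ((complPartial Q ω k)ᴴ * (Q * Δ * W)).trace := by
  have h1 : W * Δ * Q * D = (Q * Δ * W)ᴴ * (Q * D) := by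
    rw [conjTranspose_mul, conjTranspose_mul, hQ.eq, hW.eq, hΔ.eq, ← Matrix.mul_assoc,
      ← Matrix.mul_assoc, Matrix.mul_assoc (W * Δ) Q Q, hQQ]
  rw [h1, hD, Finset.mul_sum, trace_sum]
  refine Finset.sum_congr rfl fun k _ => ?_
  rw [Matrix.mul_smul, trace_smul, smul_eq_mul, ← trace_conjTranspose,
    conjTranspose_mul (complPartial Q ω k)ᴴ, conjTranspose_conjTranspose]

lemma trace_complPartial (hω : IsUnit ((arrayMatrix M ω)ᴴ * arrayMatrix M ω).det)
    (hQ : Q.IsHermitian) (hQQ : Q * Q = Q) (k i : Fin K) :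
    ((complPartial Q ω k)ᴴ * complPartial Q ω i).trace
      = ((partialA M ω k)ᴴ * Q * partialA M ω i
        * ((arrayMatrix M ω)ᴴ * arrayMatrix M ω)⁻¹).trace := by
  have hg : (((arrayMatrix M ω)ᴴ * arrayMatrix M ω)⁻¹)ᴴ
      = ((arrayMatrix M ω)ᴴ * arrayMatrix M ω)⁻¹ :=
    (isHermitian_conjTranspose_mul_self _).inv
  have h1 : ((arrayMatrix M ω)ᴴ * arrayMatrix M ω) * ((arrayMatrix M ω)ᴴ * arrayMatrix M ω)⁻¹ = 1 :=
    mul_nonsing_inv _ hω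
  simp only [complPartial, conjTranspose_mul, hg, hQ.eq, conjTranspose_conjTranspose]
  set A := arrayMatrix M ω
  set g := (Aᴴ * A)⁻¹
  have h2 : A * g * (partialA M ω k)ᴴ * Q * (Q * (partialA M ω i * (g * Aᴴ)))
      = A * (g * ((partialA M ω k)ᴴ * Q * partialA M ω i * g)) * Aᴴ := by
    simp only [Matrix.mul_assoc]
    rw [← Matrix.mul_assoc Q Q, hQQ]
  have h3 : ∀ Z, (A * (g * Z) * Aᴴ).trace = Z.trace := fun Z => by
    rw [trace_mul_comm, ← Matrix.mul_assoc, ← Matrix.mul_assoc, h1, Matrix.one_mul]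
  rw [h2, h3]

lemma trace_quadratic_eq (hω : IsUnit ((arrayMatrix M ω)ᴴ * arrayMatrix M ω).det)
    (hQ : Q.IsHermitian) (hQQ : Q * Q = Q) {D : Matrix (Fin M) (Fin M) ℂ} (hDH : D.IsHermitian)
    {x : Fin K → ℂ} (hx : ∀ k, star (x k) = x k) (hD : Q * D = ∑ k, x k • complPartial Q ω k) :
    (D * Q * D).trace = ∑ k, ∑ i, ((partialA M ω k)ᴴ * Q * partialA M ω i
        * ((arrayMatrix M ω)ᴴ * arrayMatrix M ω)⁻¹).trace * (x k * x i) := by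
  have h1 : D * Q * D = (Q * D)ᴴ * (Q * D) := by
    rw [conjTranspose_mul, hQ.eq, hDH.eq, Matrix.mul_assoc, Matrix.mul_assoc,
      ← Matrix.mul_assoc Q Q, hQQ]
  rw [h1, hD, conjTranspose_sum, Finset.sum_mul_sum, trace_sum]
  refine Finset.sum_congr rfl fun k _ => ?_
  rw [trace_sum]
  refine Finset.sum_congr rfl fun i _ => ?_
  rw [conjTranspose_smul, hx, Matrix.smul_mul, Matrix.mul_smul, trace_smul, trace_smul,
    trace_complPartial hω hQ hQQ]
  simp only [smul_eq_mul]
  ring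

variable {Ω : Type*} [MeasurableSpace Ω] {P : Measure Ω} {G : Matrix (Fin M) (Fin M) ℂ}
  {c : ℝ} {X : Ω → Matrix (Fin M) (Fin M) ℂ}

/-- Only the y part of y − ȳ correlates with a conjugated functional of Y; the ȳ part gives a
pseudo-moment, which is zero. -/
lemma integral_freqError_mul_star (hQ : Q.IsHermitian) (hW : W.IsHermitian)
    (hX : ∀ w, (X w).IsHermitian) (hY : HasCrossMoments (fun w => Q * X w * W) c Q G P)
    (C : Matrix (Fin M) (Fin M) ℂ) (k : Fin K) :
    Integrable (fun w => freqError M ω Q W (X w) k * star (C * (Q * X w * W)).trace) P ∧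
    ∫ w, freqError M ω Q W (X w) k * star (C * (Q * X w * W)).trace ∂P
      = c * (steeringOuter M ω k * Q * Cᴴ * G).trace
        / (2 * Complex.I * (star (steeringOne M (ω k)) ⬝ᵥ (Q *ᵥ steeringOne M (ω k)))) := by
  obtain ⟨i₁, h₁⟩ := hY.trace_mul_star (steeringOuter M ω k) C
  obtain ⟨i₂, h₂⟩ := hY.star_trace_mul (steeringOuter M ω k) C
  have hexp : ∀ w, freqError M ω Q W (X w) k * star (C * (Q * X w * W)).trace
      = ((steeringOuter M ω k * (Q * X w * W)).trace * star (C * (Q * X w * W)).trace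
        - star (steeringOuter M ω k * (Q * X w * W)).trace * star (C * (Q * X w * W)).trace)
        / (2 * Complex.I * (star (steeringOne M (ω k)) ⬝ᵥ (Q *ᵥ steeringOne M (ω k)))) := fun w => by
    rw [freqError_eq_trace hQ hW (hX w)]; ring
  simp only [hexp]
  refine ⟨(i₁.sub i₂).div_const _, ?_⟩
  rw [integral_div, integral_sub i₁ i₂, h₁, h₂, sub_zero]

lemma integral_freqError_mul_freqError (hQ : Q.IsHermitian) (hW : W.IsHermitian)
    (hX : ∀ w, (X w).IsHermitian) (hY : HasCrossMoments (fun w => Q * X w * W) c Q G P)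
    (k i : Fin K) :
    Integrable (fun w => freqError M ω Q W (X w) k * freqError M ω Q W (X w) i) P ∧
    ∫ w, freqError M ω Q W (X w) k * freqError M ω Q W (X w) i ∂P
      = c / 2 * ((((star (steering M (ω i)) ⬝ᵥ (G *ᵥ steering M (ω k)))
          * (star (steeringOne M (ω k)) ⬝ᵥ (Q *ᵥ steeringOne M (ω i)))).re : ℝ) : ℂ)
        / ((star (steeringOne M (ω k)) ⬝ᵥ (Q *ᵥ steeringOne M (ω k)))
          * (star (steeringOne M (ω i)) ⬝ᵥ (Q *ᵥ steeringOne M (ω i)))) := by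
  obtain ⟨i₁, h₁⟩ := hY.trace_mul (steeringOuter M ω k) (steeringOuter M ω i)
  obtain ⟨i₂, h₂⟩ := hY.trace_mul_star (steeringOuter M ω k) (steeringOuter M ω i)
  obtain ⟨i₄, h₄⟩ := hY.star_trace_mul (steeringOuter M ω k) (steeringOuter M ω i)
  rw [trace_steeringOuter_mul_mul] at h₂
  set y : Ω → Fin K → ℂ := fun w k => (steeringOuter M ω k * (Q * X w * W)).trace with hy
  change Integrable (fun w => y w k * y w i) P at i₁
  change Integrable (fun w => y w k * star (y w i)) P at i₂
  change Integrable (fun w => star (y w k) * star (y w i)) P at i₄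
  have h3 : ∀ w, star (y w k) * y w i = (starRingEnd ℂ) (y w k * star (y w i)) := fun w => by
    simp
  have i₃ : Integrable (fun w => star (y w k) * y w i) P := by
    simp only [h3]
    exact (Complex.conjCLE : ℂ →L[ℝ] ℂ).integrable_comp i₂
  have h₃ : ∫ w, star (y w k) * y w i ∂P = (starRingEnd ℂ) (∫ w, y w k * star (y w i) ∂P) := by
    simp only [h3]
    exact integral_conj
  set a := star (steeringOne M (ω k)) ⬝ᵥ (Q *ᵥ steeringOne M (ω k))
  set b := star (steeringOne M (ω i)) ⬝ᵥ (Q *ᵥ steeringOne M (ω i))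
  -- The factor (2j)² = −4 flips signs, so the surviving mixed terms y_k ȳ_i + ȳ_k y_i enter
  -- positively. Together they give twice a real part over 4, which is the factor 1/2 of the last
  -- term.
  have hexp : ∀ w, freqError M ω Q W (X w) k * freqError M ω Q W (X w) i
      = ((y w k * star (y w i) + star (y w k) * y w i)
        - (y w k * y w i + star (y w k) * star (y w i))) / (4 * (a * b)) := fun w => by
    rw [freqError_eq_trace hQ hW (hX w), freqError_eq_trace hQ hW (hX w), div_mul_div_comm]
    have h5 : 2 * Complex.I * a * (2 * Complex.I * b) = -(4 * (a * b)) := by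
      linear_combination 4 * a * b * Complex.I_sq
    rw [h5, div_neg, ← neg_div]
    congr 1
    ring
  have i₂₃ : Integrable (fun w => y w k * star (y w i) + star (y w k) * y w i) P := i₂.add i₃
  have i₁₄ : Integrable (fun w => y w k * y w i + star (y w k) * star (y w i)) P := i₁.add i₄
  simp only [hexp]
  refine ⟨(i₂₃.sub i₁₄).div_const _, ?_⟩
  rw [integral_div, integral_sub i₂₃ i₁₄, integral_add i₂ i₃, integral_add i₁ i₄, h₃]
  change (_ + _ - (∫ w, (steeringOuter M ω k * (Q * X w * W)).trace
    * (steeringOuter M ω i * (Q * X w * W)).trace ∂P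
    + ∫ w, star (steeringOuter M ω k * (Q * X w * W)).trace
    * star (steeringOuter M ω i * (Q * X w * W)).trace ∂P)) / _ = _
  rw [h₁, h₄]
  change (∫ w, (steeringOuter M ω k * (Q * X w * W)).trace
    * star (steeringOuter M ω i * (Q * X w * W)).trace ∂P + (starRingEnd ℂ) (∫ w,
    (steeringOuter M ω k * (Q * X w * W)).trace
    * star (steeringOuter M ω i * (Q * X w * W)).trace ∂P) - _) / _ = _
  rw [h₂, Complex.add_conj, Complex.re_ofReal_mul]
  push_cast
  rw [add_zero, sub_zero, div_mul_eq_mul_div, div_div]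
  rw [show (4 : ℂ) * (a * b) = 2 * (2 * (a * b)) by ring, mul_div_mul_left _ _ two_ne_zero]

end ExpectedLeakage

/-! ### Expected leakages. -/

section ExpectedLeakage

variable {M K N : ℕ} {ω : Fin K → ℝ} {S : Matrix (Fin K) (Fin K) ℂ} {σ : ℝ} {μ : Fin K → ℝ}
  {e : Fin K → Fin M → ℂ} {Ω : Type*} [MeasurableSpace Ω] {P : Measure Ω}
  {X : Ω → Matrix (Fin M) (Fin M) ℂ} {c : ℝ}

lemma sampleCov_isHermitian (x : Fin N → Fin M → ℂ) : (sampleCov x).IsHermitian := by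
  rw [IsHermitian, sampleCov, conjTranspose_smul, conjTranspose_sum]
  simp [conjTranspose_vecMulVec]

/-- In the signal eigenbasis V† R V† is diagonal with entries μ_k/(μ_k − σ²)². This is the source of
the sum in E{ρ₁}. -/
lemma trace_pinvV_mul_mul {R : Matrix (Fin M) (Fin M) ℂ} (he : IsSignalEigensystem R μ e) :
    (pinvV σ μ e * R * pinvV σ μ e).trace = ((∑ k, μ k / (μ k - σ ^ 2) ^ 2 : ℝ) : ℂ) := by
  rw [pinvV_eq]
  set E := eigMat e
  set d := diagonal fun k => ((1 / (μ k - σ ^ 2) : ℝ) : ℂ) with hd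
  have h1 : E * d * Eᴴ * R * (E * d * Eᴴ) = E * (d * diagonal (fun k => (μ k : ℂ)) * d) * Eᴴ := by
    have h2 : E * d * Eᴴ * R * (E * d * Eᴴ) = E * d * (Eᴴ * (R * E)) * d * Eᴴ := by
      simp only [Matrix.mul_assoc]
    rw [h2, he.mul_eigMat, ← Matrix.mul_assoc Eᴴ, he.eigMat_orth, Matrix.one_mul]
    simp only [Matrix.mul_assoc]
  rw [h1, trace_mul_comm, ← Matrix.mul_assoc, he.eigMat_orth, Matrix.one_mul, hd,
    diagonal_mul_diagonal, diagonal_mul_diagonal, trace_diagonal]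
  push_cast
  refine Finset.sum_congr rfl fun k _ => ?_
  rw [div_mul_eq_mul_div, one_mul, div_mul_div_comm, mul_one, sq ((μ k : ℂ) - _)]

lemma trace_noiseProj {R : Matrix (Fin M) (Fin M) ℂ} (he : IsSignalEigensystem R μ e) :
    (noiseProj e).trace = M - K := by
  rw [noiseProj, trace_sub, he.trace_signalProj]
  simp

lemma integral_rho1 {R : Matrix (Fin M) (Fin M) ℂ} (he : IsSignalEigensystem R μ e)
    (hX : ∀ w, (X w).IsHermitian)
    (hY : HasCrossMoments (fun w => noiseProj e * X w * pinvV σ μ e) c (noiseProj e)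
      (pinvV σ μ e * R * pinvV σ μ e) P) :
    Integrable (fun w => rho1 K (noiseProj e) (pinvV σ μ e) (X w)) P ∧
    ∫ w, rho1 K (noiseProj e) (pinvV σ μ e) (X w) ∂P
      = ((c * ((M : ℝ) - K) / K * ∑ k, μ k / (μ k - σ ^ 2) ^ 2 : ℝ) : ℂ) := by
  simp only [rho1_eq_trace (noiseProj_isHermitian e) he.noiseProj_mul_self
    (pinvV_isHermitian σ μ e) (hX _)]
  refine ⟨hY.trace_star_mul_self.1.const_mul _, ?_⟩
  rw [integral_const_mul, hY.trace_star_mul_self.2, trace_pinvV_mul_mul he, trace_noiseProj he]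
  push_cast
  ring

lemma crossSum_eq (R Q W : Matrix (Fin M) (Fin M) ℂ) (hQQ : Q * Q = Q) :
    crossSum M ω R Q W = ∑ k, (steeringOuter M ω k * Q * complPartial Q ω k * (W * R * W)).trace
      / (2 * Complex.I * (star (steeringOne M (ω k)) ⬝ᵥ (Q *ᵥ steeringOne M (ω k)))) := by
  refine Finset.sum_congr rfl fun k _ => ?_
  have h1 : Q * partialA M ω k * ((arrayMatrix M ω)ᴴ * arrayMatrix M ω)⁻¹ * (arrayMatrix M ω)ᴴ
      * W * R * W = Q * (complPartial Q ω k * (W * R * W)) := by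
    simp only [complPartial, Matrix.mul_assoc]
    rw [← Matrix.mul_assoc Q Q, hQQ]
  rw [Matrix.mul_assoc _ (complPartial Q ω k), Matrix.mul_assoc _ Q, steeringOuter,
    trace_vecMulVec_mul, h1]

/-- The moments of the leading order leakage of the second step. -/
lemma integral_rho2 (hK : 0 < K) (hω : Function.Injective fun k => steering M (ω k))
    (hKM : K < M) (hS : S.PosDef) (he : IsSignalEigensystem (dataCov M ω S σ) μ e)
    (hX : ∀ w, (X w).IsHermitian)
    (hY : HasCrossMoments (fun w => noiseProj e * X w * pinvV σ μ e) c (noiseProj e)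
      (pinvV σ μ e * dataCov M ω S σ * pinvV σ μ e) P) (γ : ℝ) :
    Integrable (fun w => rho2 K γ (dataCov M ω S σ) (noiseProj e) (pinvV σ μ e) (X w)
      (dProj M ω (freqError M ω (noiseProj e) (pinvV σ μ e) (X w)))) P ∧
    ∫ w, rho2 K γ (dataCov M ω S σ) (noiseProj e) (pinvV σ μ e) (X w)
      (dProj M ω (freqError M ω (noiseProj e) (pinvV σ μ e) (X w))) ∂P
      = (1 - 2 * γ + γ ^ 2) * ∫ w, rho1 K (noiseProj e) (pinvV σ μ e) (X w) ∂P
        + 2 * (γ - γ ^ 2) / K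
          * (c * (((crossSum M ω (dataCov M ω S σ) (noiseProj e) (pinvV σ μ e)).re : ℝ) : ℂ))
        + γ ^ 2 / K * (c / 2 * quadSum M ω (dataCov M ω S σ) (noiseProj e) (pinvV σ μ e)) := by
  have hu := isUnit_det_gram hω hKM.le
  have hPA := projA_eq_signalProj hω hKM.le hS he
  have hmodel := isPinvSystem hK hω hKM.le hS he
  have hQ : noiseProj e = 1 - projA M ω := by rw [hPA, noiseProj]
  have hQH := noiseProj_isHermitian e
  have hQQ := he.noiseProj_mul_self
  have hWH := pinvV_isHermitian σ μ e
  have hρ := (integral_rho1 he hX hY).1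
  set R := dataCov M ω S σ with hR
  set Q := noiseProj e with hQdef
  set W := pinvV σ μ e
  set D : Ω → Matrix (Fin M) (Fin M) ℂ := fun w => dProj M ω (freqError M ω Q W (X w)) with hD
  have hDH : ∀ w, (D w).IsHermitian := fun w =>
    dProj_isHermitian hu fun k => star_freqError hQH hWH (hX w) k
  have hQDQ : ∀ w, Q * D w * Q = 0 := fun w => by
    rw [hQ]; exact compl_mul_dProj_mul_compl hu _
  have hQD : ∀ w, Q * D w = ∑ k, freqError M ω Q W (X w) k • complPartial Q ω k := fun w =>
    compl_mul_dProj hu hQ _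
  have hcross : Integrable (fun w => (W * X w * Q * D w).trace) P ∧
      ∫ w, (W * X w * Q * D w).trace ∂P = c * crossSum M ω R Q W := by
    simp only [fun w => trace_cross_eq hQH hQQ hWH (hX w) (hQD w)]
    have h1 := fun k => integral_freqError_mul_star (ω := ω) hQH hWH hX hY (complPartial Q ω k)ᴴ k
    refine ⟨integrable_finsetSum _ fun k _ => (h1 k).1, ?_⟩
    rw [integral_finsetSum _ fun k _ => (h1 k).1, crossSum_eq R Q W hQQ, Finset.mul_sum]
    refine Finset.sum_congr rfl fun k _ => ?_
    rw [(h1 k).2, conjTranspose_conjTranspose, mul_div_assoc]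
  have hquad : Integrable (fun w => (D w * Q * D w).trace) P ∧
      ∫ w, (D w * Q * D w).trace ∂P = c / 2 * quadSum M ω R Q W := by
    simp only [fun w => trace_quadratic_eq hu hQH hQQ (hDH w)
      (fun k => star_freqError hQH hWH (hX w) k) (hQD w)]
    have h1 := fun k i => integral_freqError_mul_freqError (ω := ω) hQH hWH hX hY k i
    refine ⟨integrable_finsetSum _ fun k _ => integrable_finsetSum _ fun i _ =>
      (h1 k i).1.const_mul _, ?_⟩
    rw [integral_finsetSum _ fun k _ => integrable_finsetSum _ fun i _ => (h1 k i).1.const_mul _,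
      quadSum, Finset.mul_sum]
    refine Finset.sum_congr rfl fun k _ => ?_
    rw [integral_finsetSum _ fun i _ => (h1 k i).1.const_mul _, Finset.mul_sum]
    refine Finset.sum_congr rfl fun i _ => ?_
    rw [integral_const_mul, (h1 k i).2]
    ring
  have hformula : ∀ w, rho2 K γ R Q W (X w) (D w) = rho2Formula K γ Q W (X w) (D w) := fun w =>
    rho2_eq_rho2Formula hmodel (dataCov_eq ω S σ) (hX w) (hDH w) rfl (hQDQ w) γ
  -- The coefficient c is real, so taking real parts commutes with multiplying by it.
  have hre : Integrable (fun w => (((W * X w * Q * D w).trace.re : ℝ) : ℂ)) P ∧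
      ∫ w, (((W * X w * Q * D w).trace.re : ℝ) : ℂ) ∂P
        = c * (((crossSum M ω R Q W).re : ℝ) : ℂ) := by
    refine ⟨hcross.1.re.ofReal, ?_⟩
    rw [integral_complex_ofReal]
    have h1 := integral_re hcross.1
    rw [hcross.2, RCLike.re_to_complex, Complex.re_ofReal_mul] at h1
    simp only [RCLike.re_to_complex] at h1
    rw [h1]
    push_cast
    rfl
  change Integrable (fun w => rho2 K γ R Q W (X w) (D w)) P ∧
    ∫ w, rho2 K γ R Q W (X w) (D w) ∂P = _
  simp only [hformula, rho2Formula]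
  have k₁ := hρ.const_mul ((1 : ℂ) - 2 * γ + γ ^ 2)
  have k₂ := hre.1.const_mul (2 * ((γ : ℂ) - γ ^ 2) / K)
  have k₃ := hquad.1.const_mul ((γ : ℂ) ^ 2 / K)
  have k₁₂ : Integrable (fun w => ((1 : ℂ) - 2 * γ + γ ^ 2) * rho1 K Q W (X w)
    + 2 * ((γ : ℂ) - γ ^ 2) / K * (((W * X w * Q * D w).trace.re : ℝ) : ℂ)) P := k₁.add k₂
  refine ⟨k₁₂.add k₃, ?_⟩
  rw [integral_add k₁₂ k₃, integral_add k₁ k₂, integral_const_mul, integral_const_mul,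
    integral_const_mul, hre.2, hquad.2]

end ExpectedLeakage

/-! ### Assembly of the theorem. -/

theorem mainTheorem2
    {M K N : ℕ} (hK : 0 < K) (hKM : K < M) (hN : 0 < N)
    (d lam : ℝ) (hd : 0 < d) (hlam : 0 < lam) (hdlam : d ≤ lam / 2)
    -- the true DOAs, with pairwise distinct steering vectors
    (θ : Fin K → ℝ) (hθ : Monotone θ)
    (hθ_mem : ∀ k, θ k ∈ Set.Icc (-(Real.pi / 2)) (Real.pi / 2))
    (hθ_inj : Function.Injective fun k => steering M (electricalAngle d lam (θ k)))
    (S : Matrix (Fin K) (Fin K) ℂ) (hS : S.PosDef) (σ : ℝ) (hσ : 0 < σ)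
    -- signal eigenvalues and eigenvectors of the covariance matrix
    (μ : Fin K → ℝ) (e : Fin K → Fin M → ℂ)
    (he : IsSignalEigensystem (dataCov M (fun k => electricalAngle d lam (θ k)) S σ) μ e)
    -- the random sources and the noise at the times of the snapshots
    {Ω : Type*} [MeasurableSpace Ω] (Pr : Measure Ω) [IsProbabilityMeasure Pr]
    (s : Fin N → Ω → Fin K → ℂ) (n : Fin N → Ω → Fin M → ℂ)
    (hs_meas : ∀ t, Measurable (s t)) (hn_meas : ∀ t, Measurable (n t))
    (hs_mem : ∀ t i, MemLp (fun w => s t w i) 2 Pr)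
    (hs_cov : ∀ t i j, ∫ w, s t w i * star (s t w j) ∂Pr = S i j)
    (hn_law : ∀ t, Pr.map (n t) = Measure.pi fun _ : Fin M => complexGaussian (σ ^ 2))
    (hn_indep : iIndepFun n Pr)
    (hsn_indep : IndepFun (fun w t => s t w) (fun w t => n t w) Pr) :
    let ω : Fin K → ℝ := fun k => electricalAngle d lam (θ k)
    let A := arrayMatrix M ω
    let R := dataCov M ω S σ
    let Pperp := noiseProj e
    let Vd := pinvV σ μ e
    let ΔRs : Ω → Matrix (Fin M) (Fin M) ℂ :=
      fun w => sampleCov (fun t => A *ᵥ s t w + n t w) - R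
    let ρ₁ : Ω → ℂ := fun w => rho1 K Pperp Vd (ΔRs w)
    let ρ₂ : ℝ → Ω → ℂ := fun γ w =>
      rho2 K γ R Pperp Vd (ΔRs w) (dProj M ω (freqError M ω Pperp Vd (ΔRs w)))
    -- `P_A + dP` is the first order Taylor expansion of the projection around the true DOAs
    (∀ i j, (fun Δω : Fin K → ℝ => projA M (ω + Δω) i j - signalProj e i j
        - dProj M ω (fun k => (Δω k : ℂ)) i j) =O[𝓝 0] fun Δω => ‖Δω‖ ^ 2) ∧
    -- the formula for the leading order leakage of the second step
    (∀ (γ : ℝ) (ΔR : Matrix (Fin M) (Fin M) ℂ) (Δω : Fin K → ℝ), ΔR.IsHermitian →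
      rho2 K γ R Pperp Vd ΔR (dProj M ω fun k => (Δω k : ℂ)) =
        rho2Formula K γ Pperp Vd ΔR (dProj M ω fun k => (Δω k : ℂ))) ∧
    -- the actual leakages of the two-step method agree with the formulas to leading order
    ((∀ k, θ k ∈ Set.Ioo (-(Real.pi / 2)) (Real.pi / 2)) → ∀ γ : ℝ,
      ∃ C δ : ℝ, 0 < δ ∧ ∀ ε ≤ δ, ∀ ΔR : Matrix (Fin M) (Fin M) ℂ,
        ΔR.IsHermitian → (∀ i j, ‖ΔR i j‖ ≤ ε) →
        (∃ θhat : Fin K → ℝ, IsRootMusicEstimate d lam (R + ΔR) θhat) ∧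
        (∀ (μ₁ : Fin K → ℝ) (e₁ : Fin K → Fin M → ℂ), IsSignalEigensystem (R + ΔR) μ₁ e₁ →
          ‖(subspaceLeakage Pperp e₁ : ℂ) - rho1 K Pperp Vd ΔR‖ ≤ C * ε ^ 3) ∧
        ∀ θhat : Fin K → ℝ, IsRootMusicEstimate d lam (R + ΔR) θhat →
          let ωhat : Fin K → ℝ := fun k => electricalAngle d lam (θhat k)
          (∀ k, ‖((ωhat k - ω k : ℝ) : ℂ) - freqError M ω Pperp Vd ΔR k‖ ≤ C * ε ^ 2) ∧
          ∀ (μ₂ : Fin K → ℝ) (e₂ : Fin K → Fin M → ℂ),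
            IsSignalEigensystem (modifiedCov γ (R + ΔR) (projA M ωhat)) μ₂ e₂ →
            ‖(subspaceLeakage Pperp e₂ : ℂ) - rho2Formula K γ Pperp Vd ΔR
              (dProj M ω fun k => ((ωhat k - ω k : ℝ) : ℂ))‖ ≤ C * ε ^ 3) ∧
    -- the expected leakages
    Integrable ρ₁ Pr ∧
    (∫ w, ρ₁ w ∂Pr = ((σ ^ 2 * ((M : ℝ) - K) / (N * K)
      * ∑ k, μ k / (μ k - σ ^ 2) ^ 2 : ℝ) : ℂ)) ∧
    (∀ γ : ℝ, Integrable (ρ₂ γ) Pr ∧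
      ∫ w, ρ₂ γ w ∂Pr = (1 - 2 * γ + γ ^ 2) * ∫ w, ρ₁ w ∂Pr
        + 2 * (γ - γ ^ 2) * σ ^ 2 / (N * K) * (((crossSum M ω R Pperp Vd).re : ℝ) : ℂ)
        + γ ^ 2 * σ ^ 2 / (2 * N * K) * quadSum M ω R Pperp Vd) ∧
    -- the special cases `γ = 0` and `γ = 1`
    (∫ w, ρ₂ 0 w ∂Pr = ∫ w, ρ₁ w ∂Pr) ∧
    (∫ w, ρ₂ 1 w ∂Pr = σ ^ 2 / (2 * N * K) * quadSum M ω R Pperp Vd) := by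
  intro ω A R Pperp Vd ΔRs ρ₁ ρ₂
  have hω : Function.Injective fun k => steering M (ω k) := hθ_inj
  have hmono : StrictMono ω := strictMono_electricalAngle hd hlam hθ hθ_mem hθ_inj
  have hu := isUnit_det_gram hω hKM.le
  have hPA := projA_eq_signalProj hω hKM.le hS he
  have hX : ∀ w, (ΔRs w).IsHermitian := fun w =>
    (sampleCov_isHermitian _).sub (dataCov_isHermitian hS ω σ)
  have hY : HasCrossMoments (fun w => noiseProj e * ΔRs w * pinvV σ μ e)
      ((σ ^ 2 / N : ℝ) : ℂ) (noiseProj e) (pinvV σ μ e * dataCov M ω S σ * pinvV σ μ e) Pr := by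
    have h := hasCrossMoments_sampleCov hK hω hKM hN hS he hs_meas hn_meas hs_mem hs_cov hn_law
      hn_indep hsn_indep
    have hc : ((σ ^ 2 / N : ℝ) : ℂ) = ((σ ^ 2 : ℝ) : ℂ) / N := by push_cast; rfl
    rw [hc]
    exact h
  have hρ₁ := integral_rho1 he hX hY
  have hρ₂ : ∀ γ : ℝ, Integrable (ρ₂ γ) Pr ∧
      ∫ w, ρ₂ γ w ∂Pr = (1 - 2 * γ + γ ^ 2) * ∫ w, ρ₁ w ∂Pr
        + 2 * (γ - γ ^ 2) * σ ^ 2 / (N * K) * (((crossSum M ω R Pperp Vd).re : ℝ) : ℂ)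
        + γ ^ 2 * σ ^ 2 / (2 * N * K) * quadSum M ω R Pperp Vd := fun γ => by
    obtain ⟨h1, h2⟩ := integral_rho2 hK hω hKM hS he hX hY γ
    refine ⟨h1, h2.trans ?_⟩
    push_cast
    congr 1
    · congr 1
      rw [← mul_assoc, div_mul_div_comm, mul_comm (K : ℂ)]
    · rw [← mul_assoc, div_div, div_mul_div_comm]
      congr 2
      ring
  refine ⟨fun i j => ?_, fun γ ΔR Δω hΔ => ?_, fun hθ' γ => ?_, hρ₁.1, ?_, hρ₂, ?_, ?_⟩
  · simp only [← hPA]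
    exact isBigO_projA_sub hu i j
  · refine rho2_eq_rho2Formula (isPinvSystem hK hω hKM.le hS he) (dataCov_eq ω S σ) hΔ
      (dProj_isHermitian hu fun k => ?_) rfl ?_ γ
    · rw [Complex.star_def, Complex.conj_ofReal]
    · have h := compl_mul_dProj_mul_compl hu fun k => (Δω k : ℂ)
      rw [hPA] at h
      exact h
  · exact twoStep_expansion hK hKM hd hlam hdlam rfl hω hmono hS he hθ' γ
  · refine hρ₁.2.trans ?_
    congr 2
    rw [div_mul_eq_mul_div, div_div]
  · rw [(hρ₂ 0).2]
    simp
  · rw [(hρ₂ 1).2]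
    norm_num
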